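/- **Setting.** Let $M$ be a 3-manifold, let $f,f'$ be $C^k$-diffeomorphisms of $M$ with $3\le k\le\infty$, and let $p$ (resp. $p'$) be a fixed point of $f$ (resp. $f'$). Suppose that around $p$ there are $C^k$ coordinates $(z,t)\in\mathbb{C}\times\mathbb{R}$, centred at $p$, in which $f$ is the linear map $(z,t)\mapsto(re^{\sqrt{-1}\theta}z,\lambda t)$ with $r>1$, $\theta\notin\pi\mathbb{Z}$, $0<\lambda<1$, and that around $p'$ there are $C^k$ coordinates $(z',t')$ centred at $p'$ in which $f'$ is $(z',t')\mapsto(r'e^{\sqrt{-1}\theta'}z',\lambda' t')$ with $r'>1$, $\theta'\notin\pi\mathbb{Z}$, $0<\lambda'<1$. Let $a,a'>0$ be such that these coordinates cover the cylinders $\{|z|\le a,\ |t|\le a\}$ and $\{|z'|\le a',\ |t'|\le a'\}$, and let $D_a(p)=\{|z|\le a,\ t=0\}$, $D_{a'}(p')=\{|z'|\le a',\ t'=0\}$ be the corresponding disks in the local unstable manifolds $W^u_{\mathrm{loc}}(p)$, $W^u_{\mathrm{loc}}(p')$. Let $q\in D_a(p)$ and $q'\in D_{a'}(p')$ be homoclinic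 points of $p$ and $p'$ at which the stable curve and the unstable surface have a quadratic tangency (contact of order exactly two). Assume that $q$ is *positively associated* with $p$: for all large $n$ and every small arc $\alpha$ of $W^s(p)$ around $q$, the point $f^n(q)$ and the set $f^{-n}(\alpha\setminus\{q\})$ lie in the same component ($t>0$ or $t<0$) of the open cylinder $\{|z|<a,\ |t|<a\}$ minus $W^u_{\mathrm{loc}}(p)$. Assume likewise that $q'$ is positively associated with $p'$. Assume that $\theta/2\pi$ is irrational, and that $h:M\to M$ is a homeomorphism with $h\circ f=f'\circ h$, $h(p)=p'$ and $h(q)=q'$. **Corollary C.** There is a transverse homoclinic point $s$ of $p$ (a point other than $p$ at which $W^s(p)$ and $W^u(p)$ intersect transversely) with $s\in D_a(p)$ and $h(s)\in D_{a'}(p')$. For every such $s$, writing $s'=h(s)$: 1. if $h|_{W^u_{\mathrm{loc}}(p)}$ preserves orientation near $p$ (with respect to the coordinates $z$, $z'$), then $\dfrac{z(s)}{z(q)}=\dfrac{z'(s')}{z'(q')}$; 2. otherwise, $\dfrac{z(s)}{z(q)}=\overline{\left(\dfrac{z'(s')}{z'(q')}\right)}$. In particular $z(s)/z(q)$, up to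 complex conjugation, is a modulus: the unordered pair consisting of $z(s)/z(q)$ and its complex conjugate equals the unordered pair consisting of $z'(s')/z'(q')$ and its complex conjugate. -/

import Mathlib

open Filter Topology
open scoped Manifold ContDiff

/-- The model space of a `3`-manifold without boundary. -/
abbrev E3 : Type := EuclideanSpace ℝ (Fin 3)

section SaddleFocus

variable {M : Type*}

/-- `x` is a homoclinic point of the fixed point `p` of `f`: it is different from `p` and lies both
in the stable set `W^s(p)` and in the unstable set `W^u(p)`. -/
def IsHomoclinic [TopologicalSpace M] (f : M ≃ M) (p x : M) : Prop :=
  x ≠ p ∧ Tendsto (fun n : ℕ => f^[n] x) atTop (𝓝 p) ∧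
    Tendsto (fun n : ℕ => f.symm^[n] x) atTop (𝓝 p)

/-- `p` is a fixed point of saddle-focus type of `f`, and `φ = (z, t)` is a `C^k` coordinate system
around `p`, with values in `ℂ × ℝ`, in which `f` is the linear map
`(z, t) ↦ (r e^{iθ} z, lam t)`, where `r > 1`, `θ ≠ 0 mod π`, `0 < lam < 1`.  The coordinates
cover the closed cylinder of radius and half-height `a > 0`. -/
structure IsLinearizingChart [TopologicalSpace M] [ChartedSpace E3 M] (k : ℕ∞) (f : M ≃ M) (p : M)
    (r θ lam a : ℝ) (φ : OpenPartialHomeomorph M (ℂ × ℝ)) : Prop where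
  fixed : f p = p
  mem_source : p ∈ φ.source
  map_base : φ p = 0
  contMDiffOn : ContMDiffOn 𝓘(ℝ, E3) 𝓘(ℝ, ℂ × ℝ) k φ φ.source
  contMDiffOn_symm : ContMDiffOn 𝓘(ℝ, ℂ × ℝ) 𝓘(ℝ, E3) k φ.symm φ.target
  linear : ∀ x ∈ φ.source, f x ∈ φ.source →
    φ (f x) = ((r : ℂ) * Complex.exp (θ * Complex.I) * (φ x).1, lam * (φ x).2)
  one_lt_r : 1 < r
  theta_ne : ∀ m : ℤ, θ ≠ m * Real.pi
  lam_pos : 0 < lam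
  lam_lt_one : lam < 1
  a_pos : 0 < a
  cylinder_subset : Metric.closedBall (0 : ℂ) a ×ˢ Set.Icc (-a) a ⊆ φ.target

/-- The disk `D_a(p) = {|z| ≤ a, t = 0}` in the local unstable manifold of `p`. -/
def unstableDisk [TopologicalSpace M] (φ : OpenPartialHomeomorph M (ℂ × ℝ)) (a : ℝ) : Set M :=
  {x | x ∈ φ.source ∧ ‖(φ x).1‖ ≤ a ∧ (φ x).2 = 0}

/-- The segment `{z = 0, |t| ≤ a}` in the local stable manifold of `p`. -/
def stableSegment [TopologicalSpace M] (φ : OpenPartialHomeomorph M (ℂ × ℝ)) (a : ℝ) : Set M :=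
  {x | x ∈ φ.source ∧ (φ x).1 = 0 ∧ |(φ x).2| ≤ a}

/-- If `f^N x` lies on the local stable segment, then `τ ↦ f^{-N} (φ⁻¹ (0, τ))` parametrizes
regularly the branch of `W^s(p)` through `x`; the point `x` has parameter `t (f^N x)`. -/
noncomputable def stableArc [TopologicalSpace M] (f : M ≃ M) (φ : OpenPartialHomeomorph M (ℂ × ℝ)) (N : ℕ)
    (τ : ℝ) : M :=
  f.symm^[N] (φ.symm (0, τ))

/-- If moreover `f^{-K} x` lies in the local unstable disk, then `y ↦ t (f^{-K} y)` is, near `x`, a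
regular defining function of the branch of `W^u(p)` through `x`.  This is its restriction to the
branch of `W^s(p)` through `x`: its order of vanishing is the order of contact at `x`. -/
noncomputable def contactFunction [TopologicalSpace M] (f : M ≃ M) (φ : OpenPartialHomeomorph M (ℂ × ℝ))
    (N K : ℕ) (τ : ℝ) : ℝ :=
  (φ (f.symm^[K] (stableArc f φ N τ))).2

/-- `x` is a homoclinic point of `p` at which the curve `W^s(p)` and the surface `W^u(p)` have a
quadratic tangency: the contact function vanishes at `x` to order exactly two. -/
def IsQuadraticTangency [TopologicalSpace M] (f : M ≃ M) (p : M)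
    (φ : OpenPartialHomeomorph M (ℂ × ℝ)) (a : ℝ) (x : M) : Prop :=
  IsHomoclinic f p x ∧ ∃ N K : ℕ, f^[N] x ∈ stableSegment φ a ∧ f.symm^[K] x ∈ unstableDisk φ a ∧
    deriv (contactFunction f φ N K) (φ (f^[N] x)).2 = 0 ∧
    deriv (deriv (contactFunction f φ N K)) (φ (f^[N] x)).2 ≠ 0

/-- `x` is a homoclinic point of `p` at which the curve `W^s(p)` and the surface `W^u(p)` intersect
transversely: the contact function vanishes at `x` to order exactly one. -/
def IsTransverseHomoclinic [TopologicalSpace M] (f : M ≃ M) (p : M)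
    (φ : OpenPartialHomeomorph M (ℂ × ℝ)) (a : ℝ) (x : M) : Prop :=
  IsHomoclinic f p x ∧ ∃ N K : ℕ, f^[N] x ∈ stableSegment φ a ∧ f.symm^[K] x ∈ unstableDisk φ a ∧
    deriv (contactFunction f φ N K) (φ (f^[N] x)).2 ≠ 0

/-- `x` and `y` lie in the same component of `U ∖ W^u_loc(p)`, where `U` is the open cylinder
`{|z| < a, |t| < a}`: the two components are given by `t > 0` and `t < 0`. -/
def SameSide [TopologicalSpace M] (φ : OpenPartialHomeomorph M (ℂ × ℝ)) (a : ℝ) (x y : M) : Prop :=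
  (x ∈ φ.source ∧ ‖(φ x).1‖ < a ∧ |(φ x).2| < a) ∧
  (y ∈ φ.source ∧ ‖(φ y).1‖ < a ∧ |(φ y).2| < a) ∧
  0 < (φ x).2 * (φ y).2

/-- The homoclinic tangency `q` is positively associated with `p`: for all large `n` and every
small arc `α` of `W^s(p)` around `q`, the point `f^n q` and the set `f^{-n} (α ∖ {q})` lie in the
same component of `U ∖ W^u_loc(p)`. -/
def IsPositivelyAssociated [TopologicalSpace M] (f : M ≃ M)
    (φ : OpenPartialHomeomorph M (ℂ × ℝ)) (a : ℝ) (q : M) : Prop :=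
  ∃ N : ℕ, f^[N] q ∈ stableSegment φ a ∧
    ∀ᶠ n : ℕ in atTop, ∀ᶠ τ in 𝓝[≠] (φ (f^[N] q)).2,
      SameSide φ a (f^[n] q) (f.symm^[n] (stableArc f φ N τ))

/-- The expression of a map `h` between local unstable manifolds in the coordinates `z`, `z'`. -/
noncomputable def unstableExpr [TopologicalSpace M] (φ φ' : OpenPartialHomeomorph M (ℂ × ℝ)) (h : M → M)
    (z : ℂ) : ℂ :=
  (φ' (h (φ.symm (z, 0)))).1

/-- A map `g` of the plane with `g 0 = 0`, injective and continuous near `0`, preserves orientation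
iff it takes small positively oriented circles around `0` to loops of winding number `1` around
`0`.  Here `A` is a continuous choice of the argument (in turns) of `g` along such a circle. -/
def PreservesOrientation (g : ℂ → ℂ) : Prop :=
  ∃ ε > 0, ∀ ρ : ℝ, 0 < ρ → ρ < ε → ∃ A : ℝ → ℝ, Continuous A ∧
    (∀ t : ℝ, A (t + 1) = A t + 1) ∧
    ∀ t : ℝ, g (ρ * Complex.exp (2 * Real.pi * t * Complex.I)) ≠ 0 ∧
      g (ρ * Complex.exp (2 * Real.pi * t * Complex.I)) =
        ‖g (ρ * Complex.exp (2 * Real.pi * t * Complex.I))‖ *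
          Complex.exp (2 * Real.pi * A t * Complex.I)

/-- The complex number `z(s) / z(q)`. -/
noncomputable def zRatio [TopologicalSpace M] (φ : OpenPartialHomeomorph M (ℂ × ℝ)) (q s : M) : ℂ :=
  (φ s).1 / (φ q).1

end SaddleFocus

/-! ### Continuous injective endomorphisms of the circle -/

section CircleGroup

/-! In the linearizing charts `h` becomes a local conjugacy `H` between diagonal maps. It preserves
the unstable disks and the stable axes. Let `g` be its restriction to the unstable disk. The claim
reduces to `g z = C z` or `g z = C z̄` near 0: ratios `z(s)/z(q)` do not change under `f⁻ⁿ`, so they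
may be computed near `p`, and the two cases correspond to whether orientation is preserved. Three
arguments give this form.

Radiality. Move `q` by iterates to `(0, τ₀)` on the stable axis. There the unstable surface is `{E =
0}` with `E = c₀ · (height ∘ f⁻ᵐ)`, and the quadratic tangency says that `E(0, ·)` has a
nondegenerate minimum with value 0 at `τ₀`, while the horizontal derivative of `E` is `x ↦ -Re(αx)`
with `α ≠ 0`. To first order the surface therefore projects onto the half-plane `Re(αx) ≥ 0`. Its
iterates accumulate on rotated half-disks, and `H` must respect these (`IsFold.half_plane`): if
`(e^{iθ}, e^{iθ'})ⁿ` accumulates at `(u, u')`, the half-disk rotated by `u` goes into the one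
rotated by `u'`. Two distinct half-planes cannot correspond to the same one, so the closed group of
pairs `(u, u')` is the graph of a continuous injective endomorphism of the circle, which is defined
everywhere because `θ/2π` is irrational. Hence `u' = u` or `u' = u⁻¹`, and intersecting half-planes
shows that `g` sends rays to rays (`radial_of_half_planes`).

Transverse returns. Positive association gives `c₀τ₀ > 0`, so the stable arc near `q`, pulled back
by `f⁻ⁿ`, is stretched vertically on the side where the fold lies. Whenever its base point lies
strictly inside the half-plane, the intermediate value theorem makes the arc cross the fold
(`IsFold.eventually_exists_return`). The crossing is transverse, since both slopes are of
square-root type and dominate the horizontal error (`IsFold.eventually_deriv_return_ne_zero`).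
Radiality allows the same `n` for both maps, so one homoclinic point is transverse for `f` and has
an image transverse for `f'`.

Linearity. At such a point, with disk coordinate `ζ`, the unstable disk is a graph over its own
linearization, through differentiable local parametrizations `F`, `F'` with `F 0 = ζ` and `F' 0 = g
ζ`. The conjugacy then relates the germ of `g` at `ζ` to the values of `g` near 0. A radial map
transports arguments rigidly, so comparing first-order angular displacements gives `r = r'` and
shows that the radial factor of `g` is constant (`linear_of_radial_of_comparison`). -/

theorem Circle.sq_eq_one_iff {u : Circle} : u ^ 2 = 1 ↔ u = 1 ∨ u = -1 := by
  constructor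
  · intro hu
    have h1 : (u : ℂ) ^ 2 = 1 := by rw [← Circle.coe_pow, hu, Circle.coe_one]
    rcases mul_self_eq_one_iff.1 ((pow_two _).symm.trans h1) with h | h
    · left; exact Circle.ext h
    · right; exact Circle.ext (by simpa using h)
  · rintro (rfl | rfl) <;> simp

/-- The only continuous injective endomorphisms of the circle group are the identity and the
inversion; first under the normalization that `i` is fixed. -/
theorem Circle.eq_id_of_continuous_injective_of_fix {κ : Circle →* Circle} (hc : Continuous κ)
    (hi : Function.Injective κ) (hI : κ (Circle.exp (Real.pi / 2)) = Circle.exp (Real.pi / 2))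
    (u : Circle) : κ u = u := by
  -- Positivity of the real part selects the correct square root in the dyadic induction `hdy`. If
  -- the real part vanished at some `y` in the interval, `κ (exp y)` and `κ (exp (π/2))` would both
  -- have square `-1`. Injectivity would give `exp (2iy) = -1`, contrary to `cos y > 0`.
  have hre : ∀ x ∈ Set.Ioo (-(Real.pi / 2)) (Real.pi / 2),
      0 < ((κ (Circle.exp x) : Circle) : ℂ).re := by
    intro x hx
    by_contra! hneg
    have hcont : Continuous fun y : ℝ => ((κ (Circle.exp y) : Circle) : ℂ).re := by fun_prop
    have h0 : (0 : ℝ) ∈ Set.Ioo (-(Real.pi / 2)) (Real.pi / 2) := by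
      constructor <;> linarith [Real.pi_pos]
    obtain ⟨y, hy, hy0⟩ := (isPreconnected_Ioo (a := -(Real.pi / 2)) (b := Real.pi / 2)).intermediate_value
      hx h0 hcont.continuousOn (show (0:ℝ) ∈ Set.Icc _ _ from ⟨hneg, by simp⟩)
    have hsq : (((κ (Circle.exp y)) ^ 2 : Circle) : ℂ) = -1 := by
      have h1 : Complex.normSq (κ (Circle.exp y) : ℂ) = 1 := Circle.normSq_coe _
      rw [Complex.normSq_apply] at h1
      simp only at hy0
      rw [Circle.coe_pow]
      apply Complex.ext
      · simp [pow_two, hy0]; simp [hy0] at h1; linarith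
      · simp [pow_two, hy0]
    have h2 : κ ((Circle.exp y) ^ 2) = κ ((Circle.exp (Real.pi / 2)) ^ 2) := by
      rw [map_pow, map_pow, hI]
      apply Circle.ext
      rw [hsq, ← Circle.exp_natCast_mul]
      simp [Circle.coe_exp, mul_div_cancel₀]
    have h3 := hi h2
    have h4 : (((Circle.exp y) ^ 2 : Circle) : ℂ) = -1 := by
      rw [h3, ← Circle.exp_natCast_mul]
      simp [Circle.coe_exp, mul_div_cancel₀]
    have h5 : Real.cos (2 * y) = -1 := by
      rw [← Circle.exp_natCast_mul, Circle.coe_exp] at h4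
      have := congrArg Complex.re h4
      rw [Complex.exp_ofReal_mul_I_re] at this
      simpa using this
    have h6 : 0 < Real.cos y := Real.cos_pos_of_mem_Ioo hy
    rw [Real.cos_two_mul] at h5
    nlinarith
  have hdy : ∀ k : ℕ, κ (Circle.exp (Real.pi / 2 / 2 ^ k)) = Circle.exp (Real.pi / 2 / 2 ^ k) := by
    intro k
    induction k with
    | zero => simpa using hI
    | succ k ih =>
      set x : ℝ := Real.pi / 2 / 2 ^ (k + 1) with hx
      have hxx : Circle.exp (Real.pi / 2 / 2 ^ k) = Circle.exp x ^ 2 := by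
        rw [← Circle.exp_natCast_mul]; rw [hx, pow_succ]; congr 1; push_cast; field_simp
      have hxm : x ∈ Set.Ioo (-(Real.pi / 2)) (Real.pi / 2) := by
        have : 0 < x := by rw [hx]; positivity
        refine ⟨by linarith [Real.pi_pos], ?_⟩
        rw [hx]
        apply div_lt_self (by positivity)
        exact one_lt_pow₀ (by norm_num) (by omega)
      rw [hxx, map_pow] at ih
      have h1 : (κ (Circle.exp x) / Circle.exp x) ^ 2 = 1 := by rw [div_pow, ih, div_self']
      rcases Circle.sq_eq_one_iff.1 h1 with h | h
      · exact div_eq_one.1 h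
      · exfalso
        rw [div_eq_iff_eq_mul] at h
        have h2 := hre x hxm
        rw [h] at h2
        have h3 : 0 < Real.cos x := Real.cos_pos_of_mem_Ioo hxm
        have h4 : ((Circle.exp x : Circle) : ℂ).re = Real.cos x := by
          rw [Circle.coe_exp, Complex.exp_ofReal_mul_I_re]
        simp only [neg_mul, one_mul, Circle.coe_neg, Complex.neg_re] at h2
        rw [h4] at h2
        linarith
  let D : AddSubgroup ℝ :=
    { carrier := {x | κ (Circle.exp x) = Circle.exp x}
      add_mem' := by
        intro x y hx hy
        simp only [Set.mem_ofPred_eq] at hx hy ⊢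
        rw [Circle.exp_add, map_mul, hx, hy]
      zero_mem' := by simp
      neg_mem' := by
        intro x hx
        simp only [Set.mem_ofPred_eq] at hx ⊢
        rw [Circle.exp_neg, map_inv, hx] }
  have hD : Dense (D : Set ℝ) := by
    apply AddSubgroup.dense_of_not_isolated_zero
    intro ε hε
    obtain ⟨k, hk⟩ := exists_pow_lt_of_lt_one (show 0 < ε / (Real.pi / 2) by positivity)
      (show (1 / 2 : ℝ) < 1 by norm_num)
    refine ⟨Real.pi / 2 / 2 ^ k, hdy k, by positivity, ?_⟩
    rw [lt_div_iff₀ (by positivity)] at hk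
    calc Real.pi / 2 / 2 ^ k = (1 / 2) ^ k * (Real.pi / 2) := by rw [one_div, inv_pow]; ring
      _ < ε := hk
  have hclosed : IsClosed (D : Set ℝ) :=
    isClosed_eq (hc.comp (by fun_prop)) (by fun_prop)
  have hall : (D : Set ℝ) = Set.univ := by rw [← hclosed.closure_eq]; exact hD.closure_eq
  have : Complex.arg u ∈ (D : Set ℝ) := by rw [hall]; trivial
  simpa [D] using this

/-- Injectivity forces `κ (-1) = -1`, hence `κ I = ± I`. The minus sign is reduced to the normalized
case by passing to the pointwise inverse of `κ`. -/
theorem Circle.eq_id_or_inv_of_continuous_injective {κ : Circle →* Circle} (hc : Continuous κ)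
    (hi : Function.Injective κ) : (∀ u, κ u = u) ∨ (∀ u, κ u = u⁻¹) := by
  set I : Circle := Circle.exp (Real.pi / 2) with hI
  have hI2 : I ^ 2 = -1 := by
    rw [hI, ← Circle.exp_natCast_mul]; apply Circle.ext; simp [Circle.coe_exp, mul_div_cancel₀]
  have hne : (-1 : Circle) ≠ 1 := by
    intro h
    have := congrArg (fun z : Circle => (z : ℂ).re) h
    norm_num at this
  have hneg : κ (-1) = -1 := by
    have h1 : κ (-1) ^ 2 = 1 := by rw [← map_pow]; simp
    rcases Circle.sq_eq_one_iff.1 h1 with h | h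
    · exact absurd (hi (h.trans (map_one κ).symm)) hne
    · exact h
  have h2 : (κ I / I) ^ 2 = 1 := by rw [div_pow, ← map_pow, hI2, hneg, div_self']
  rcases Circle.sq_eq_one_iff.1 h2 with h | h
  · left
    exact Circle.eq_id_of_continuous_injective_of_fix hc hi (div_eq_one.1 h)
  · right
    have h3 : κ I = I⁻¹ := by
      rw [div_eq_iff_eq_mul] at h
      rw [h, eq_inv_iff_mul_eq_one, mul_assoc, ← pow_two, hI2]; simp
    have h4 := Circle.eq_id_of_continuous_injective_of_fix (κ := κ⁻¹) (hc.inv)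
      (fun x y hxy => hi (inv_injective hxy)) (by
        rw [MonoidHom.inv_apply, h3, inv_inv])
    intro u
    rw [← h4 u, MonoidHom.inv_apply, inv_inv]
    rw [← MonoidHom.inv_apply, h4]

end CircleGroup

/-! ### Joint orbits of two rotations and radial maps -/

section RotationPairs

/-- The closure of the cyclic subgroup generated by a pair of rotations. -/
noncomputable def rotationClosure (a b : Circle) : Subgroup (Circle × Circle) :=
  (Subgroup.zpowers (a, b)).topologicalClosure

/-- In a compact group the cluster points of the forward powers already fill the closed subgroup
generated by the element. Only forward iterates are therefore needed. A single filter `l` makes both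
rotations converge simultaneously. -/
theorem mem_rotationClosure_iff {a b u u' : Circle} :
    (u, u') ∈ rotationClosure a b ↔ ∃ l : Filter ℕ, l.NeBot ∧ l ≤ atTop ∧
      Tendsto (fun n : ℕ => a ^ n) l (𝓝 u) ∧ Tendsto (fun n : ℕ => b ^ n) l (𝓝 u') := by
  rw [rotationClosure, ← mapClusterPt_atTop_pow_iff_mem_topologicalClosure_zpowers]
  constructor
  · intro h
    obtain ⟨U, hU, hUt⟩ := mapClusterPt_iff_ultrafilter.1 h
    refine ⟨U, inferInstance, hU, ?_, ?_⟩
    · exact (continuous_fst.tendsto (u, u')).comp hUt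
    · exact (continuous_snd.tendsto (u, u')).comp hUt
  · rintro ⟨l, hl, hle, h1, h2⟩
    have : Tendsto (fun n : ℕ => (a, b) ^ n) l (𝓝 (u, u')) := by
      simpa using h1.prodMk_nhds h2
    exact this.mapClusterPt.mono hle

theorem swap_mem_rotationClosure {a b u u' : Circle} (h : (u, u') ∈ rotationClosure a b) :
    (u', u) ∈ rotationClosure b a := by
  obtain ⟨l, hl, hle, h1, h2⟩ := mem_rotationClosure_iff.1 h
  exact mem_rotationClosure_iff.2 ⟨l, hl, hle, h2, h1⟩

theorem mk_mem_rotationClosure (a b : Circle) : (a, b) ∈ rotationClosure a b :=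
  Subgroup.le_topologicalClosure _ (Subgroup.mem_zpowers _)

/-- Density provides an ultrafilter along which `aⁿ` tends to `u`. Along it `bⁿ` converges by
compactness. -/
theorem exists_mem_rotationClosure {a : Circle} (ha : DenseRange fun n : ℤ => a ^ n) (b u : Circle) :
    ∃ u', (u, u') ∈ rotationClosure a b := by
  have h1 : MapClusterPt u atTop (a ^ · : ℕ → Circle) := by
    rw [mapClusterPt_atTop_pow_iff_mem_topologicalClosure_zpowers]
    exact ha u
  obtain ⟨U, hU, hUt⟩ := mapClusterPt_iff_ultrafilter.1 h1
  obtain ⟨u', -, hu'⟩ := isCompact_univ.ultrafilter_le_nhds (U.map fun n : ℕ => b ^ n) (by simp)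
  exact ⟨u', mem_rotationClosure_iff.2 ⟨U, inferInstance, hU, hUt, hu'⟩⟩

/-- The two hypotheses make both projections of the closed subgroup injective, and density makes the
first one onto. By compactness the first projection is a homeomorphism, so the second composed with
its inverse is a continuous injective endomorphism of the circle. -/
theorem rotationClosure_eq_graph {a b : Circle} (ha : DenseRange fun n : ℤ => a ^ n)
    (h1 : ∀ u', (1, u') ∈ rotationClosure a b → u' = 1)
    (h2 : ∀ u, (u, 1) ∈ rotationClosure a b → u = 1) :
    (∀ u u', (u, u') ∈ rotationClosure a b → u' = u) ∨
      (∀ u u', (u, u') ∈ rotationClosure a b → u' = u⁻¹) := by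
  set Γ := rotationClosure a b with hΓ
  have hcl : IsClosed (Γ : Set (Circle × Circle)) := Subgroup.isClosed_topologicalClosure _
  have : CompactSpace Γ := isCompact_iff_compactSpace.1 hcl.isCompact
  let π₁ : Γ →* Circle := (MonoidHom.fst Circle Circle).comp Γ.subtype
  let π₂ : Γ →* Circle := (MonoidHom.snd Circle Circle).comp Γ.subtype
  have hc1 : Continuous π₁ := continuous_fst.comp continuous_subtype_val
  have hc2 : Continuous π₂ := continuous_snd.comp continuous_subtype_val
  have hi1 : Function.Injective π₁ := by
    rw [injective_iff_map_eq_one]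
    rintro ⟨⟨u, u'⟩, hu⟩ (rfl : u = 1)
    have := h1 u' hu
    subst this; rfl
  have hi2 : Function.Injective π₂ := by
    rw [injective_iff_map_eq_one]
    rintro ⟨⟨u, u'⟩, hu⟩ (rfl : u' = 1)
    have := h2 u hu
    subst this; rfl
  have hs1 : Function.Surjective π₁ := by
    intro u
    obtain ⟨u', hu'⟩ := exists_mem_rotationClosure ha b u
    exact ⟨⟨(u, u'), hu'⟩, rfl⟩
  let e : Γ ≃* Circle := MulEquiv.ofBijective π₁ ⟨hi1, hs1⟩
  have hce : Continuous e.symm := by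
    have := (Continuous.homeoOfEquivCompactToT2 (f := e.toEquiv) hc1).symm.continuous
    exact this
  have key := Circle.eq_id_or_inv_of_continuous_injective (κ := π₂.comp e.symm.toMonoidHom)
    (hc2.comp hce) (hi2.comp e.symm.injective)
  have hval : ∀ u u' (h : (u, u') ∈ Γ), (π₂.comp e.symm.toMonoidHom) u = u' := by
    intro u u' h
    have : e.symm u = ⟨(u, u'), h⟩ := by
      rw [MulEquiv.symm_apply_eq]; rfl
    change π₂ (e.symm u) = u'
    rw [this]; rfl
  rcases key with h | h
  · left; intro u u' hu; rw [← hval u u' hu, h]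
  · right; intro u u' hu; rw [← hval u u' hu, h]

/-- If a half-plane is contained in another one, then their inner normals are parallel. -/
theorem Complex.exists_nonneg_mul_of_re_pos_imp {P Q : ℂ} (hP : P ≠ 0)
    (h : ∀ u : Circle, 0 < ((u : ℂ) * P).re → 0 ≤ ((u : ℂ) * Q).re) :
    ∃ s : ℝ, 0 ≤ s ∧ Q = s * P := by
  have h' : ∀ v : ℂ, 0 < (v * P).re → 0 ≤ (v * Q).re := by
    intro v hv
    have hv0 : v ≠ 0 := by rintro rfl; simp at hv
    have hn : 0 < ‖v‖ := norm_pos_iff.2 hv0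
    let u : Circle := ⟨v / ‖v‖, by simp [Submonoid.unitSphere, hn.ne']⟩
    have hu : (u : ℂ) = ((‖v‖⁻¹ : ℝ) : ℂ) * v := by
      change v / ‖v‖ = _
      push_cast; field_simp
    have := h u (by rw [hu, mul_assoc, Complex.re_ofReal_mul]; positivity)
    rw [hu, mul_assoc, Complex.re_ofReal_mul] at this
    exact nonneg_of_mul_nonneg_right this (by positivity)
  have hN : 0 < Complex.normSq P := Complex.normSq_pos.2 hP
  -- Testing the inclusion on `v = (x + iy) * conj P` with `x > 0` turns it into `Re ((x + iy) W) ≥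
  -- 0` for all such `x`, `y`. This forces `W` to be real and nonnegative, and `Q = (W / |P|²) P`.
  set W := (starRingEnd ℂ P) * Q with hW
  have hPP : (starRingEnd ℂ P) * P = (Complex.normSq P : ℂ) := by
    rw [mul_comm, Complex.mul_conj]
  have hW1 : ∀ x y : ℝ, 0 < x → 0 ≤ x * W.re - y * W.im := by
    intro x y hx
    have := h' ((⟨x, y⟩ : ℂ) * (starRingEnd ℂ P)) (by
      rw [mul_assoc, hPP, Complex.re_mul_ofReal]; positivity)
    rw [mul_assoc, ← hW, Complex.mul_re] at this
    exact this
  have hre : 0 ≤ W.re := by simpa using hW1 1 0 one_pos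
  have him : W.im = 0 := by
    by_contra hne
    have := hW1 1 ((W.re + 1) / W.im) one_pos
    rw [div_mul_cancel₀ _ hne] at this
    linarith
  refine ⟨W.re / Complex.normSq P, by positivity, ?_⟩
  have hWr : W = (W.re : ℂ) := Complex.ext (by simp) (by simp [him])
  have hN' : (Complex.normSq P : ℂ) ≠ 0 := by exact_mod_cast hN.ne'
  push_cast
  rw [← hWr, hW, div_mul_eq_mul_div, eq_div_iff hN', ← hPP]
  ring

/-- A local homeomorphism `g` of the plane which, for each pair `(u, u')` in the closure of the
joint orbit of two rotations, maps the half disk rotated by `u` to a half disk rotated by `u'`,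
is radial up to a rotation and possibly a reflection. -/
theorem radial_of_half_planes {a b : Circle} (ha : DenseRange fun n : ℤ => a ^ n)
    {α α' : ℂ} (hα : α ≠ 0) (hα' : α' ≠ 0) {g g' : ℂ → ℂ} {R R' : ℝ} (hR : 0 < R) (hR' : 0 < R')
    (hS : ∀ u u', (u, u') ∈ rotationClosure a b → ∀ z, ‖z‖ < R →
      0 < (α * (u⁻¹ : Circle) * z).re → 0 ≤ (α' * (u'⁻¹ : Circle) * g z).re)
    (hS' : ∀ u u', (u, u') ∈ rotationClosure b a → ∀ z, ‖z‖ < R' →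
      0 < (α' * (u⁻¹ : Circle) * z).re → 0 ≤ (α * (u'⁻¹ : Circle) * g' z).re)
    (hg : ContinuousOn g (Metric.ball 0 R)) (hg' : ContinuousOn g' (Metric.ball 0 R'))
    (hg0 : g 0 = 0) (hg0' : g' 0 = 0)
    (hgg' : ∀ᶠ x in 𝓝 0, g (g' x) = x) (hg'g : ∀ᶠ x in 𝓝 0, g' (g x) = x) :
    (∀ u u', (u, u') ∈ rotationClosure a b → u' = u) ∧
        (∀ z, ‖z‖ < R → ∃ s : ℝ, 0 ≤ s ∧ α' * g z = s * (α * z)) ∨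
      (∀ u u', (u, u') ∈ rotationClosure a b → u' = u⁻¹) ∧
        (∀ z, ‖z‖ < R → ∃ s : ℝ, 0 ≤ s ∧ starRingEnd ℂ (α' * g z) = s * (α * z)) := by
  -- Quantified over all the data so that it serves both `g` and `g'`. If `u' ≠ 1`, put `w = 1 - u'`
  -- and take `x` a small positive multiple of `w / α'`: then `Re (α' x) > 0`, but `Re (α' u'⁻¹ x) <
  -- 0`. Near `z = g' x` the pair `(1, u')` excludes `Re (α y) > 0`, and the pair `(1, 1)` applied
  -- to `g'` excludes `Re (α y) < 0`. So `Re (α y)` would vanish on an open set.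
  have aux : ∀ {a b : Circle} {α α' : ℂ} (_ : α ≠ 0) (_ : α' ≠ 0) {g g' : ℂ → ℂ} {R R' : ℝ}
      (_ : 0 < R) (_ : 0 < R')
      (_ : ∀ u u', (u, u') ∈ rotationClosure a b → ∀ z, ‖z‖ < R →
        0 < (α * (u⁻¹ : Circle) * z).re → 0 ≤ (α' * (u'⁻¹ : Circle) * g z).re)
      (_ : ∀ u u', (u, u') ∈ rotationClosure b a → ∀ z, ‖z‖ < R' →
        0 < (α' * (u⁻¹ : Circle) * z).re → 0 ≤ (α * (u'⁻¹ : Circle) * g' z).re)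
      (_ : ContinuousOn g (Metric.ball 0 R)) (_ : ContinuousOn g' (Metric.ball 0 R'))
      (_ : g 0 = 0) (_ : g' 0 = 0)
      (_ : ∀ᶠ x in 𝓝 0, g (g' x) = x) (_ : ∀ᶠ x in 𝓝 0, g' (g x) = x)
      (u' : Circle), (1, u') ∈ rotationClosure a b → u' = 1 := by
    intro a b α α' hα hα' g g' R R' hR hR' hS hS' hg hg' hg0 hg0' hgg' hg'g u' hu'
    by_contra hne
    have hone : ((1 : Circle), (1 : Circle)) ∈ rotationClosure a b := (rotationClosure a b).one_mem
    have hcg : ContinuousAt g 0 := hg.continuousAt (Metric.ball_mem_nhds 0 hR)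
    have hcg' : ContinuousAt g' 0 := hg'.continuousAt (Metric.ball_mem_nhds 0 hR')
    -- a point `x` with prescribed signs
    set w : ℂ := 1 - (u' : ℂ) with hw
    have hre : (u' : ℂ).re < 1 := by
      have h1 : Complex.normSq (u' : ℂ) = 1 := Circle.normSq_coe _
      rw [Complex.normSq_apply] at h1
      by_contra! hge
      have hr : (u' : ℂ).re = 1 := by nlinarith [sq_nonneg (u' : ℂ).im]
      have hi : (u' : ℂ).im = 0 := by rw [hr] at h1; nlinarith
      exact hne (Circle.ext (Complex.ext (by simpa using hr) (by simpa using hi)))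
    have hline : ContinuousAt (fun ε : ℝ => g' ((ε : ℂ) * (w / α'))) 0 := by
      apply ContinuousAt.comp (g := g')
      · simpa using hcg'
      · fun_prop
    have hlin2 : Tendsto (fun ε : ℝ => (ε : ℂ) * (w / α')) (𝓝[>] 0) (𝓝 0) := by
      have : ContinuousAt (fun ε : ℝ => (ε : ℂ) * (w / α')) 0 := by fun_prop
      simpa using this.tendsto.mono_left nhdsWithin_le_nhds
    have hlin3 : Tendsto (fun ε : ℝ => g' ((ε : ℂ) * (w / α'))) (𝓝[>] 0) (𝓝 0) := by
      simpa [hg0'] using hline.tendsto.mono_left nhdsWithin_le_nhds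
    have hballR : ∀ᶠ x : ℂ in 𝓝 0, ‖x‖ < R := by
      filter_upwards [Metric.ball_mem_nhds (0 : ℂ) hR] with x hx using by simpa using hx
    have hballR' : ∀ᶠ x : ℂ in 𝓝 0, ‖x‖ < R' := by
      filter_upwards [Metric.ball_mem_nhds (0 : ℂ) hR'] with x hx using by simpa using hx
    obtain ⟨ε, hgx, hxR', hz, hgz, hε⟩ := ((hlin2.eventually hgg').and
      ((hlin2.eventually hballR').and ((hlin3.eventually hballR).and
      ((hlin3.eventually hg'g.eventually_nhds).and self_mem_nhdsWithin)))).exists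
    set x : ℂ := (ε : ℂ) * (w / α') with hx
    set z : ℂ := g' x with hzdef
    have hε0 : 0 < ε := hε
    have hax : α' * x = ε * w := by rw [hx]; field_simp
    have hx1 : 0 < (α' * ((1 : Circle)⁻¹ : Circle) * x).re := by
      simp only [inv_one, Circle.coe_one, mul_one, hax, Complex.re_ofReal_mul]
      apply mul_pos hε0
      simp [hw]; linarith
    have hx2 : (α' * (u'⁻¹ : Circle) * x).re < 0 := by
      have : α' * ((u'⁻¹ : Circle) : ℂ) * x = ε * (((u'⁻¹ : Circle) : ℂ) - 1) := by
        rw [mul_right_comm, hax, hw, mul_assoc, sub_mul, one_mul, ← Circle.coe_mul,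
          mul_inv_cancel, Circle.coe_one]
      rw [this, Complex.re_ofReal_mul]
      apply mul_neg_of_pos_of_neg hε0
      rw [Circle.coe_inv_eq_conj]; simp; linarith
    have hcz : ContinuousAt g z := hg.continuousAt (Metric.isOpen_ball.mem_nhds (by simpa using hz))
    have hev : ∀ᶠ y in 𝓝 z, (α * y).re = 0 := by
      have c1 : ContinuousAt (fun y => (α' * ((1 : Circle)⁻¹ : Circle) * g y).re) z := by fun_prop
      have c2 : ContinuousAt (fun y => (α' * ((u')⁻¹ : Circle) * g y).re) z := by fun_prop
      have c3 : ContinuousAt (fun y => ‖g y‖) z := by fun_prop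
      have c4 : ContinuousAt (fun y : ℂ => ‖y‖) z := by fun_prop
      filter_upwards [c1.tendsto.eventually_const_lt (by rw [hgx]; exact hx1),
        c2.tendsto.eventually_lt_const (by rw [hgx]; exact hx2),
        c3.tendsto.eventually_lt_const (by rw [hgx]; exact hxR'),
        c4.tendsto.eventually_lt_const hz, hgz] with y h1 h2 h3 h4 h5
      apply le_antisymm
      · by_contra! hpos
        exact absurd (hS 1 u' hu' y h4 (by simpa using hpos)) (not_le.2 h2)
      · have := hS' 1 1 (swap_mem_rotationClosure hone) (g y) h3 h1
        rw [h5] at this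
        simpa using this
    have hzero : ∀ᶠ δ : ℝ in 𝓝[>] 0, (α * (z + δ * starRingEnd ℂ α)).re = 0 := by
      have : Tendsto (fun δ : ℝ => z + (δ : ℂ) * starRingEnd ℂ α) (𝓝[>] 0) (𝓝 z) := by
        have : ContinuousAt (fun δ : ℝ => z + (δ : ℂ) * starRingEnd ℂ α) 0 := by fun_prop
        simpa using this.tendsto.mono_left nhdsWithin_le_nhds
      exact this.eventually hev
    obtain ⟨δ, hδ, hδ0⟩ := (hzero.and self_mem_nhdsWithin).exists
    have hδ1 : 0 < δ := hδ0
    have h0 := hev.self_of_nhds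
    rw [mul_add, Complex.add_re, h0, mul_left_comm, Complex.mul_conj, Complex.re_ofReal_mul,
      Complex.ofReal_re, zero_add] at hδ
    have := mul_pos hδ1 (Complex.normSq_pos.2 hα)
    linarith
  have hgraph := rotationClosure_eq_graph ha
    (aux hα hα' hR hR' hS hS' hg hg' hg0 hg0' hgg' hg'g)
    (fun u hu => aux hα' hα hR' hR hS' hS hg' hg hg0' hg0 hg'g hgg' u (swap_mem_rotationClosure hu))
  have hpar : ∀ {P : ℂ} (z : ℂ), z ≠ 0 → (∀ u : Circle, 0 < (α * (u⁻¹ : Circle) * z).re →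
      0 ≤ (((u⁻¹ : Circle) : ℂ) * P).re) → ∃ s : ℝ, 0 ≤ s ∧ P = s * (α * z) := by
    intro P z hz hz'
    apply Complex.exists_nonneg_mul_of_re_pos_imp (mul_ne_zero hα hz)
    intro u hu
    have := hz' u⁻¹ (by rw [inv_inv]; convert hu using 2; ring)
    rwa [inv_inv] at this
  rcases hgraph with h | h
  · refine Or.inl ⟨h, fun z hz => ?_⟩
    rcases eq_or_ne z 0 with rfl | hz0
    · exact ⟨0, le_rfl, by simp [hg0]⟩
    apply hpar z hz0
    intro u hu
    obtain ⟨u', hu'⟩ := exists_mem_rotationClosure ha b u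
    have := hS u u' hu' z hz hu
    rw [h u u' hu'] at this
    convert this using 2; ring
  · refine Or.inr ⟨h, fun z hz => ?_⟩
    rcases eq_or_ne z 0 with rfl | hz0
    · exact ⟨0, le_rfl, by simp [hg0]⟩
    apply hpar z hz0
    intro u hu
    obtain ⟨u', hu'⟩ := exists_mem_rotationClosure ha b u
    have := hS u u' hu' z hz hu
    rw [h u u' hu', inv_inv] at this
    rw [Circle.coe_inv_eq_conj, ← map_mul, Complex.conj_re]
    convert this using 2; ring

end RotationPairs

/-! ### From radial to linear: comparing germs -/

section Comparison

/-- A preimage `x` of `I / β` under `Λ` works up to a positive factor, and a rotation turns `z` into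
its direction. Only real linearity of `Λ` is available, and it suffices. -/
theorem exists_circle_im_ne_zero {β : ℂ} {Λ : ℂ →L[ℝ] ℂ} (hβ : β ≠ 0)
    (hΛ : Function.Surjective Λ) {z : ℂ} (hz : z ≠ 0) :
    ∃ v : Circle, (β * Λ ((v : ℂ) * z)).im ≠ 0 := by
  obtain ⟨x, hx⟩ := hΛ (Complex.I / β)
  have hx0 : x ≠ 0 := by
    rintro rfl
    rw [map_zero, eq_comm, div_eq_zero_iff] at hx
    exact hx.elim Complex.I_ne_zero hβ
  have hq : x / z ≠ 0 := div_ne_zero hx0 hz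
  let v : Circle := ⟨x / z / ‖x / z‖, by
    simp only [Submonoid.unitSphere, Submonoid.mem_mk, Subsemigroup.mem_mk, mem_sphere_zero_iff_norm]
    rw [norm_div, Complex.norm_real, norm_norm, div_self (norm_ne_zero_iff.2 hq)]⟩
  refine ⟨v, ?_⟩
  have hv : (v : ℂ) * z = (‖x / z‖⁻¹ : ℝ) • x := by
    change x / z / ‖x / z‖ * z = _
    rw [Complex.real_smul, Complex.ofReal_inv]
    field_simp
  rw [hv, map_smul, hx, mul_smul_comm, mul_div_cancel₀ _ hβ, Complex.smul_im, Complex.I_im]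
  simpa [and_comm] using hq

theorem tendsto_pow_zero_of_le_atTop {ρ : ℝ} (h0 : 0 ≤ ρ) (h1 : ρ < 1) {l : Filter ℕ}
    (hl : l ≤ atTop) : Tendsto (fun n : ℕ => ρ ^ n) l (𝓝 0) :=
  (tendsto_pow_atTop_nhds_zero_of_lt_one h0 h1).mono_left hl

/-- First-order expansion along a sequence shrinking like `r⁻ⁿ`. The filter `l` is general because
the rescaled sequences also rotate, and so converge only along suitable filters. -/
theorem HasFDerivAt.tendsto_pow_mul_sub {F : ℂ → ℂ} {Λ : ℂ →L[ℝ] ℂ} (hF : HasFDerivAt F Λ 0)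
    {r : ℝ} (hr : 1 < r) {l : Filter ℕ} (hl : l ≤ atTop) {x : ℕ → ℂ} {X : ℂ}
    (hx : Tendsto (fun n => ((r : ℂ) ^ n) * x n) l (𝓝 X)) :
    Tendsto (fun n => ((r : ℂ) ^ n) * (F (x n) - F 0)) l (𝓝 (Λ X)) := by
  have hr0 : (r : ℂ) ≠ 0 := by exact_mod_cast (zero_lt_one.trans hr).ne'
  have hx0 : Tendsto x l (𝓝 0) := by
    have h0 := tendsto_pow_zero_of_le_atTop (ρ := r⁻¹) (by positivity) (inv_lt_one_of_one_lt₀ hr) hl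
    have h1 := ((Complex.continuous_ofReal.tendsto _).comp h0).mul hx
    rw [Complex.ofReal_zero, zero_mul] at h1
    refine h1.congr fun n => ?_
    simp only [Function.comp_apply, inv_pow, Complex.ofReal_inv, Complex.ofReal_pow]
    rw [← mul_assoc, inv_mul_cancel₀ (pow_ne_zero _ hr0), one_mul]
  have hlim := (hasFDerivWithinAt_univ.2 hF).lim (l := l) (c := fun n => r ^ n) (d := x) (v := X)
    hx0 (by simp) (by simpa using hx)
  simpa using hlim

/-- Under the hypothesis, `k c ζ + Q` is a real multiple of `c (ζ + P)`, so the imaginary part of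
`conj (c (ζ + P)) * (k c ζ + Q)` vanishes. Expanding it eliminates the unknown factor `s`. The
second term on the left is a product of two displacements, hence negligible to first order. -/
theorem radial_comparison_identity {c ζ P Q : ℂ} {k s : ℝ}
    (h : k * (c * ζ) + Q = s * (c * (ζ + P))) :
    (starRingEnd ℂ (c * ζ) * Q).im + (starRingEnd ℂ c * Q * starRingEnd ℂ P).im =
      k * Complex.normSq c * (starRingEnd ℂ ζ * P).im := by
  have hQ : Q = s * (c * (ζ + P)) - k * (c * ζ) := by rw [← h]; ring
  rw [hQ]
  simp [Complex.mul_re, Complex.mul_im, Complex.normSq_apply]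
  ring

/-- A radial homeomorphism `g` whose germ at some point `ζ ≠ 0` is comparable to its germ at `0`,
through a pair of differentiable maps along the orbits of two similarities, is linear. -/
theorem linear_of_radial_of_comparison {a : Circle} (ha : DenseRange fun n : ℤ => a ^ n)
    {r r' : ℝ} (hr : 1 < r) (hr' : 1 < r') {c : ℂ} (hc : c ≠ 0) {g : ℂ → ℂ} {R : ℝ}
    (hrad : ∀ z, ‖z‖ < R → ∃ s : ℝ, 0 ≤ s ∧ g z = s * (c * z))
    (hg0 : ∀ z, z ≠ 0 → ‖z‖ < R → g z ≠ 0)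
    {ζ : ℂ} (hζ : ‖ζ‖ < R) (hζ0 : ζ ≠ 0) {F F' : ℂ → ℂ} {Λ Λ' : ℂ →L[ℝ] ℂ}
    (hF : HasFDerivAt F Λ 0) (hF' : HasFDerivAt F' Λ' 0) (hF0 : F 0 = ζ) (hF0' : F' 0 = g ζ)
    (hΛ : Function.Surjective Λ) (hΛ' : Function.Surjective Λ')
    (hcomp : ∀ z, ‖z‖ < R → ∃ w : ℕ → ℂ,
      (∀ᶠ n in atTop, g (F (((r : ℂ) * a)⁻¹ ^ n * z)) = F' (w n)) ∧
      Tendsto (fun n => ((r' : ℂ) * a) ^ n * w n) atTop (𝓝 (g z))) :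
    r = r' ∧ ∃ m : ℝ, 0 < m ∧ ∀ z, ‖z‖ < R → g z = m * (c * z) := by
  obtain ⟨k, hk, hgk⟩ := hrad ζ hζ
  have hk0 : 0 < k := by
    rcases hk.lt_or_eq with h | h
    · exact h
    · exact absurd (by rw [hgk, ← h]; simp) (hg0 ζ hζ0 hζ)
  have hr0 : 0 < r := by linarith
  have hr0' : 0 < r' := by linarith
  -- `ell` and `ell'` are, up to positive factors, the first-order variations of the argument at `ζ`
  -- and at `c ζ`. A radial map changes all arguments by the constant `arg c`, so after rescaling by
  -- `rⁿ` and `r'ⁿ` these variations must match.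
  set ell : ℂ → ℝ := fun x => (starRingEnd ℂ ζ * Λ x).im with hell
  set ell' : ℂ → ℝ := fun x => (starRingEnd ℂ (c * ζ) * Λ' (c * x)).im with hell'
  -- the basic relation
  have key : ∀ z (s : ℝ), ‖z‖ < R → g z = s * (c * z) → ∀ v : Circle, ∃ l : Filter ℕ, l.NeBot ∧
      l ≤ atTop ∧ ∃ A B : ℕ → ℝ, Tendsto A l (𝓝 (s * ell' (v * z))) ∧
        Tendsto B l (𝓝 (k * Complex.normSq c * ell (v * z))) ∧ ∀ᶠ n in l, r ^ n * A n = r' ^ n * B n := by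
    intro z s hz hgz v
    -- The points `x n` are rotated by `a⁻ⁿ`, so `aⁿ` has to tend to `v⁻¹` in order to reach the
    -- direction `v`.
    obtain ⟨v', hv'⟩ := exists_mem_rotationClosure ha a v⁻¹
    obtain ⟨l, hl, hle, hav, -⟩ := mem_rotationClosure_iff.1 hv'
    refine ⟨l, hl, hle, ?_⟩
    have hav' : Tendsto (fun n : ℕ => ((a⁻¹ ^ n : Circle) : ℂ)) l (𝓝 v) := by
      have := hav.inv
      rw [inv_inv] at this
      refine (Continuous.tendsto continuous_subtype_val _).comp (this.congr fun n => (inv_pow a n).symm)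
    obtain ⟨w, hw1, hw2⟩ := hcomp z hz
    set x : ℕ → ℂ := fun n => ((r : ℂ) * a)⁻¹ ^ n * z with hx
    have hrx : Tendsto (fun n => ((r : ℂ) ^ n) * x n) l (𝓝 (v * z)) := by
      refine (hav'.mul_const z).congr fun n => ?_
      have : (r : ℂ) ^ n ≠ 0 := by exact_mod_cast (pow_pos hr0 n).ne'
      simp only [hx, mul_inv, mul_pow, Circle.coe_pow, Circle.coe_inv, inv_pow]
      field_simp
    have hrw : Tendsto (fun n => ((r' : ℂ) ^ n) * w n) l (𝓝 (s * (c * (v * z)))) := by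
      have := hav'.mul (hw2.mono_left hle)
      rw [hgz] at this
      refine (this.congr fun n => ?_).trans_eq ?_
      · have : (a : ℂ) ^ n ≠ 0 := pow_ne_zero _ (Circle.coe_ne_zero a)
        simp only [mul_pow, Circle.coe_pow, Circle.coe_inv, inv_pow]
        field_simp
      · congr 1; ring
    have hP := hF.tendsto_pow_mul_sub hr hle hrx
    have hQ := hF'.tendsto_pow_mul_sub hr' hle hrw
    have hinv : Tendsto (fun n : ℕ => ((r : ℂ) ^ n)⁻¹) l (𝓝 0) := by
      have := tendsto_pow_zero_of_le_atTop (ρ := r⁻¹) (by positivity) (inv_lt_one_of_one_lt₀ hr) hle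
      have := (Complex.continuous_ofReal.tendsto _).comp this
      rw [Complex.ofReal_zero] at this
      exact this.congr fun n => by simp
    have hP0 : Tendsto (fun n => F (x n) - F 0) l (𝓝 0) := by
      have := hinv.mul hP
      rw [zero_mul] at this
      refine this.congr fun n => ?_
      have : (r : ℂ) ^ n ≠ 0 := by exact_mod_cast (pow_pos hr0 n).ne'
      field_simp
    have hFx : Tendsto (fun n => F (x n)) l (𝓝 ζ) := by
      simpa [hF0] using hP0.add_const ζ
    refine ⟨fun n => (starRingEnd ℂ (c * ζ) * ((r' : ℂ) ^ n * (F' (w n) - F' 0))).im +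
      (starRingEnd ℂ c * ((r' : ℂ) ^ n * (F' (w n) - F' 0)) * starRingEnd ℂ (F (x n) - F 0)).im,
      fun n => k * Complex.normSq c * (starRingEnd ℂ ζ * ((r : ℂ) ^ n * (F (x n) - F 0))).im,
      ?_, ?_, ?_⟩
    · have h1 : Tendsto (fun n => (starRingEnd ℂ (c * ζ) * ((r' : ℂ) ^ n * (F' (w n) - F' 0))).im)
          l (𝓝 (starRingEnd ℂ (c * ζ) * Λ' (s * (c * (v * z)))).im) :=
        (Complex.continuous_im.tendsto _).comp (hQ.const_mul _)
      have h2 : Tendsto (fun n => (starRingEnd ℂ c * ((r' : ℂ) ^ n * (F' (w n) - F' 0)) *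
          starRingEnd ℂ (F (x n) - F 0)).im) l (𝓝 (starRingEnd ℂ c * Λ' (s * (c * (v * z))) *
            starRingEnd ℂ 0).im) :=
        (Complex.continuous_im.tendsto _).comp ((hQ.const_mul _).mul
          ((Complex.continuous_conj.tendsto _).comp hP0))
      convert h1.add h2 using 2
      rw [map_zero, mul_zero, Complex.zero_im, add_zero, hell']
      have : Λ' ((s : ℂ) * (c * (v * z))) = s * Λ' (c * (v * z)) := by
        have := Λ'.map_smul s (c * (v * z))
        simpa using this
      rw [this, mul_left_comm (starRingEnd ℂ (c * ζ)), Complex.im_ofReal_mul]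
    · exact ((Complex.continuous_im.tendsto _).comp (hP.const_mul _)).const_mul _
    · filter_upwards [hw1.filter_mono hle, hFx.norm.eventually_lt_const hζ] with n hn hn2
      obtain ⟨t, -, ht⟩ := hrad _ hn2
      have hid := radial_comparison_identity (c := c) (ζ := ζ) (P := F (x n) - F 0)
        (Q := F' (w n) - F' 0) (k := k) (s := t) (by
          rw [hF0, hF0', ← hn, hgk]
          rw [add_sub_cancel, add_sub_cancel, ht])
      have e1 : ∀ y q : ℂ, (y * ((r' : ℂ) ^ n * q)).im = r' ^ n * (y * q).im := by
        intro y q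
        rw [mul_left_comm, ← Complex.ofReal_pow, Complex.im_ofReal_mul]
      have e2 : ∀ y q : ℂ, (y * ((r : ℂ) ^ n * q)).im = r ^ n * (y * q).im := by
        intro y q
        rw [mul_left_comm, ← Complex.ofReal_pow, Complex.im_ofReal_mul]
      have e3 : ∀ y q p : ℂ, (y * ((r' : ℂ) ^ n * q) * p).im = r' ^ n * (y * q * p).im := by
        intro y q p
        rw [mul_left_comm, mul_assoc, ← Complex.ofReal_pow, Complex.im_ofReal_mul]
      rw [e1, e2, e3, ← mul_add, hid]
      ring
  have hnc : 0 < Complex.normSq c := Complex.normSq_pos.2 hc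
  have hconj : starRingEnd ℂ ζ ≠ 0 := by simpa using hζ0
  have hconj' : starRingEnd ℂ (c * ζ) ≠ 0 := by simpa using ⟨hc, hζ0⟩
  -- If the rates differed, dividing the relation by the faster power would force `A` or `B` to tend
  -- to 0, although for a suitable `v` its limit is nonzero.
  have hrr : r = r' := by
    rcases lt_trichotomy r r' with h | h | h
    · obtain ⟨v, hv⟩ := exists_circle_im_ne_zero hconj hΛ hζ0
      obtain ⟨l, hl, hle, A, B, hA, hB, hAB⟩ := key ζ k hζ hgk v
      have h0 := (tendsto_pow_zero_of_le_atTop (ρ := r / r') (by positivity)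
        ((div_lt_one hr0').2 h) hle).mul hA
      rw [zero_mul] at h0
      have := tendsto_nhds_unique_of_eventuallyEq hB h0 (hAB.mono fun n hn => by
        simp only [div_pow]; rw [div_mul_eq_mul_div, hn, mul_div_cancel_left₀ _ (by positivity)])
      exact absurd this (mul_ne_zero (mul_pos hk0 hnc).ne' hv)
    · exact h
    · obtain ⟨v, hv⟩ := exists_circle_im_ne_zero hconj' hΛ' (mul_ne_zero hc hζ0)
      obtain ⟨l, hl, hle, A, B, hA, hB, hAB⟩ := key ζ k hζ hgk v
      have h0 := (tendsto_pow_zero_of_le_atTop (ρ := r' / r) (by positivity)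
        ((div_lt_one hr0).2 h) hle).mul hB
      rw [zero_mul] at h0
      have := tendsto_nhds_unique_of_eventuallyEq hA h0 (hAB.mono fun n hn => by
        simp only [div_pow]; rw [div_mul_eq_mul_div, ← hn, mul_div_cancel_left₀ _ (by positivity)])
      refine absurd this (mul_ne_zero hk0.ne' ?_)
      rw [mul_left_comm] at hv
      exact hv
  refine ⟨hrr, ?_⟩
  subst hrr
  have key2 : ∀ z (s : ℝ), ‖z‖ < R → g z = s * (c * z) → ∀ v : Circle,
      s * ell' (v * z) = k * Complex.normSq c * ell (v * z) := by
    intro z s hz hs v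
    obtain ⟨l, hl, hle, A, B, hA, hB, hAB⟩ := key z s hz hs v
    refine tendsto_nhds_unique_of_eventuallyEq hA hB (hAB.mono fun n hn => ?_)
    exact mul_left_cancel₀ (by positivity) hn
  refine ⟨k, hk0, fun z hz => ?_⟩
  rcases eq_or_ne z 0 with rfl | hz0
  · obtain ⟨s, -, hs⟩ := hrad 0 hz
    simp [hs]
  obtain ⟨s, -, hs⟩ := hrad z hz
  obtain ⟨v, hv⟩ := exists_circle_im_ne_zero hconj hΛ hz0
  have hv' : ell (v * z) ≠ 0 := hv
  have h1 := key2 z s hz hs v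
  -- the point on the circle through `ζ` in the same direction
  have hq : z / ζ ≠ 0 := div_ne_zero hz0 hζ0
  let y : Circle := ⟨z / ζ / ‖z / ζ‖, by
    simp only [Submonoid.unitSphere, Submonoid.mem_mk, Subsemigroup.mem_mk, mem_sphere_zero_iff_norm]
    rw [norm_div, Complex.norm_real, norm_norm, div_self (norm_ne_zero_iff.2 hq)]⟩
  have hy : ((v * y : Circle) : ℂ) * ζ = (‖z / ζ‖⁻¹ : ℝ) • ((v : ℂ) * z) := by
    rw [Circle.coe_mul]
    change (v : ℂ) * (z / ζ / ‖z / ζ‖) * ζ = _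
    rw [Complex.real_smul, Complex.ofReal_inv]
    field_simp
  -- The relation at `ζ`, where the radial factor is `k`, is taken in the same direction `v * z` as
  -- the relation at `z`. Comparing the two gives `s = k`, since `ell' (v * z) ≠ 0`.
  have h2 := key2 ζ k hζ hgk (v * y)
  have hell1 : ell ((‖z / ζ‖⁻¹ : ℝ) • ((v : ℂ) * z)) = ‖z / ζ‖⁻¹ * ell (v * z) := by
    simp only [hell]; rw [map_smul, mul_smul_comm, Complex.smul_im, smul_eq_mul]
  have hell2 : ell' ((‖z / ζ‖⁻¹ : ℝ) • ((v : ℂ) * z)) = ‖z / ζ‖⁻¹ * ell' (v * z) := by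
    simp only [hell']; rw [mul_smul_comm, map_smul, mul_smul_comm, Complex.smul_im, smul_eq_mul]
  rw [hy, hell1, hell2] at h2
  have hp : 0 < ‖z / ζ‖⁻¹ := by positivity
  have h3 : k * ell' (v * z) = k * Complex.normSq c * ell (v * z) := by
    apply mul_left_cancel₀ hp.ne'; linarith
  have h4 : ell' (v * z) ≠ 0 := by
    intro h0
    rw [h0, mul_zero] at h3
    exact (mul_ne_zero (mul_pos hk0 hnc).ne' hv') h3.symm
  have h5 : s = k := mul_right_cancel₀ h4 (h1.trans h3.symm)
  rw [hs, h5]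

end Comparison

/-! ### Surfaces folded along the vertical axis -/

section Fold

/-- Quadratic estimates for a `C²` function at a nondegenerate critical zero. -/
theorem eventually_quadratic_bounds {C : ℝ → ℝ} {τ₀ : ℝ} (hC : ContDiffAt ℝ 2 C τ₀)
    (h0 : C τ₀ = 0) (h1 : deriv C τ₀ = 0) (h2 : 0 < deriv (deriv C) τ₀) :
    ∀ᶠ t in 𝓝 τ₀, deriv (deriv C) τ₀ / 4 * (t - τ₀) ^ 2 ≤ C t ∧
      C t ≤ 3 * deriv (deriv C) τ₀ / 4 * (t - τ₀) ^ 2 ∧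
      3 * deriv (deriv C) τ₀ / 4 * (t - τ₀) ^ 2 ≤ deriv C t * (t - τ₀) := by
  set c := deriv (deriv C) τ₀ with hc
  have hd : ∀ᶠ t in 𝓝 τ₀, DifferentiableAt ℝ C t := by
    filter_upwards [hC.eventually (by simp)] with t ht
    exact ht.differentiableAt (by norm_num)
  have hC' : HasDerivAt (deriv C) c τ₀ :=
    (((hC.fderiv_right (m := 1) (by norm_num)).clm_apply
      (contDiffAt_const (c := (1 : ℝ)))).differentiableAt (by norm_num)).hasDerivAt
  have hl := hC'.isLittleO.def (c := c / 4) (by positivity)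
  obtain ⟨δ, hδ, hball⟩ := Metric.eventually_nhds_iff_ball.1 (hd.and hl)
  filter_upwards [Metric.ball_mem_nhds τ₀ hδ] with t ht
  have hseg : segment ℝ τ₀ t ⊆ Metric.ball τ₀ δ :=
    (convex_ball τ₀ δ).segment_subset (Metric.mem_ball_self hδ) ht
  have hbd : ∀ s ∈ Metric.ball τ₀ δ, |deriv C s - c * (s - τ₀)| ≤ c / 4 * |s - τ₀| := by
    intro s hs
    have := (hball s hs).2
    rw [h1, sub_zero, smul_eq_mul, mul_comm (s - τ₀)] at this
    simpa [Real.norm_eq_abs] using this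
  have hmv : ‖(C t - c / 2 * (t - τ₀) ^ 2) - (C τ₀ - c / 2 * (τ₀ - τ₀) ^ 2)‖ ≤
      c / 4 * |t - τ₀| * ‖t - τ₀‖ := by
    refine Convex.norm_image_sub_le_of_norm_hasDerivWithin_le
      (f := fun s => C s - c / 2 * (s - τ₀) ^ 2) (f' := fun s => deriv C s - c * (s - τ₀))
      (s := segment ℝ τ₀ t) ?_ ?_ (convex_segment τ₀ t) (left_mem_segment ℝ τ₀ t)
      (right_mem_segment ℝ τ₀ t)
    · intro s hs
      have e1 := (hball s (hseg hs)).1.hasDerivAt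
      have e2 : HasDerivAt (fun s : ℝ => c / 2 * (s - τ₀) ^ 2) (c * (s - τ₀)) s := by
        have := (((hasDerivAt_id s).sub_const τ₀).pow 2).const_mul (c / 2)
        refine this.congr_deriv ?_
        simp; ring
      exact (e1.sub e2).hasDerivWithinAt
    · intro s hs
      refine (hbd s (hseg hs)).trans ?_
      have : |s - τ₀| ≤ |t - τ₀| := by
        rw [segment_eq_uIcc] at hs
        exact Set.abs_sub_left_of_mem_uIcc hs
      gcongr
  rw [h0, sub_self, Real.norm_eq_abs, Real.norm_eq_abs, mul_assoc, abs_mul_abs_self] at hmv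
  have h3 := abs_le.1 hmv
  have h4 := hbd t ht
  have h5 : |(deriv C t - c * (t - τ₀)) * (t - τ₀)| ≤ c / 4 * (t - τ₀) ^ 2 := by
    rw [abs_mul, ← sq_abs (t - τ₀), pow_two, ← mul_assoc]
    gcongr
  have h6 := abs_le.1 h5
  refine ⟨by nlinarith, by nlinarith, by nlinarith⟩

/-- `E` is a defining function, near `(0, τ₀)`, of a surface having a quadratic contact with the
vertical axis at `(0, τ₀)`. -/
structure IsFold (E : ℂ × ℝ → ℝ) (τ₀ : ℝ) : Prop where
  contDiffAt : ContDiffAt ℝ 2 E (0, τ₀)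
  zero : E (0, τ₀) = 0
  deriv_zero : deriv (fun t => E (0, t)) τ₀ = 0
  deriv_deriv_pos : 0 < deriv (deriv fun t => E (0, t)) τ₀

/-- The horizontal part of the derivative of a function on `ℂ × ℝ`. -/
noncomputable def horizontalDeriv (E : ℂ × ℝ → ℝ) (w : ℂ × ℝ) : ℂ →L[ℝ] ℝ :=
  (fderiv ℝ E w).comp (ContinuousLinearMap.inl ℝ ℂ ℝ)

variable {E : ℂ × ℝ → ℝ} {τ₀ : ℝ}

theorem IsFold.axis_bounds (hE : IsFold E τ₀) : ∃ c > 0, ∀ᶠ t in 𝓝 τ₀,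
    c / 4 * (t - τ₀) ^ 2 ≤ E (0, t) ∧ E (0, t) ≤ 3 * c / 4 * (t - τ₀) ^ 2 ∧
      3 * c / 4 * (t - τ₀) ^ 2 ≤ deriv (fun t => E (0, t)) t * (t - τ₀) := by
  refine ⟨_, hE.deriv_deriv_pos, eventually_quadratic_bounds (C := fun t => E (0, t)) ?_
    hE.zero hE.deriv_zero hE.deriv_deriv_pos⟩
  exact ContDiffAt.comp τ₀ (f := fun t : ℝ => ((0 : ℂ), t)) hE.contDiffAt (by fun_prop)

theorem IsFold.axis_nonneg (hE : IsFold E τ₀) : ∀ᶠ t in 𝓝 τ₀, 0 ≤ E (0, t) := by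
  obtain ⟨c, hc, h⟩ := hE.axis_bounds
  filter_upwards [h] with t ht
  exact le_trans (by positivity) ht.1

/-- Strict differentiability is what is needed: the increment is taken from the moving axis point
`(0, w.2)`, not from `(0, τ₀)`. -/
theorem IsFold.eventually_abs_le (hE : IsFold E τ₀) {ε : ℝ} (hε : 0 < ε) :
    ∀ᶠ w in 𝓝 ((0 : ℂ), τ₀),
      |E w - E (0, w.2) - horizontalDeriv E (0, τ₀) w.1| ≤ ε * ‖w.1‖ := by
  have h := (hE.contDiffAt.hasStrictFDerivAt (by norm_num)).isLittleO.def hε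
  have ht : Tendsto (fun w : ℂ × ℝ => (w, ((0 : ℂ), w.2))) (𝓝 (0, τ₀)) (𝓝 ((0, τ₀), (0, τ₀))) := by
    have : Continuous fun w : ℂ × ℝ => (w, ((0 : ℂ), w.2)) := by fun_prop
    exact this.tendsto (0, τ₀)
  filter_upwards [ht.eventually h] with w hw
  have e : w - (0, w.2) = (w.1, 0) := by ext <;> simp
  simp only [e] at hw
  simpa [horizontalDeriv, Real.norm_eq_abs, Prod.norm_def] using hw

/-- Since `E` is nonnegative on the axis, the horizontal derivative must compensate for it at a
zero. Up to a first-order error, the surface thus projects into a half-plane. -/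
theorem IsFold.eventually_le_of_eq_zero (hE : IsFold E τ₀) {ε : ℝ} (hε : 0 < ε) :
    ∀ᶠ w in 𝓝 ((0 : ℂ), τ₀), E w = 0 → horizontalDeriv E (0, τ₀) w.1 ≤ ε * ‖w.1‖ := by
  have h2 : Tendsto (fun w : ℂ × ℝ => w.2) (𝓝 (0, τ₀)) (𝓝 τ₀) := continuous_snd.tendsto _
  filter_upwards [hE.eventually_abs_le hε, h2.eventually hE.axis_nonneg] with w h1 h2 h3
  have := (abs_le.1 h1).1
  linarith

/-- Converse to the previous estimate, away from the boundary of the half-plane: `E (z, τ₀) ≤ 0` by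
the first-order expansion, while `E (z, τ₀ + d) > 0` for small `z` because `E (0, ·)` has a strict
minimum. The intermediate value theorem gives the zero. -/
theorem IsFold.eventually_exists_eq_zero (hE : IsFold E τ₀) {κ δ : ℝ} (hκ : 0 < κ) (hδ : 0 < δ) :
    ∀ᶠ z in 𝓝 (0 : ℂ), horizontalDeriv E (0, τ₀) z ≤ -κ * ‖z‖ →
      ∃ t, |t - τ₀| < δ ∧ E (z, t) = 0 := by
  obtain ⟨c, hc, hax⟩ := hE.axis_bounds
  have hcont : ∀ᶠ w in 𝓝 ((0 : ℂ), τ₀), ContinuousAt E w := by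
    filter_upwards [hE.contDiffAt.eventually (by simp)] with w hw using hw.continuousAt
  obtain ⟨δ₁, hδ₁, h1⟩ := Metric.eventually_nhds_iff_ball.1 hax
  obtain ⟨δ₂, hδ₂, h2⟩ := Metric.eventually_nhds_iff_ball.1 (hcont.and (hE.eventually_abs_le hκ))
  set d := min δ (min δ₁ δ₂) / 2 with hd
  have hd0 : 0 < d := by positivity
  have hm : min δ (min δ₁ δ₂) = 2 * d := by rw [hd]; ring
  have hdδ : d < δ := by have := min_le_left δ (min δ₁ δ₂); linarith
  have hdδ₁ : d < δ₁ := by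
    have := (min_le_right δ (min δ₁ δ₂)).trans (min_le_left _ _); linarith
  have hdδ₂ : d < δ₂ := by
    have := (min_le_right δ (min δ₁ δ₂)).trans (min_le_right _ _); linarith
  have hmem : ∀ z : ℂ, ‖z‖ < δ₂ → ∀ t, |t - τ₀| ≤ d → (z, t) ∈ Metric.ball ((0 : ℂ), τ₀) δ₂ := by
    intro z hz t ht
    rw [← ball_prod_same]
    exact ⟨by simpa using hz, by rw [Metric.mem_ball, Real.dist_eq]; linarith⟩
  have hpos : 0 < E (0, τ₀ + d) := by
    refine lt_of_lt_of_le ?_ (h1 (τ₀ + d) ?_).1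
    · rw [add_sub_cancel_left]; positivity
    · rw [Metric.mem_ball, Real.dist_eq, add_sub_cancel_left, abs_of_pos hd0]; exact hdδ₁
  have hc1 : ContinuousAt (fun z : ℂ => E (z, τ₀ + d)) 0 := by
    have : ContinuousAt E (0, τ₀ + d) :=
      (h2 _ (hmem 0 (by simpa using hδ₂) _ (by rw [add_sub_cancel_left, abs_of_pos hd0]))).1
    exact ContinuousAt.comp (f := fun z : ℂ => (z, τ₀ + d)) this (by fun_prop)
  filter_upwards [hc1.tendsto.eventually_const_lt hpos, Metric.ball_mem_nhds (0 : ℂ) hδ₂]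
    with z hz1 hz2 hz3
  rw [mem_ball_zero_iff] at hz2
  have hneg : E (z, τ₀) ≤ 0 := by
    have := (abs_le.1 (h2 (z, τ₀) (hmem z hz2 τ₀ (by simpa using hd0.le))).2).2
    simp only [hE.zero] at this
    linarith
  have hco : ContinuousOn (fun t => E (z, t)) (Set.Icc τ₀ (τ₀ + d)) := by
    intro t ht
    have hE' : ContinuousAt E (z, t) := (h2 _ (hmem z hz2 t (by
      rw [abs_of_nonneg (by linarith [ht.1])]; linarith [ht.2]))).1
    exact (ContinuousAt.comp (f := fun t : ℝ => (z, t)) hE' (by fun_prop)).continuousWithinAt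
  obtain ⟨t, ht, ht0⟩ := intermediate_value_Icc (by linarith) hco
    (show (0 : ℝ) ∈ Set.Icc _ _ from ⟨hneg, hz1.le⟩)
  exact ⟨t, by rw [abs_of_nonneg (by linarith [ht.1])]; linarith [ht.2], ht0⟩

end Fold

/-! ### Returns of the stable arc to the fold -/

section ReturnMap

variable {E : ℂ × ℝ → ℝ} {τ₀ : ℝ} {back : ℂ × ℝ → ℂ × ℝ} {c₀ : ℝ}

/-- The linear model `(z, t) ↦ (ν z, m t)`. -/
def diagMap (ν : ℂ) (m : ℝ) (w : ℂ × ℝ) : ℂ × ℝ := (ν * w.1, m * w.2)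

/-- Intended for `ν = μ⁻ⁿ`, with constants independent of `n`. Replacing `z₀` by `x` and linearizing
`E` each cost at most `κ/4 * ‖ν‖`. This dictates `ε` and `ρ`, and leaves half of the gain `κ * ‖ν‖`.
-/
theorem IsFold.eventually_neg_of_near (hE : IsFold E τ₀) {z₀ : ℂ} {κ : ℝ} (hκ : 0 < κ) :
    ∃ ρ > 0, ∀ (ν x : ℂ) (t : ℝ), ‖x - z₀‖ < ρ → ‖ν * x‖ < ρ → |t - τ₀| < ρ →
      horizontalDeriv E (0, τ₀) (ν * z₀) ≤ -κ * ‖ν‖ →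
      E (ν * x, t) ≤ E (0, t) - κ / 2 * ‖ν‖ := by
  set η := horizontalDeriv E (0, τ₀) with hη
  set ε := κ / (4 * (‖z₀‖ + 1)) with hε
  have hε0 : 0 < ε := by positivity
  obtain ⟨δ, hδ, h1⟩ := Metric.eventually_nhds_iff_ball.1 (hE.eventually_abs_le hε0)
  set ρ := min δ (min 1 (κ / (4 * (‖η‖ + 1)))) with hρ
  have hρδ : ρ ≤ δ := min_le_left _ _
  have hρ1 : ρ ≤ 1 := (min_le_right _ _).trans (min_le_left _ _)
  have hρκ : ρ ≤ κ / (4 * (‖η‖ + 1)) := (min_le_right _ _).trans (min_le_right _ _)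
  refine ⟨ρ, by positivity, fun ν x t hx hνx ht hneg => ?_⟩
  have hmem : (ν * x, t) ∈ Metric.ball ((0 : ℂ), τ₀) δ := by
    rw [← ball_prod_same]
    exact ⟨by rw [mem_ball_zero_iff]; linarith, by rw [Metric.mem_ball, Real.dist_eq]; linarith⟩
  have h2 := (abs_le.1 (h1 _ hmem)).2
  simp only at h2
  have h3 : η (ν * x) = η (ν * z₀) + η (ν * (x - z₀)) := by rw [← map_add]; congr 1; ring
  have h4 : η (ν * (x - z₀)) ≤ κ / 4 * ‖ν‖ := by
    calc η (ν * (x - z₀)) ≤ ‖η (ν * (x - z₀))‖ := Real.le_norm_self _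
      _ ≤ ‖η‖ * ‖ν * (x - z₀)‖ := η.le_opNorm _
      _ ≤ (‖η‖ + 1) * (‖ν‖ * (κ / (4 * (‖η‖ + 1)))) := by
          rw [norm_mul]; gcongr
          · linarith
          · linarith
      _ = κ / 4 * ‖ν‖ := by field_simp
  have h5 : ε * ‖ν * x‖ ≤ κ / 4 * ‖ν‖ := by
    have : ‖x‖ ≤ ‖z₀‖ + 1 := by
      have := norm_le_norm_add_norm_sub' x z₀
      linarith
    calc ε * ‖ν * x‖ ≤ ε * (‖ν‖ * (‖z₀‖ + 1)) := by rw [norm_mul]; gcongr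
      _ = κ / 4 * ‖ν‖ := by rw [hε]; field_simp
  linarith

/-- The height of `back (0, τ)` is `E (0, τ) / c₀`, so after the expansion by `lam⁻ⁿ` it sweeps a
whole interval starting at `τ₀`. This is where `0 < c₀ * τ₀` enters. At height `τ₀` the function `E`
is negative because the base point lies inside the half-plane. Slightly further from 0 it is
positive, so the arc crosses the fold. -/
theorem IsFold.eventually_exists_return (hE : IsFold E τ₀) (hb : ContDiffAt ℝ 2 back (0, τ₀))
    (hEb : ∀ w, E w = c₀ * (back w).2) (hc₀ : 0 < c₀ * τ₀) {μ : ℂ} {lam : ℝ} (hμ : 1 < ‖μ‖)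
    (hl0 : 0 < lam) (hl1 : lam < 1) {κ δ : ℝ} (hκ : 0 < κ) (hδ : 0 < δ) :
    ∀ᶠ n : ℕ in atTop,
      horizontalDeriv E (0, τ₀) (μ⁻¹ ^ n * (back (0, τ₀)).1) ≤ -κ * ‖μ⁻¹ ^ n‖ →
      ∃ τ, |τ - τ₀| < δ ∧ |lam⁻¹ ^ n * (back (0, τ)).2 - τ₀| < δ ∧
        E (diagMap (μ⁻¹ ^ n) (lam⁻¹ ^ n) (back (0, τ))) = 0 := by
  set z₀ := (back (0, τ₀)).1 with hz₀
  have hτ0 : τ₀ ≠ 0 := by rintro rfl; simp at hc₀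
  obtain ⟨c, hc, hax⟩ := hE.axis_bounds
  obtain ⟨ρ, hρ, hneg⟩ := hE.eventually_neg_of_near (z₀ := z₀) hκ
  have haxis : Continuous fun t : ℝ => ((0 : ℂ), t) := by fun_prop
  have hcontE : ∀ᶠ w in 𝓝 ((0 : ℂ), τ₀), ContinuousAt E w := by
    filter_upwards [hE.contDiffAt.eventually (by simp)] with w hw using hw.continuousAt
  have hcontb : ∀ᶠ t in 𝓝 τ₀, ContinuousAt (fun t => back (0, t)) t := by
    filter_upwards [haxis.continuousAt.eventually (hb.eventually (by simp))] with t ht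
    exact ContinuousAt.comp (f := fun t : ℝ => ((0 : ℂ), t)) ht.continuousAt haxis.continuousAt
  have hnear : ∀ᶠ t in 𝓝 τ₀, ‖(back (0, t)).1 - z₀‖ < ρ := by
    have h1 : ContinuousAt (fun t => ‖(back (0, t)).1 - z₀‖) τ₀ := by
      have := hcontb.self_of_nhds
      fun_prop
    refine h1.tendsto.eventually_lt_const ?_
    simpa [← hz₀] using hρ
  have hdiff : ∀ᶠ t in 𝓝 τ₀, DifferentiableAt ℝ (fun t => E (0, t)) t := by
    filter_upwards [haxis.continuousAt.eventually (hE.contDiffAt.eventually (by simp))] with t ht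
    exact DifferentiableAt.comp (f := fun t : ℝ => ((0 : ℂ), t)) t
      (ht.differentiableAt (by norm_num)) (by fun_prop)
  obtain ⟨δ₁, hδ₁, hB⟩ := Metric.eventually_nhds_iff_ball.1
    (hax.and (hcontb.and (hnear.and hdiff)))
  obtain ⟨δ₂, hδ₂, hEc⟩ := Metric.eventually_nhds_iff_ball.1 hcontE
  -- the interval on which we work
  set d := min (min δ δ₁) (min δ₂ ρ) / 2 with hd
  have hd0 : 0 < d := by positivity
  have hm : min (min δ δ₁) (min δ₂ ρ) = 2 * d := by rw [hd]; ring
  have hdδ : d < δ := by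
    have := (min_le_left (min δ δ₁) (min δ₂ ρ)).trans (min_le_left _ _); linarith
  have hdδ₁ : d < δ₁ := by
    have := (min_le_left (min δ δ₁) (min δ₂ ρ)).trans (min_le_right _ _); linarith
  have hdδ₂ : d < δ₂ := by
    have := (min_le_right (min δ δ₁) (min δ₂ ρ)).trans (min_le_left _ _); linarith
  have hdρ : d < ρ := by
    have := (min_le_right (min δ δ₁) (min δ₂ ρ)).trans (min_le_right _ _); linarith
  have hsub : ∀ t ∈ Set.Icc τ₀ (τ₀ + d), t ∈ Metric.ball τ₀ δ₁ := by
    intro t ht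
    rw [Metric.mem_ball, Real.dist_eq, abs_of_nonneg (by linarith [ht.1])]
    linarith [ht.2]
  -- Monotonicity orders `τ₁` and `τ₂` below, and keeps the renormalized height within `d` of `τ₀`
  -- on the whole interval between them.
  have hmono : MonotoneOn (fun t => E (0, t)) (Set.Icc τ₀ (τ₀ + d)) := by
    refine monotoneOn_of_deriv_nonneg (convex_Icc _ _) (fun t ht =>
      (hB t (hsub t ht)).2.2.2.continuousAt.continuousWithinAt) (fun t ht => ?_) (fun t ht => ?_)
    · rw [interior_Icc] at ht
      exact (hB t (hsub t ⟨ht.1.le, ht.2.le⟩)).2.2.2.differentiableWithinAt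
    · rw [interior_Icc] at ht
      have := (hB t (hsub t ⟨ht.1.le, ht.2.le⟩)).1.2.2
      have h0 : 0 < t - τ₀ := by linarith [ht.1]
      have h1 : 0 ≤ deriv (fun t => E (0, t)) t * (t - τ₀) := le_trans (by positivity) this
      exact nonneg_of_mul_nonneg_left h1 h0
  have hcontE0 : ContinuousOn (fun t => E (0, t)) (Set.Icc τ₀ (τ₀ + d)) := fun t ht =>
    (hB t (hsub t ht)).2.2.2.continuousAt.continuousWithinAt
  -- the target point above `τ₀`
  set d' := d * (τ₀ / |τ₀|) with hd'
  have habs : |(τ₀ / |τ₀|)| = 1 := by rw [abs_div, abs_abs, div_self (abs_ne_zero.2 hτ0)]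
  have hd'abs : |d'| = d := by rw [hd', abs_mul, habs, mul_one, abs_of_pos hd0]
  have hEpos : ∀ s : ℝ, |s| = d → 0 < E (0, τ₀ + s) := by
    intro s hs
    have hs0 : s ≠ 0 := by rintro rfl; simp at hs; linarith
    refine lt_of_lt_of_le ?_ (hB (τ₀ + s) ?_).1.1
    · rw [add_sub_cancel_left]; positivity
    · rw [Metric.mem_ball, Real.dist_eq, add_sub_cancel_left, hs]; exact hdδ₁
  have hEd : 0 < E (0, τ₀ + d) := hEpos d (abs_of_pos hd0)
  have hz : ∀ ε > 0, ∀ᶠ n : ℕ in atTop, ∀ x : ℂ, ‖x - z₀‖ < ρ → ‖μ⁻¹ ^ n * x‖ < ε := by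
    intro ε hε
    have hlim : Tendsto (fun n : ℕ => ‖μ‖⁻¹ ^ n * (‖z₀‖ + ρ)) atTop (𝓝 0) := by
      simpa using (tendsto_pow_atTop_nhds_zero_of_lt_one (by positivity)
        (inv_lt_one_of_one_lt₀ hμ)).mul_const (‖z₀‖ + ρ)
    filter_upwards [hlim.eventually_lt_const hε] with n hn x hx
    refine lt_of_le_of_lt ?_ hn
    rw [norm_mul, norm_pow, norm_inv]
    gcongr
    have := norm_le_norm_add_norm_sub' x z₀
    linarith
  have hc1 : ContinuousAt (fun z : ℂ => E (z, τ₀ + d')) 0 := by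
    have : ContinuousAt E (0, τ₀ + d') := by
      apply hEc
      rw [← ball_prod_same]
      exact ⟨by simpa using hδ₂, by
        rw [Metric.mem_ball, Real.dist_eq, add_sub_cancel_left, hd'abs]; exact hdδ₂⟩
    exact ContinuousAt.comp (f := fun z : ℂ => (z, τ₀ + d')) this (by fun_prop)
  obtain ⟨ε₁, hε₁, hpos⟩ := Metric.eventually_nhds_iff_ball.1
    (hc1.tendsto.eventually_const_lt (hEpos d' hd'abs))
  have hbig : ∀ᶠ n : ℕ in atTop, c₀ * τ₀ + c₀ * d' < lam⁻¹ ^ n * E (0, τ₀ + d) :=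
    ((tendsto_pow_atTop_atTop_of_one_lt ((one_lt_inv₀ hl0).2 hl1)).atTop_mul_const
      hEd).eventually_gt_atTop _
  filter_upwards [hz ρ hρ, hz ε₁ hε₁, hz δ₂ hδ₂, hbig] with n hn1 hn2 hn2' hn3 hη
  set m := lam⁻¹ ^ n with hmdef
  have hm0 : 0 < m := by positivity
  have hc0d' : 0 < c₀ * d' := by
    rw [hd', show c₀ * (d * (τ₀ / |τ₀|)) = d * (c₀ * τ₀) / |τ₀| by ring]
    have : 0 < |τ₀| := abs_pos.2 hτ0
    positivity
  -- For large `n` the values of `m * E (0, ·)` cover both `c₀ * τ₀` and `c₀ * (τ₀ + d')`. The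
  -- corresponding parameters `τ₁`, `τ₂` have renormalized heights `τ₀` and `τ₀ + d'`.
  have hivt := intermediate_value_Icc (show τ₀ ≤ τ₀ + d by linarith)
    (hcontE0.const_smul m)
  have hE0 : E (0, τ₀) = 0 := hE.zero
  simp only [Pi.smul_apply, smul_eq_mul, hE0, mul_zero] at hivt
  obtain ⟨τ₁, hτ₁, hτ₁v⟩ := hivt (show c₀ * τ₀ ∈ Set.Icc _ _ from ⟨hc₀.le, by linarith⟩)
  obtain ⟨τ₂, hτ₂, hτ₂v⟩ := hivt (show c₀ * τ₀ + c₀ * d' ∈ Set.Icc _ _ from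
    ⟨by linarith, hn3.le⟩)
  simp only at hτ₁v hτ₂v
  have hc0' : c₀ ≠ 0 := by rintro rfl; simp at hc₀
  have hval : ∀ τ s, m * E (0, τ) = c₀ * s → m * (back (0, τ)).2 = s := by
    intro τ s h
    rw [hEb] at h
    apply mul_left_cancel₀ hc0'
    linarith
  have h12 : τ₁ ≤ τ₂ := by
    by_contra! hlt
    have := mul_le_mul_of_nonneg_left (hmono hτ₂ hτ₁ hlt.le) hm0.le
    simp only at this
    rw [hτ₁v, hτ₂v] at this
    linarith
  have hsub12 : Set.Icc τ₁ τ₂ ⊆ Set.Icc τ₀ (τ₀ + d) := Set.Icc_subset_Icc hτ₁.1 hτ₂.2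
  have hheight : ∀ τ ∈ Set.Icc τ₁ τ₂, |m * (back (0, τ)).2 - τ₀| ≤ d := by
    intro τ hτ
    have e1 := mul_le_mul_of_nonneg_left (hmono hτ₁ (hsub12 hτ) hτ.1) hm0.le
    have e2 := mul_le_mul_of_nonneg_left (hmono (hsub12 hτ) hτ₂ hτ.2) hm0.le
    simp only at e1 e2
    rw [hτ₁v, hEb] at e1
    rw [hτ₂v, hEb] at e2
    have hc0abs : c₀ * d' = |c₀| * d := by rw [← abs_of_pos hc0d', abs_mul, hd'abs]
    have : |c₀ * (m * (back (0, τ)).2 - τ₀)| ≤ |c₀| * d := by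
      rw [abs_le, ← hc0abs]; constructor <;> nlinarith
    rw [abs_mul] at this
    exact le_of_mul_le_mul_left this (abs_pos.2 hc0')
  have hco : ContinuousOn (fun τ => E (diagMap (μ⁻¹ ^ n) m (back (0, τ)))) (Set.Icc τ₁ τ₂) := by
    intro τ hτ
    have hb' := hB τ (hsub τ (hsub12 hτ))
    have hcE : ContinuousAt E (diagMap (μ⁻¹ ^ n) m (back (0, τ))) := by
      apply hEc
      rw [← ball_prod_same]
      refine ⟨by simpa [diagMap] using hn2' _ hb'.2.2.1, ?_⟩
      rw [Metric.mem_ball, Real.dist_eq]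
      exact (hheight τ hτ).trans_lt hdδ₂
    have hd : Continuous (diagMap (μ⁻¹ ^ n) m) := by unfold diagMap; fun_prop
    exact (ContinuousAt.comp (f := fun τ => diagMap (μ⁻¹ ^ n) m (back (0, τ))) hcE
      (ContinuousAt.comp (f := fun τ => back (0, τ)) hd.continuousAt
        hb'.2.1)).continuousWithinAt
  have hv1 : E (diagMap (μ⁻¹ ^ n) m (back (0, τ₁))) ≤ 0 := by
    have hb' := hB τ₁ (hsub τ₁ hτ₁)
    have := hneg (μ⁻¹ ^ n) (back (0, τ₁)).1 τ₀ hb'.2.2.1 (hn1 _ hb'.2.2.1) (by simpa using hρ) hη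
    rw [hE0] at this
    rw [diagMap, hval τ₁ τ₀ hτ₁v]
    refine this.trans ?_
    have : 0 ≤ κ / 2 * ‖μ⁻¹ ^ n‖ := by positivity
    linarith
  have hv2 : 0 ≤ E (diagMap (μ⁻¹ ^ n) m (back (0, τ₂))) := by
    have hb' := hB τ₂ (hsub τ₂ hτ₂)
    rw [diagMap, hval τ₂ (τ₀ + d') (by rw [hτ₂v]; ring)]
    exact (hpos _ (by simpa using hn2 _ hb'.2.2.1)).le
  obtain ⟨τ, hτ, hτ0'⟩ := intermediate_value_Icc h12 hco (show (0 : ℝ) ∈ Set.Icc _ _ from ⟨hv1, hv2⟩)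
  refine ⟨τ, ?_, (hheight τ hτ).trans_lt hdδ, hτ0'⟩
  have := hsub12 hτ
  rw [abs_of_nonneg (by linarith [this.1])]
  linarith [this.2]

end ReturnMap

/-! ### Transversality of the returns -/

section ReturnMapTransversality

variable {E : ℂ × ℝ → ℝ} {τ₀ : ℝ} {back : ℂ × ℝ → ℂ × ℝ} {c₀ : ℝ}

/-- Both sides are comparable to `(t - τ₀)²`. The bound converts a lower bound for the value of `E`
on the axis into one for its slope, without reference to the position of `t`. -/
theorem IsFold.exists_deriv_sq_bound (hE : IsFold E τ₀) : ∃ c > 0, ∀ᶠ t in 𝓝 τ₀,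
    0 ≤ E (0, t) ∧ c * E (0, t) ≤ (deriv (fun t => E (0, t)) t) ^ 2 := by
  obtain ⟨c, hc, hax⟩ := hE.axis_bounds
  refine ⟨3 * c / 4, by positivity, ?_⟩
  filter_upwards [hax] with t ⟨h1, h2, h3⟩
  refine ⟨le_trans (by positivity) h1, ?_⟩
  rcases eq_or_ne t τ₀ with rfl | hne
  · rw [hE.zero, mul_zero]; positivity
  have hx : 0 < (t - τ₀) ^ 2 := by
    have : t - τ₀ ≠ 0 := sub_ne_zero.2 hne
    positivity
  have h4 : (3 * c / 4 * (t - τ₀) ^ 2) ^ 2 ≤ (deriv (fun t => E (0, t)) t * (t - τ₀)) ^ 2 :=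
    pow_le_pow_left₀ (by positivity) h3 2
  have h5 : (3 * c / 4) ^ 2 * (t - τ₀) ^ 2 ≤ (deriv (fun t => E (0, t)) t) ^ 2 := by
    refine le_of_mul_le_mul_right ?_ hx
    linarith
  calc 3 * c / 4 * E (0, t) ≤ 3 * c / 4 * (3 * c / 4 * (t - τ₀) ^ 2) := by gcongr
    _ = (3 * c / 4) ^ 2 * (t - τ₀) ^ 2 := by ring
    _ ≤ _ := h5

theorem sq_le_four_mul_sq {x y : ℝ} (h : 4 * (x - y) ^ 2 ≤ y ^ 2) : y ^ 2 ≤ 4 * x ^ 2 := by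
  have h1 : |2 * (x - y)| ≤ |y| := sq_le_sq.1 (by linarith)
  have h2 : |y| ≤ |2 * x| := by
    have h3 := abs_sub_abs_le_abs_sub (2 * y) (2 * x)
    rw [abs_sub_comm, ← mul_sub] at h3
    have h4 : |2 * y| = 2 * |y| := by rw [abs_mul, abs_two]
    linarith
  have := sq_le_sq.2 h2
  linarith

/-- The derivative of a `C²` function is locally Lipschitz, so leaving the axis changes the vertical
slope by only `O(‖z‖)`. At a return the slope on the axis is at least of order `‖z‖^{1/2}`, which
dominates this error. -/
theorem exists_fderiv_bounds (hE : ContDiffAt ℝ 2 E (0, τ₀)) : ∃ M > 0, ∃ δ > 0,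
    ∀ (z : ℂ) (t : ℝ), ‖z‖ < δ → |t - τ₀| < δ → DifferentiableAt ℝ E (z, t) ∧
      ‖fderiv ℝ E (z, t)‖ ≤ M ∧
      |fderiv ℝ E (z, t) (0, 1) - deriv (fun t => E (0, t)) t| ≤ M * ‖z‖ := by
  have hd : ∀ᶠ w in 𝓝 ((0 : ℂ), τ₀), DifferentiableAt ℝ E w := by
    filter_upwards [hE.eventually (by simp)] with w hw using hw.differentiableAt (by norm_num)
  have hf : ContDiffAt ℝ 1 (fderiv ℝ E) (0, τ₀) := hE.fderiv_right (by norm_num)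
  obtain ⟨K, s, hs, hK⟩ := hf.exists_lipschitzOnWith
  have hbd : ∀ᶠ w in 𝓝 ((0 : ℂ), τ₀), ‖fderiv ℝ E w‖ < ‖fderiv ℝ E (0, τ₀)‖ + 1 :=
    hf.continuousAt.norm.tendsto.eventually_lt_const (by linarith)
  obtain ⟨δ, hδ, hb⟩ := Metric.eventually_nhds_iff_ball.1 (hd.and (hbd.and hs))
  refine ⟨‖fderiv ℝ E (0, τ₀)‖ + 1 + K, by positivity, δ, hδ, fun z t hz ht => ?_⟩
  have hmem : ∀ z : ℂ, ‖z‖ < δ → (z, t) ∈ Metric.ball ((0 : ℂ), τ₀) δ := by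
    intro z hz
    rw [← ball_prod_same]
    exact ⟨by simpa using hz, by rw [Metric.mem_ball, Real.dist_eq]; exact ht⟩
  obtain ⟨h1, h2, h3⟩ := hb _ (hmem z hz)
  obtain ⟨h1', -, h3'⟩ := hb _ (hmem 0 (by simpa using hδ))
  refine ⟨h1, by have := K.2; change (0 : ℝ) ≤ K at this; linarith, ?_⟩
  have hder : deriv (fun t => E (0, t)) t = fderiv ℝ E (0, t) (0, 1) := by
    have := h1'.hasFDerivAt.comp_hasDerivAt t (f := fun t : ℝ => ((0 : ℂ), t))
      ((hasDerivAt_const t (0 : ℂ)).prodMk (hasDerivAt_id t))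
    exact this.deriv
  rw [hder, ← sub_apply]
  calc |(fderiv ℝ E (z, t) - fderiv ℝ E (0, t)) (0, 1)|
      ≤ ‖fderiv ℝ E (z, t) - fderiv ℝ E (0, t)‖ * ‖((0 : ℂ), (1 : ℝ))‖ := by
        rw [← Real.norm_eq_abs]; exact ContinuousLinearMap.le_opNorm _ _
    _ ≤ K * ‖z‖ * 1 := by
        have h4 := hK.dist_le_mul _ h3 _ h3'
        rw [dist_eq_norm, dist_eq_norm] at h4
        simp only [Prod.mk_sub_mk, sub_zero, sub_self, Prod.norm_mk, norm_zero] at h4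
        rw [max_eq_left (norm_nonneg z)] at h4
        have h5 : ‖((0 : ℂ), (1 : ℝ))‖ = 1 := by simp [Prod.norm_mk]
        rw [h5]
        gcongr
    _ ≤ _ := by
        rw [mul_one]
        gcongr
        have := norm_nonneg (fderiv ℝ E (0, τ₀))
        linarith

-- With `ν = μ⁻ⁿ` and `m = lam⁻ⁿ`, the derivative is a horizontal term of size `O(‖ν‖)` plus `m *
-- V.2 * X`, where `V.2` is the vertical speed of the arc and `X` the vertical slope of `E` at the
-- return. A zero of `E` there means `E (0, m * y) ≥ κ/2 * ‖ν‖`, hence `X² ≳ ‖ν‖`. The arc having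
-- been stretched to height about `τ₀` means `m * V.2² ≳ 1`. So `(m * V.2 * X)² ≳ ‖ν‖`, which
-- exceeds `O(‖ν‖²)` for large `n`.
set_option maxHeartbeats 1000000 in
theorem IsFold.eventually_deriv_return_ne_zero (hE : IsFold E τ₀)
    (hb : ContDiffAt ℝ 2 back (0, τ₀)) (hEb : ∀ w, E w = c₀ * (back w).2) (hc₀ : c₀ ≠ 0)
    (hτ₀ : τ₀ ≠ 0) {μ : ℂ} {lam : ℝ} (hμ : 1 < ‖μ‖) (hl0 : 0 < lam) (hl1 : lam < 1) {κ : ℝ}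
    (hκ : 0 < κ) :
    ∃ δ > 0, ∀ᶠ n : ℕ in atTop,
      horizontalDeriv E (0, τ₀) (μ⁻¹ ^ n * (back (0, τ₀)).1) ≤ -κ * ‖μ⁻¹ ^ n‖ →
      ∀ τ, |τ - τ₀| < δ → |lam⁻¹ ^ n * (back (0, τ)).2 - τ₀| < δ →
        E (diagMap (μ⁻¹ ^ n) (lam⁻¹ ^ n) (back (0, τ))) = 0 →
        deriv (fun τ => E (diagMap (μ⁻¹ ^ n) (lam⁻¹ ^ n) (back (0, τ)))) τ ≠ 0 := by
  set z₀ := (back (0, τ₀)).1 with hz₀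
  obtain ⟨c, hc, hax⟩ := hE.exists_deriv_sq_bound
  obtain ⟨ρ, hρ, hneg⟩ := hE.eventually_neg_of_near (z₀ := z₀) hκ
  obtain ⟨M, hM, δ₁, hδ₁, hfd⟩ := exists_fderiv_bounds hE.contDiffAt
  have haxis : Continuous fun t : ℝ => ((0 : ℂ), t) := by fun_prop
  have hdb : ∀ᶠ t in 𝓝 τ₀, DifferentiableAt ℝ back (0, t) := by
    filter_upwards [haxis.continuousAt.eventually (hb.eventually (by simp))] with t ht using
      ht.differentiableAt (by norm_num)
  have hcb : ContinuousAt (fun t => back (0, t)) τ₀ :=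
    ContinuousAt.comp (f := fun t : ℝ => ((0 : ℂ), t)) hb.continuousAt haxis.continuousAt
  have hnear : ∀ᶠ t in 𝓝 τ₀, ‖(back (0, t)).1 - z₀‖ < ρ := by
    have h1 : ContinuousAt (fun t => ‖(back (0, t)).1 - z₀‖) τ₀ := by fun_prop
    refine h1.tendsto.eventually_lt_const ?_
    simpa [← hz₀] using hρ
  have hbd : ∀ᶠ t in 𝓝 τ₀, ‖fderiv ℝ back (0, t)‖ < ‖fderiv ℝ back (0, τ₀)‖ + 1 := by
    have h1 : ContinuousAt (fderiv ℝ back) (0, τ₀) := hb.continuousAt_fderiv (by norm_num)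
    have h2 : ContinuousAt (fun t : ℝ => fderiv ℝ back (0, t)) τ₀ :=
      ContinuousAt.comp (f := fun t : ℝ => ((0 : ℂ), t)) h1 haxis.continuousAt
    exact h2.norm.tendsto.eventually_lt_const (by linarith)
  set B := ‖fderiv ℝ back (0, τ₀)‖ + 1 with hB
  have hB0 : 0 < B := by positivity
  obtain ⟨δ₂, hδ₂, hloc⟩ := Metric.eventually_nhds_iff_ball.1
    (hax.and (hdb.and (hnear.and hbd)))
  -- The bound `|τ₀| / 2` keeps the return height away from 0. The value `m * E (0, τ)` is then at
  -- least `|c₀| * |τ₀| / 2`, the quantity entering `k₂`.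
  set δ := min (min δ₁ δ₂) (min ρ (|τ₀| / 2)) with hδ
  have hδδ₁ : δ ≤ δ₁ := (min_le_left _ _).trans (min_le_left _ _)
  have hδδ₂ : δ ≤ δ₂ := (min_le_left _ _).trans (min_le_right _ _)
  have hδρ : δ ≤ ρ := (min_le_right _ _).trans (min_le_left _ _)
  have hδτ : δ ≤ |τ₀| / 2 := (min_le_right _ _).trans (min_le_right _ _)
  have habs : 0 < |τ₀| := abs_pos.2 hτ₀
  refine ⟨δ, by positivity, ?_⟩
  set Z := ‖z₀‖ + ρ with hZ
  have hZ0 : 0 < Z := by positivity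
  have hN0 : Tendsto (fun n : ℕ => ‖μ⁻¹ ^ n‖) atTop (𝓝 0) := by
    refine (tendsto_pow_atTop_nhds_zero_of_lt_one (r := ‖μ‖⁻¹) (by positivity)
      (inv_lt_one_of_one_lt₀ hμ)).congr fun n => ?_
    rw [norm_pow, norm_inv]
  set k₁ := c * κ / 2 with hk₁
  set k₂ := c * (|c₀| * |τ₀| / 2) / c₀ ^ 2 with hk₂
  have hk₁0 : 0 < k₁ := by positivity
  have hk₂0 : 0 < k₂ := by
    have : 0 < |c₀| := abs_pos.2 hc₀
    positivity
  have hN1 : ∀ᶠ n : ℕ in atTop, ‖μ⁻¹ ^ n‖ * Z < min ρ δ₁ := by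
    have := hN0.mul_const Z
    rw [zero_mul] at this
    exact this.eventually_lt_const (by positivity)
  have hN2 : ∀ᶠ n : ℕ in atTop, ‖μ⁻¹ ^ n‖ * (4 * (M * Z) ^ 2) < k₁ := by
    have := hN0.mul_const (4 * (M * Z) ^ 2)
    rw [zero_mul] at this
    exact this.eventually_lt_const hk₁0
  have hN3 : ∀ᶠ n : ℕ in atTop, ‖μ⁻¹ ^ n‖ * (4 * (M * B) ^ 2) < k₁ * k₂ := by
    have := hN0.mul_const (4 * (M * B) ^ 2)
    rw [zero_mul] at this
    exact this.eventually_lt_const (by positivity)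
  filter_upwards [hN1, hN2, hN3] with n h1 h2 h3 hη τ hτ hm hzero hder
  have hμ0 : μ ≠ 0 := by rintro rfl; simp at hμ; linarith
  have hNpos : 0 < ‖μ⁻¹ ^ n‖ := norm_pos_iff.2 (pow_ne_zero _ (inv_ne_zero hμ0))
  set ν := μ⁻¹ ^ n with hν
  set m := lam⁻¹ ^ n with hmdef
  have hm0 : 0 < m := by positivity
  have hm1 : 1 ≤ m := one_le_pow₀ ((one_le_inv₀ hl0).2 hl1.le)
  obtain ⟨haxτ, hdbτ, hnτ, hbdτ⟩ := hloc τ (by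
    rw [Metric.mem_ball, Real.dist_eq]; exact hτ.trans_le hδδ₂)
  set x := (back (0, τ)).1 with hx
  set y := (back (0, τ)).2 with hy
  obtain ⟨haxt, -, -, -⟩ := hloc (m * y) (by
    rw [Metric.mem_ball, Real.dist_eq]; exact hm.trans_le hδδ₂)
  have hxZ : ‖x‖ ≤ Z := by
    have := norm_le_norm_add_norm_sub' x z₀
    linarith
  have hzle : ‖ν * x‖ ≤ ‖ν‖ * Z := by rw [norm_mul]; gcongr
  obtain ⟨hdE, hbE, hvE⟩ := hfd (ν * x) (m * y) (by
    exact lt_of_le_of_lt hzle (h1.trans_le (min_le_right _ _))) (hm.trans_le hδδ₁)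
  -- the height above the fold
  have hlow := hneg ν x (m * y) hnτ (lt_of_le_of_lt hzle (h1.trans_le (min_le_left _ _)))
    (hm.trans_le hδρ) hη
  have hzero' : E (ν * x, m * y) = 0 := hzero
  rw [hzero'] at hlow
  set Q' := deriv (fun t => E (0, t)) (m * y) with hQ'
  have hQ'sq : k₁ * ‖ν‖ ≤ Q' ^ 2 := by
    refine le_trans ?_ haxt.2
    rw [hk₁]
    have : κ / 2 * ‖ν‖ ≤ E (0, m * y) := by linarith
    calc c * κ / 2 * ‖ν‖ = c * (κ / 2 * ‖ν‖) := by ring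
      _ ≤ _ := by gcongr
  set X := fderiv ℝ E (ν * x, m * y) (0, 1) with hX
  have hXsq : k₁ * ‖ν‖ ≤ 4 * X ^ 2 := by
    have e1 : |X - Q'| ≤ M * (‖ν‖ * Z) := hvE.trans (by gcongr)
    have e2 : 4 * (X - Q') ^ 2 ≤ k₁ * ‖ν‖ := by
      calc 4 * (X - Q') ^ 2 = 4 * |X - Q'| ^ 2 := by rw [sq_abs]
        _ ≤ 4 * (M * (‖ν‖ * Z)) ^ 2 := by gcongr
        _ = ‖ν‖ * (4 * (M * Z) ^ 2) * ‖ν‖ := by ring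
        _ ≤ k₁ * ‖ν‖ := by gcongr
    exact hQ'sq.trans (sq_le_four_mul_sq (e2.trans hQ'sq))
  -- the speed of the curve
  have hcurve := hdbτ.hasFDerivAt.comp_hasDerivAt τ (f := fun t : ℝ => ((0 : ℂ), t))
    ((hasDerivAt_const τ (0 : ℂ)).prodMk (hasDerivAt_id τ))
  set V := fderiv ℝ back (0, τ) (0, 1) with hV
  have hVnorm : ‖V‖ ≤ B := by
    have h5 : ‖((0 : ℂ), (1 : ℝ))‖ = 1 := by simp [Prod.norm_mk]
    have := ContinuousLinearMap.le_opNorm (fderiv ℝ back (0, τ)) (0, 1)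
    rw [h5, mul_one] at this
    exact this.trans hbdτ.le
  have hc2 : HasDerivAt (fun t => (back (0, t)).1) V.1 τ :=
    (ContinuousLinearMap.fst ℝ ℂ ℝ).hasFDerivAt.comp_hasDerivAt τ hcurve
  have hc3 : HasDerivAt (fun t => (back (0, t)).2) V.2 τ :=
    (ContinuousLinearMap.snd ℝ ℂ ℝ).hasFDerivAt.comp_hasDerivAt τ hcurve
  have hdEτ : deriv (fun t => E (0, t)) τ = c₀ * V.2 := by
    have : HasDerivAt (fun t => E (0, t)) (c₀ * V.2) τ := by
      simp only [hEb]
      exact hc3.const_mul c₀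
    exact this.deriv
  have hV2 : k₂ ≤ m * V.2 ^ 2 := by
    have e1 := haxτ.2
    rw [hdEτ] at e1
    have e2 : |c₀| * |τ₀| / 2 ≤ m * E (0, τ) := by
      have e3 : |τ₀| / 2 ≤ |m * y| := by
        have := abs_sub_abs_le_abs_sub τ₀ (m * y)
        rw [abs_sub_comm] at this
        linarith [hm.le.trans hδτ]
      calc |c₀| * |τ₀| / 2 = |c₀| * (|τ₀| / 2) := by ring
        _ ≤ |c₀| * |m * y| := by gcongr
        _ = m * |E (0, τ)| := by rw [hEb, abs_mul, abs_mul, abs_of_pos hm0, ← hy]; ring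
        _ = m * E (0, τ) := by rw [abs_of_nonneg haxτ.1]
    have hc0sq : 0 < c₀ ^ 2 := by positivity
    rw [hk₂, div_le_iff₀ hc0sq]
    calc c * (|c₀| * |τ₀| / 2) ≤ c * (m * E (0, τ)) := by gcongr
      _ = m * (c * E (0, τ)) := by ring
      _ ≤ m * (c₀ * V.2) ^ 2 := by gcongr
      _ = m * V.2 ^ 2 * c₀ ^ 2 := by ring
  -- the derivative
  have hDE : HasDerivAt (fun τ => E (diagMap ν m (back (0, τ))))
      (fderiv ℝ E (ν * x, m * y) (ν * V.1, m * V.2)) τ := by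
    have hdE' : HasFDerivAt E (fderiv ℝ E (ν * x, m * y)) (diagMap ν m (back (0, τ))) :=
      hdE.hasFDerivAt
    exact hdE'.comp_hasDerivAt τ (f := fun τ => diagMap ν m (back (0, τ)))
      ((hc2.const_mul ν).prodMk (hc3.const_mul m))
  rw [hDE.deriv] at hder
  have hsplit : ((ν * V.1, m * V.2) : ℂ × ℝ) = (ν * V.1, 0) + (m * V.2) • ((0 : ℂ), (1 : ℝ)) := by
    ext <;> simp
  rw [hsplit, map_add, map_smul, smul_eq_mul, ← hX] at hder
  have hle : (m * V.2 * X) ^ 2 ≤ (M * (‖ν‖ * B)) ^ 2 := by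
    have e1 : m * V.2 * X = -fderiv ℝ E (ν * x, m * y) (ν * V.1, 0) := by linarith
    rw [e1, neg_sq, ← sq_abs]
    gcongr
    rw [← Real.norm_eq_abs]
    refine (ContinuousLinearMap.le_opNorm _ _).trans ?_
    have e2 : ‖((ν * V.1, 0) : ℂ × ℝ)‖ ≤ ‖ν‖ * B := by
      rw [Prod.norm_mk, norm_zero, max_eq_left (norm_nonneg _), norm_mul]
      gcongr
      exact (norm_fst_le V).trans hVnorm
    gcongr
  have hge : k₁ * k₂ * ‖ν‖ ≤ 4 * (m * V.2 * X) ^ 2 := by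
    calc k₁ * k₂ * ‖ν‖ = k₂ * (k₁ * ‖ν‖) := by ring
      _ ≤ m * V.2 ^ 2 * (4 * X ^ 2) := by gcongr
      _ ≤ m * (m * V.2 ^ 2 * (4 * X ^ 2)) := le_mul_of_one_le_left (by positivity) hm1
      _ = 4 * (m * V.2 * X) ^ 2 := by ring
  have hfin : k₁ * k₂ * ‖ν‖ ≤ ‖ν‖ * (4 * (M * B) ^ 2) * ‖ν‖ := by
    calc _ ≤ _ := hge
      _ ≤ 4 * (M * (‖ν‖ * B)) ^ 2 := by gcongr
      _ = _ := by ring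
  have := le_of_mul_le_mul_right hfin hNpos
  linarith

end ReturnMapTransversality

/-! ### Local conjugacies between hyperbolic diagonal maps -/

section Cylinder

/-- The closed cylinder of radius and half-height `a`. -/
def cylinder (a : ℝ) : Set (ℂ × ℝ) := Metric.closedBall (0 : ℂ) a ×ˢ Set.Icc (-a) a

theorem mem_cylinder {a : ℝ} {w : ℂ × ℝ} : w ∈ cylinder a ↔ ‖w.1‖ ≤ a ∧ |w.2| ≤ a := by
  rw [cylinder, Set.mem_prod, mem_closedBall_zero_iff, Set.mem_Icc, abs_le]

theorem cylinder_mem_nhds {a : ℝ} {w : ℂ × ℝ} (h1 : ‖w.1‖ < a) (h2 : |w.2| < a) :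
    cylinder a ∈ 𝓝 w := by
  have c1 : ContinuousAt (fun w : ℂ × ℝ => ‖w.1‖) w := by fun_prop
  have c2 : ContinuousAt (fun w : ℂ × ℝ => |w.2|) w := by fun_prop
  filter_upwards [c1.tendsto.eventually_lt_const h1, c2.tendsto.eventually_lt_const h2]
    with v hv1 hv2
  exact mem_cylinder.2 ⟨hv1.le, hv2.le⟩

theorem smul_mem_cylinder {a s : ℝ} {w : ℂ × ℝ} (hs0 : 0 ≤ s) (hs1 : s ≤ 1)
    (hw : w ∈ cylinder a) : s • w ∈ cylinder a := by
  rw [mem_cylinder] at hw ⊢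
  have h1 := norm_nonneg w.1
  have h2 := abs_nonneg w.2
  rw [Prod.smul_fst, Prod.smul_snd, norm_smul, smul_eq_mul, abs_mul, Real.norm_eq_abs,
    abs_of_nonneg hs0]
  constructor <;> nlinarith

theorem diagMap_diagMap (ν ν' : ℂ) (m m' : ℝ) (w : ℂ × ℝ) :
    diagMap ν m (diagMap ν' m' w) = diagMap (ν * ν') (m * m') w := by
  simp [diagMap, mul_assoc]

theorem continuous_diagMap (ν : ℂ) (m : ℝ) : Continuous (diagMap ν m) := by
  unfold diagMap; fun_prop

theorem diagMap_smul (ν : ℂ) (m s : ℝ) (w : ℂ × ℝ) :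
    diagMap ν m (s • w) = s • diagMap ν m w := by
  simp [diagMap, mul_left_comm]

theorem diagMap_inv_pow_cancel {μ : ℂ} {lam : ℝ} (hμ : μ ≠ 0) (hl : lam ≠ 0) (n : ℕ) (w : ℂ × ℝ) :
    diagMap (μ ^ n) (lam ^ n) (diagMap (μ⁻¹ ^ n) (lam⁻¹ ^ n) w) = w := by
  rw [diagMap_diagMap, ← mul_pow, ← mul_pow, mul_inv_cancel₀ hμ, mul_inv_cancel₀ hl]
  simp [diagMap]

/-- Intermediate iterates of a hyperbolic diagonal map stay in the cylinder. -/
theorem diagMap_pow_mem_cylinder {μ : ℂ} {lam a : ℝ} (hμ : 1 < ‖μ‖) (hl0 : 0 < lam)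
    (hl1 : lam < 1) {w : ℂ × ℝ} {n j : ℕ} (hj : j ≤ n) (hw : w ∈ cylinder a)
    (hn : diagMap (μ ^ n) (lam ^ n) w ∈ cylinder a) :
    diagMap (μ ^ j) (lam ^ j) w ∈ cylinder a := by
  rw [mem_cylinder] at hw hn ⊢
  simp only [diagMap, norm_mul, norm_pow, abs_mul, abs_pow, abs_of_pos hl0] at hn ⊢
  constructor
  · refine le_trans ?_ hn.1
    gcongr
    exact hμ.le
  · refine le_trans ?_ hw.2
    exact mul_le_of_le_one_left (abs_nonneg _) (pow_le_one₀ hl0.le hl1.le)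

/-- A continuous injective map between cylinders which conjugates two hyperbolic diagonal maps. -/
structure IsLocalConj (μ μ' : ℂ) (lam lam' a a' : ℝ) (H : ℂ × ℝ → ℂ × ℝ) : Prop where
  continuousOn : ContinuousOn H (cylinder a)
  mapsTo : Set.MapsTo H (cylinder a) (cylinder a')
  injOn : Set.InjOn H (cylinder a)
  map_zero : H 0 = 0
  conj : ∀ w ∈ cylinder a, diagMap μ lam w ∈ cylinder a →
    H (diagMap μ lam w) = diagMap μ' lam' (H w)

namespace IsLocalConj

variable {μ μ' : ℂ} {lam lam' a a' : ℝ} {H : ℂ × ℝ → ℂ × ℝ}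

theorem conj_pow (hH : IsLocalConj μ μ' lam lam' a a' H) (hμ : 1 < ‖μ‖) (hl0 : 0 < lam)
    (hl1 : lam < 1) {w : ℂ × ℝ} {n : ℕ} (hw : w ∈ cylinder a)
    (hn : diagMap (μ ^ n) (lam ^ n) w ∈ cylinder a) :
    H (diagMap (μ ^ n) (lam ^ n) w) = diagMap (μ' ^ n) (lam' ^ n) (H w) := by
  induction n with
  | zero => simp [diagMap]
  | succ n ih =>
    have h1 := diagMap_pow_mem_cylinder hμ hl0 hl1 (Nat.le_succ n) hw hn
    rw [pow_succ', pow_succ', ← diagMap_diagMap] at hn ⊢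
    rw [hH.conj _ h1 hn, ih h1, diagMap_diagMap, ← pow_succ', ← pow_succ']

/-- The backward orbit of a point of the disk never leaves the cylinder, and neither does its image.
A nonzero height of the image would be expanded by `lam'⁻ⁿ`. The vertical axis is treated dually,
with forward orbits. -/
theorem map_disk (hH : IsLocalConj μ μ' lam lam' a a' H) (hμ : 1 < ‖μ‖) (hl0 : 0 < lam)
    (hl1 : lam < 1) (hl0' : 0 < lam') (hl1' : lam' < 1) {z : ℂ} (hz : ‖z‖ ≤ a) :
    (H (z, 0)).2 = 0 := by
  have hμ0 : μ ≠ 0 := by rintro rfl; simp at hμ; linarith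
  have ha : 0 ≤ a := (norm_nonneg z).trans hz
  have hmem : (z, (0 : ℝ)) ∈ cylinder a := mem_cylinder.2 ⟨hz, by simpa using ha⟩
  by_contra hne
  have hb : ∀ n : ℕ, lam'⁻¹ ^ n * |(H (z, 0)).2| ≤ a' := by
    intro n
    have e := diagMap_inv_pow_cancel hμ0 hl0.ne' n (z, 0)
    have hmem' : diagMap (μ⁻¹ ^ n) (lam⁻¹ ^ n) (z, 0) ∈ cylinder a := by
      rw [mem_cylinder]
      simp only [diagMap, norm_mul, norm_pow, norm_inv, mul_zero, abs_zero]
      refine ⟨le_trans ?_ hz, ha⟩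
      exact mul_le_of_le_one_left (norm_nonneg _) (pow_le_one₀ (by positivity)
        (inv_le_one_of_one_le₀ hμ.le))
    have h1 := hH.conj_pow hμ hl0 hl1 hmem' (by rwa [e])
    rw [e] at h1
    have h2 := (mem_cylinder.1 (hH.mapsTo hmem')).2
    rw [h1]
    simp only [diagMap, abs_mul, abs_pow, abs_of_pos hl0']
    rw [← mul_assoc, ← mul_pow, inv_mul_cancel₀ hl0'.ne', one_pow, one_mul]
    exact h2
  have := ((tendsto_pow_atTop_atTop_of_one_lt ((one_lt_inv₀ hl0').2 hl1')).atTop_mul_const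
    (abs_pos.2 hne)).eventually_gt_atTop a'
  obtain ⟨n, hn⟩ := this.exists
  exact absurd (hb n) (not_le.2 hn)

theorem map_axis (hH : IsLocalConj μ μ' lam lam' a a' H) (hμ : 1 < ‖μ‖) (hμ' : 1 < ‖μ'‖)
    (hl0 : 0 < lam) (hl1 : lam < 1) {t : ℝ} (ht : |t| ≤ a) : (H (0, t)).1 = 0 := by
  have ha : 0 ≤ a := (abs_nonneg t).trans ht
  have hmem : ((0 : ℂ), t) ∈ cylinder a := mem_cylinder.2 ⟨by simpa using ha, ht⟩
  by_contra hne
  have hb : ∀ n : ℕ, ‖μ'‖ ^ n * ‖(H (0, t)).1‖ ≤ a' := by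
    intro n
    have hmem' : diagMap (μ ^ n) (lam ^ n) (0, t) ∈ cylinder a := by
      rw [mem_cylinder]
      simp only [diagMap, mul_zero, norm_zero, abs_mul, abs_pow, abs_of_pos hl0]
      exact ⟨ha, le_trans (mul_le_of_le_one_left (abs_nonneg _) (pow_le_one₀ hl0.le hl1.le)) ht⟩
    have h2 := (mem_cylinder.1 (hH.mapsTo hmem')).1
    rw [hH.conj_pow hμ hl0 hl1 hmem hmem'] at h2
    simpa [diagMap, norm_mul, norm_pow] using h2
  have := ((tendsto_pow_atTop_atTop_of_one_lt hμ').atTop_mul_const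
    (norm_pos_iff.2 hne)).eventually_gt_atTop a'
  obtain ⟨n, hn⟩ := this.exists
  exact absurd (hb n) (not_le.2 hn)

end IsLocalConj

end Cylinder

/-! ### Dynamics in the linearizing chart -/

section ChartDynamics

variable {M : Type*} [TopologicalSpace M] [ChartedSpace E3 M] {k : ℕ∞} {f : M ≃ M} {p : M}
  {r θ lam a : ℝ} {φ : OpenPartialHomeomorph M (ℂ × ℝ)}

/-- The complex multiplier `r e^{iθ}`. -/
noncomputable def multiplier (r θ : ℝ) : ℂ := (r : ℂ) * (Circle.exp θ : ℂ)

theorem norm_multiplier {r θ : ℝ} (hr : 0 < r) : ‖multiplier r θ‖ = r := by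
  rw [multiplier, norm_mul, Circle.norm_coe, mul_one, Complex.norm_real, Real.norm_eq_abs,
    abs_of_pos hr]

namespace IsLinearizingChart

theorem norm_mult (hφ : IsLinearizingChart k f p r θ lam a φ) : ‖multiplier r θ‖ = r :=
  norm_multiplier (zero_lt_one.trans hφ.one_lt_r)

theorem one_lt_norm_mult (hφ : IsLinearizingChart k f p r θ lam a φ) : 1 < ‖multiplier r θ‖ := by
  rw [hφ.norm_mult]; exact hφ.one_lt_r

theorem mult_ne_zero (hφ : IsLinearizingChart k f p r θ lam a φ) : multiplier r θ ≠ 0 := by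
  rw [← norm_pos_iff, hφ.norm_mult]
  exact zero_lt_one.trans hφ.one_lt_r

theorem apply_of_mem (hφ : IsLinearizingChart k f p r θ lam a φ) {x : M} (hx : x ∈ φ.source)
    (hfx : f x ∈ φ.source) : φ (f x) = diagMap (multiplier r θ) lam (φ x) := by
  rw [hφ.linear x hx hfx, diagMap, multiplier, Circle.coe_exp]

theorem cylinder_subset_target (hφ : IsLinearizingChart k f p r θ lam a φ) :
    cylinder a ⊆ φ.target := hφ.cylinder_subset

theorem symm_zero (hφ : IsLinearizingChart k f p r θ lam a φ) : φ.symm 0 = p := by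
  rw [← hφ.map_base, φ.left_inv hφ.mem_source]

/-- The chart is linearizing only at points whose image is already known to stay in its source, so a
connectedness argument is needed: the set of `s ∈ [0, 1]` for which the formula holds at `s • w` is
clopen and contains 0. Closedness uses the Hausdorff property. -/
theorem map_symm [T2Space M] (hφ : IsLinearizingChart k f p r θ lam a φ) (hf : Continuous f)
    {w : ℂ × ℝ} (hw : w ∈ cylinder a) (hfw : diagMap (multiplier r θ) lam w ∈ cylinder a) :
    f (φ.symm w) = φ.symm (diagMap (multiplier r θ) lam w) := by
  set L := diagMap (multiplier r θ) lam with hL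
  have hLc : Continuous L := continuous_diagMap _ _
  have hm1 : ∀ s : unitInterval, (s : ℝ) • w ∈ φ.target := fun s =>
    hφ.cylinder_subset_target (smul_mem_cylinder s.2.1 s.2.2 hw)
  have hm2 : ∀ s : unitInterval, L ((s : ℝ) • w) ∈ φ.target := fun s =>
    hφ.cylinder_subset_target (by
      rw [hL, diagMap_smul]; exact smul_mem_cylinder s.2.1 s.2.2 hfw)
  have hc0 : Continuous fun s : unitInterval => (s : ℝ) • w := by fun_prop
  have hc1 : Continuous fun s : unitInterval => f (φ.symm ((s : ℝ) • w)) :=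
    hf.comp (φ.continuousOn_symm.comp_continuous hc0 hm1)
  have hc2 : Continuous fun s : unitInterval => φ.symm (L ((s : ℝ) • w)) :=
    φ.continuousOn_symm.comp_continuous (hLc.comp hc0) hm2
  have hclopen : IsClopen {s : unitInterval | f (φ.symm ((s : ℝ) • w)) = φ.symm (L ((s : ℝ) • w))} := by
    refine ⟨isClosed_eq hc1 hc2, ?_⟩
    rw [isOpen_iff_mem_nhds]
    intro s hs
    have hs' : f (φ.symm ((s : ℝ) • w)) ∈ φ.source := by
      rw [show f (φ.symm ((s : ℝ) • w)) = _ from hs]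
      exact φ.map_target (hm2 s)
    filter_upwards [hc1.continuousAt.eventually (φ.open_source.mem_nhds hs')] with t ht
    have := hφ.apply_of_mem (φ.map_target (hm1 t)) ht
    rw [φ.right_inv (hm1 t)] at this
    change f (φ.symm ((t : ℝ) • w)) = φ.symm (L ((t : ℝ) • w))
    rw [hL, ← this, φ.left_inv ht]
  have huniv := hclopen.eq_univ ⟨0, by
    change f (φ.symm (((0 : unitInterval) : ℝ) • w)) = φ.symm (L (((0 : unitInterval) : ℝ) • w))
    have : L 0 = 0 := by simp [hL, diagMap]
    rw [Set.Icc.coe_zero, zero_smul, this, hφ.symm_zero, hφ.fixed]⟩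
  have h1 : (1 : unitInterval) ∈ {s : unitInterval | f (φ.symm ((s : ℝ) • w)) =
      φ.symm (L ((s : ℝ) • w))} := by rw [huniv]; trivial
  simpa using h1

theorem iterate_map_symm [T2Space M] (hφ : IsLinearizingChart k f p r θ lam a φ)
    (hf : Continuous f) {w : ℂ × ℝ} {n : ℕ} (hw : w ∈ cylinder a)
    (hn : diagMap (multiplier r θ ^ n) (lam ^ n) w ∈ cylinder a) :
    f^[n] (φ.symm w) = φ.symm (diagMap (multiplier r θ ^ n) (lam ^ n) w) := by
  induction n with
  | zero => simp [diagMap]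
  | succ n ih =>
    have h1 := diagMap_pow_mem_cylinder hφ.one_lt_norm_mult hφ.lam_pos hφ.lam_lt_one
      (Nat.le_succ n) hw hn
    rw [Function.iterate_succ_apply', ih h1]
    rw [pow_succ', pow_succ', ← diagMap_diagMap] at hn ⊢
    exact hφ.map_symm hf h1 hn

theorem iterate_symm_map_symm [T2Space M] (hφ : IsLinearizingChart k f p r θ lam a φ)
    (hf : Continuous f) {w : ℂ × ℝ} {n : ℕ} (hw : w ∈ cylinder a)
    (hn : diagMap ((multiplier r θ)⁻¹ ^ n) (lam⁻¹ ^ n) w ∈ cylinder a) :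
    f.symm^[n] (φ.symm w) = φ.symm (diagMap ((multiplier r θ)⁻¹ ^ n) (lam⁻¹ ^ n) w) := by
  have e := diagMap_inv_pow_cancel hφ.mult_ne_zero hφ.lam_pos.ne' n w
  have h1 := hφ.iterate_map_symm hf hn (by rwa [e])
  rw [e] at h1
  rw [← h1]
  exact (Function.LeftInverse.iterate f.symm_apply_apply n) _

theorem map_disk_inv [T2Space M] (hφ : IsLinearizingChart k f p r θ lam a φ)
    (hf : Continuous f) {x : M} (hx : x ∈ unstableDisk φ a) (n : ℕ) :
    f.symm^[n] x ∈ unstableDisk φ a ∧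
      φ (f.symm^[n] x) = ((multiplier r θ)⁻¹ ^ n * (φ x).1, 0) := by
  obtain ⟨hxs, hx1, hx2⟩ := hx
  have e : φ x = ((φ x).1, 0) := Prod.ext rfl hx2
  have hw : φ x ∈ cylinder a := mem_cylinder.2 ⟨hx1, by rw [hx2, abs_zero]; exact hφ.a_pos.le⟩
  have hd : diagMap ((multiplier r θ)⁻¹ ^ n) (lam⁻¹ ^ n) (φ x) =
      ((multiplier r θ)⁻¹ ^ n * (φ x).1, 0) := by simp [diagMap, hx2]
  have hle : ‖(multiplier r θ)⁻¹ ^ n * (φ x).1‖ ≤ a := by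
    rw [norm_mul, norm_pow, norm_inv]
    refine le_trans ?_ hx1
    exact mul_le_of_le_one_left (norm_nonneg _) (pow_le_one₀ (by positivity)
        (inv_le_one_of_one_le₀ hφ.one_lt_norm_mult.le))
  have hn : diagMap ((multiplier r θ)⁻¹ ^ n) (lam⁻¹ ^ n) (φ x) ∈ cylinder a := by
    rw [hd]
    exact mem_cylinder.2 ⟨hle, by simpa using hφ.a_pos.le⟩
  have h1 := hφ.iterate_symm_map_symm hf hw hn
  rw [φ.left_inv hxs] at h1
  have h2 : φ (f.symm^[n] x) = ((multiplier r θ)⁻¹ ^ n * (φ x).1, 0) := by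
    rw [h1, φ.right_inv (hφ.cylinder_subset_target hn), hd]
  refine ⟨⟨?_, ?_, ?_⟩, h2⟩
  · rw [h1]; exact φ.map_target (hφ.cylinder_subset_target hn)
  · rw [h2]; exact hle
  · rw [h2]

theorem map_segment [T2Space M] (hφ : IsLinearizingChart k f p r θ lam a φ)
    (hf : Continuous f) {x : M} (hx : x ∈ stableSegment φ a) (n : ℕ) :
    f^[n] x ∈ stableSegment φ a ∧ φ (f^[n] x) = (0, lam ^ n * (φ x).2) := by
  obtain ⟨hxs, hx1, hx2⟩ := hx
  have hw : φ x ∈ cylinder a := mem_cylinder.2 ⟨by rw [hx1, norm_zero]; exact hφ.a_pos.le, hx2⟩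
  have hd : diagMap (multiplier r θ ^ n) (lam ^ n) (φ x) = (0, lam ^ n * (φ x).2) := by
    simp [diagMap, hx1]
  have hle : |lam ^ n * (φ x).2| ≤ a := by
    rw [abs_mul, abs_pow, abs_of_pos hφ.lam_pos]
    refine le_trans ?_ hx2
    exact mul_le_of_le_one_left (abs_nonneg _) (pow_le_one₀ hφ.lam_pos.le hφ.lam_lt_one.le)
  have hn : diagMap (multiplier r θ ^ n) (lam ^ n) (φ x) ∈ cylinder a := by
    rw [hd]
    exact mem_cylinder.2 ⟨by simpa using hφ.a_pos.le, hle⟩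
  have h1 := hφ.iterate_map_symm hf hw hn
  rw [φ.left_inv hxs] at h1
  have h2 : φ (f^[n] x) = (0, lam ^ n * (φ x).2) := by
    rw [h1, φ.right_inv (hφ.cylinder_subset_target hn), hd]
  refine ⟨⟨?_, ?_, ?_⟩, h2⟩
  · rw [h1]; exact φ.map_target (hφ.cylinder_subset_target hn)
  · rw [h2]
  · rw [h2]; exact hle

end IsLinearizingChart

/-- The local expression of `h` in the charts `φ` and `φ'`. -/
noncomputable def localExpr (φ φ' : OpenPartialHomeomorph M (ℂ × ℝ)) (h : M → M) (w : ℂ × ℝ) : ℂ × ℝ :=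
  φ' (h (φ.symm w))

theorem exists_isLocalConj [T2Space M] {f' : M ≃ M} {p' : M} {r' θ' lam' a' : ℝ}
    {φ' : OpenPartialHomeomorph M (ℂ × ℝ)} (hφ : IsLinearizingChart k f p r θ lam a φ)
    (hφ' : IsLinearizingChart k f' p' r' θ' lam' a' φ') (hf : Continuous f) (h : M ≃ₜ M)
    (hconj : ∀ x, h (f x) = f' (h x)) (hp : h p = p') :
    ∃ a₁ > 0, ∀ a₀, 0 < a₀ → a₀ ≤ a₁ → a₀ ≤ a ∧
      IsLocalConj (multiplier r θ) (multiplier r' θ') lam lam' a₀ a' (localExpr φ φ' h) ∧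
      ∀ w ∈ cylinder a₀, h (φ.symm w) ∈ φ'.source := by
  have h0 : (0 : ℂ × ℝ) ∈ cylinder a := mem_cylinder.2 (by simpa using hφ.a_pos.le)
  have hc : ContinuousAt (fun w => h (φ.symm w)) 0 :=
    h.continuous.continuousAt.comp (φ.continuousAt_symm (hφ.cylinder_subset_target h0))
  have hb : h (φ.symm 0) = p' := by rw [hφ.symm_zero, hp]
  have hev1 : ∀ᶠ w in 𝓝 (0 : ℂ × ℝ), h (φ.symm w) ∈ φ'.source :=
    hc.eventually (φ'.open_source.mem_nhds (by simpa only [hb] using hφ'.mem_source))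
  have hc2 : ContinuousAt (localExpr φ φ' h) 0 := by
    refine ContinuousAt.comp (g := φ') (f := fun w => h (φ.symm w)) ?_ hc
    rw [hb]
    exact φ'.continuousAt hφ'.mem_source
  have hb2 : localExpr φ φ' h 0 = 0 := by rw [localExpr, hb, hφ'.map_base]
  have hev2 : ∀ᶠ w in 𝓝 (0 : ℂ × ℝ), localExpr φ φ' h w ∈ cylinder a' :=
    hc2.eventually (by
      rw [hb2]; exact cylinder_mem_nhds (by simpa using hφ'.a_pos) (by simpa using hφ'.a_pos))
  obtain ⟨ε, hε, hball⟩ := Metric.eventually_nhds_iff_ball.1 (hev1.and hev2)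
  refine ⟨min a (ε / 2), by have := hφ.a_pos; positivity, fun a₀ ha0 ha1 => ?_⟩
  have haa : a₀ ≤ a := ha1.trans (min_le_left _ _)
  have haε : a₀ < ε := by have := ha1.trans (min_le_right _ _); linarith
  have hsub : cylinder a₀ ⊆ Metric.ball 0 ε := by
    intro w hw
    rw [mem_cylinder] at hw
    rw [mem_ball_zero_iff, Prod.norm_def, Real.norm_eq_abs]
    exact (max_le hw.1 hw.2).trans_lt haε
  have hsuba : cylinder a₀ ⊆ cylinder a := fun w hw =>
    mem_cylinder.2 ⟨(mem_cylinder.1 hw).1.trans haa, (mem_cylinder.1 hw).2.trans haa⟩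
  have hsubt : cylinder a₀ ⊆ φ.target := hsuba.trans hφ.cylinder_subset_target
  refine ⟨haa, ⟨?_, fun w hw => (hball w (hsub hw)).2, ?_, hb2, ?_⟩,
    fun w hw => (hball w (hsub hw)).1⟩
  · exact φ'.continuousOn.comp (h.continuous.comp_continuousOn (φ.continuousOn_symm.mono hsubt))
      (fun w hw => (hball w (hsub hw)).1)
  · intro w hw v hv hwv
    have h1 := φ'.injOn (hball w (hsub hw)).1 (hball v (hsub hv)).1 hwv
    exact φ.symm.injOn (hsubt hw) (hsubt hv) (h.injective h1)
  · intro w hw hLw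
    have h1 := hφ.map_symm hf (hsuba hw) (hsuba hLw)
    rw [localExpr, ← h1, hconj]
    apply hφ'.apply_of_mem (hball w (hsub hw)).1
    rw [← hconj, h1]
    exact (hball _ (hsub hLw)).1

end ChartDynamics

/-! ### Iterates between the stable segment and the unstable disk -/

section Transitions

variable {M : Type*} [TopologicalSpace M]

/-- The `m`-th iterate of `f` in the chart `φ`. -/
noncomputable def chartIterate (φ : OpenPartialHomeomorph M (ℂ × ℝ)) (f : M → M) (m : ℕ)
    (w : ℂ × ℝ) : ℂ × ℝ :=
  φ (f^[m] (φ.symm w))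

theorem contactFunction_eq (f : M ≃ M) (φ : OpenPartialHomeomorph M (ℂ × ℝ)) (N K : ℕ) (τ : ℝ) :
    contactFunction f φ N K τ = (chartIterate φ f.symm (K + N) (0, τ)).2 := by
  rw [contactFunction, stableArc, chartIterate, Function.iterate_add_apply]

variable {f : M ≃ M} {φ : OpenPartialHomeomorph M (ℂ × ℝ)}

/-- The `m`-th iterate of `f` takes the point of coordinates `w₁` to the point of coordinates
`w₀`. -/
structure IsTransition (f : M ≃ M) (φ : OpenPartialHomeomorph M (ℂ × ℝ)) (m : ℕ)
    (w₀ w₁ : ℂ × ℝ) : Prop where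
  mem₀ : w₀ ∈ φ.target
  mem₁ : w₁ ∈ φ.target
  map : f.symm^[m] (φ.symm w₀) = φ.symm w₁

namespace IsTransition

variable {m : ℕ} {w₀ w₁ : ℂ × ℝ}

theorem map' (h : IsTransition f φ m w₀ w₁) : f^[m] (φ.symm w₁) = φ.symm w₀ := by
  rw [← h.map]
  exact (Function.LeftInverse.iterate f.apply_symm_apply m) _

theorem backward_eq (h : IsTransition f φ m w₀ w₁) : chartIterate φ f.symm m w₀ = w₁ := by
  rw [chartIterate, h.map, φ.right_inv h.mem₁]

theorem forward_eq (h : IsTransition f φ m w₀ w₁) : chartIterate φ f m w₁ = w₀ := by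
  rw [chartIterate, h.map', φ.right_inv h.mem₀]

theorem eventually_backward_mem (h : IsTransition f φ m w₀ w₁) (hf : Continuous f.symm) :
    ∀ᶠ w in 𝓝 w₀, w ∈ φ.target ∧ f.symm^[m] (φ.symm w) ∈ φ.source := by
  have hc : ContinuousAt (fun w => f.symm^[m] (φ.symm w)) w₀ :=
    (hf.iterate m).continuousAt.comp (φ.continuousAt_symm h.mem₀)
  have ht : ∀ᶠ w in 𝓝 w₀, w ∈ φ.target := φ.open_target.mem_nhds h.mem₀
  refine ht.and (hc.eventually (φ.open_source.mem_nhds ?_))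
  simpa only [h.map] using φ.map_target h.mem₁

theorem eventually_forward_mem (h : IsTransition f φ m w₀ w₁) (hf : Continuous f) :
    ∀ᶠ w in 𝓝 w₁, w ∈ φ.target ∧ f^[m] (φ.symm w) ∈ φ.source := by
  have hc : ContinuousAt (fun w => f^[m] (φ.symm w)) w₁ :=
    (hf.iterate m).continuousAt.comp (φ.continuousAt_symm h.mem₁)
  have ht : ∀ᶠ w in 𝓝 w₁, w ∈ φ.target := φ.open_target.mem_nhds h.mem₁
  refine ht.and (hc.eventually (φ.open_source.mem_nhds ?_))
  simpa only [h.map'] using φ.map_target h.mem₀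

theorem eventually_backward_forward (h : IsTransition f φ m w₀ w₁) (hf : Continuous f) :
    ∀ᶠ w in 𝓝 w₁, chartIterate φ f.symm m (chartIterate φ f m w) = w := by
  filter_upwards [h.eventually_forward_mem hf] with w ⟨h1, h2⟩
  rw [chartIterate, chartIterate, φ.left_inv h2,
    (Function.LeftInverse.iterate f.symm_apply_apply m) _, φ.right_inv h1]

end IsTransition

/-- The point `q` is brought by `f^N` to the stable segment and by `f^{-K}` to the unstable disk. -/
def IsHomoclinicAt (f : M ≃ M) (φ : OpenPartialHomeomorph M (ℂ × ℝ)) (a : ℝ) (q : M)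
    (N K : ℕ) : Prop :=
  f^[N] q ∈ stableSegment φ a ∧ f.symm^[K] q ∈ unstableDisk φ a

namespace IsHomoclinicAt

variable {N K : ℕ} {q : M} {a : ℝ}

theorem eta_stable (h : IsHomoclinicAt f φ a q N K) : φ (f^[N] q) = (0, (φ (f^[N] q)).2) :=
  Prod.ext h.1.2.1 rfl

theorem eta_unstable (h : IsHomoclinicAt f φ a q N K) :
    φ (f.symm^[K] q) = ((φ (f.symm^[K] q)).1, 0) :=
  Prod.ext rfl h.2.2.2

theorem isTransition (h : IsHomoclinicAt f φ a q N K) :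
    IsTransition f φ (K + N) (0, (φ (f^[N] q)).2) ((φ (f.symm^[K] q)).1, 0) := by
  rw [← h.eta_stable, ← h.eta_unstable]
  refine ⟨φ.map_source h.1.1, φ.map_source h.2.1, ?_⟩
  rw [φ.left_inv h.1.1, φ.left_inv h.2.1, Function.iterate_add_apply,
    (Function.LeftInverse.iterate f.symm_apply_apply N) _]

end IsHomoclinicAt

variable [ChartedSpace E3 M] {k : ℕ∞} {p : M}
  {r θ lam a : ℝ}

theorem ContMDiff.iterate_E3 {g : M → M} (hg : ContMDiff 𝓘(ℝ, E3) 𝓘(ℝ, E3) k g) (m : ℕ) :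
    ContMDiff 𝓘(ℝ, E3) 𝓘(ℝ, E3) k g^[m] := by
  induction m with
  | zero => exact contMDiff_id
  | succ m ih => rw [Function.iterate_succ']; exact hg.comp ih

namespace IsLinearizingChart

theorem contDiffAt_chartIterate (hφ : IsLinearizingChart k f p r θ lam a φ) {g : M → M}
    (hg : ContMDiff 𝓘(ℝ, E3) 𝓘(ℝ, E3) k g) {m : ℕ} {w : ℂ × ℝ} (hw : w ∈ φ.target)
    (hgw : g^[m] (φ.symm w) ∈ φ.source) : ContDiffAt ℝ k (chartIterate φ g m) w := by
  rw [← contMDiffAt_iff_contDiffAt]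
  have h1 : ContMDiffAt 𝓘(ℝ, ℂ × ℝ) 𝓘(ℝ, E3) k φ.symm w :=
    hφ.contMDiffOn_symm.contMDiffAt (φ.open_target.mem_nhds hw)
  have h2 : ContMDiffAt 𝓘(ℝ, E3) 𝓘(ℝ, ℂ × ℝ) k φ (g^[m] (φ.symm w)) :=
    hφ.contMDiffOn.contMDiffAt (φ.open_source.mem_nhds hgw)
  exact h2.comp w ((hg.iterate_E3 m).contMDiffAt.comp w h1)

end IsLinearizingChart

namespace IsTransition

variable {m : ℕ} {w₀ w₁ : ℂ × ℝ}

theorem contDiffAt_backward (h : IsTransition f φ m w₀ w₁)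
    (hφ : IsLinearizingChart k f p r θ lam a φ)
    (hf : ContMDiff 𝓘(ℝ, E3) 𝓘(ℝ, E3) k f.symm) : ContDiffAt ℝ k (chartIterate φ f.symm m) w₀ :=
  hφ.contDiffAt_chartIterate hf h.mem₀ (by rw [h.map]; exact φ.map_target h.mem₁)

theorem contDiffAt_forward (h : IsTransition f φ m w₀ w₁)
    (hφ : IsLinearizingChart k f p r θ lam a φ)
    (hf : ContMDiff 𝓘(ℝ, E3) 𝓘(ℝ, E3) k f) : ContDiffAt ℝ k (chartIterate φ f m) w₁ :=
  hφ.contDiffAt_chartIterate hf h.mem₁ (by rw [h.map']; exact φ.map_target h.mem₀)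

end IsTransition

end Transitions

/-! ### Dependence of the contact function on the chosen iterates -/

section ContactShift

variable {M : Type*} [TopologicalSpace M] [T2Space M] [ChartedSpace E3 M] {k : ℕ∞} {f : M ≃ M}
  {p q : M} {r θ lam a : ℝ} {φ : OpenPartialHomeomorph M (ℂ × ℝ)}

namespace IsHomoclinicAt

variable {N K : ℕ}

theorem succ_left (h : IsHomoclinicAt f φ a q N K) (hφ : IsLinearizingChart k f p r θ lam a φ)
    (hf : Continuous f) : IsHomoclinicAt f φ a q (N + 1) K ∧
      (φ (f^[N + 1] q)).2 = lam * (φ (f^[N] q)).2 := by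
  obtain ⟨h1, h2⟩ := hφ.map_segment hf h.1 1
  rw [Function.iterate_one, ← Function.iterate_succ_apply' f] at h1 h2
  exact ⟨⟨h1, h.2⟩, by rw [h2, pow_one]⟩

theorem succ_right (h : IsHomoclinicAt f φ a q N K) (hφ : IsLinearizingChart k f p r θ lam a φ)
    (hf : Continuous f) : IsHomoclinicAt f φ a q N (K + 1) := by
  obtain ⟨h1, -⟩ := hφ.map_disk_inv hf h.2 1
  rw [Function.iterate_one, ← Function.iterate_succ_apply' f.symm] at h1
  exact ⟨h.1, h1⟩

/-- One more backward iterate inside the chart only rescales heights, and in `contact_succ_left` one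
more forward iterate only rescales the parameter. Orders of vanishing and signs therefore pass to
larger `N`, `K`. This allows the tangency and the positive association, given with unrelated
exponents, to be used together. -/
theorem contact_succ_right (h : IsHomoclinicAt f φ a q N K)
    (hφ : IsLinearizingChart k f p r θ lam a φ) (hf : Continuous f) (hf' : Continuous f.symm) :
    contactFunction f φ N (K + 1) =ᶠ[𝓝 (φ (f^[N] q)).2]
      fun τ => lam⁻¹ * contactFunction f φ N K τ := by
  have ht : Tendsto (fun τ : ℝ => ((0 : ℂ), τ)) (𝓝 (φ (f^[N] q)).2) (𝓝 (0, (φ (f^[N] q)).2)) := by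
    have : Continuous fun τ : ℝ => ((0 : ℂ), τ) := by fun_prop
    exact this.tendsto _
  filter_upwards [ht.eventually (h.isTransition.eventually_backward_mem hf'),
    ht.eventually ((h.succ_right hφ hf).isTransition.eventually_backward_mem hf')]
    with τ ⟨_, h1⟩ ⟨_, h2⟩
  rw [contactFunction_eq, contactFunction_eq, chartIterate, chartIterate]
  rw [Nat.succ_add, Function.iterate_succ_apply'] at h2 ⊢
  have h3 := hφ.apply_of_mem h2 (by rwa [f.apply_symm_apply])
  rw [f.apply_symm_apply] at h3
  rw [h3, diagMap]
  have := hφ.lam_pos.ne'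
  field_simp

theorem contact_succ_left (h : IsHomoclinicAt f φ a q N K)
    (hφ : IsLinearizingChart k f p r θ lam a φ) (hf : Continuous f) (hf' : Continuous f.symm) :
    contactFunction f φ (N + 1) K =ᶠ[𝓝 (φ (f^[N + 1] q)).2]
      fun τ => contactFunction f φ N K (lam⁻¹ * τ) := by
  obtain ⟨hs, hτ⟩ := h.succ_left hφ hf
  set τ₁ := (φ (f^[N + 1] q)).2 with hτ₁
  have ht : Tendsto (fun τ : ℝ => ((0 : ℂ), τ)) (𝓝 τ₁) (𝓝 (0, τ₁)) := by
    have : Continuous fun τ : ℝ => ((0 : ℂ), τ) := by fun_prop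
    exact this.tendsto _
  have hp1 : φ.symm (0, τ₁) = f^[N + 1] q := by
    rw [hτ₁, ← hs.eta_stable, φ.left_inv hs.1.1]
  have hev1 : ∀ᶠ τ in 𝓝 τ₁, ((0 : ℂ), τ) ∈ φ.target :=
    ht.eventually (φ.open_target.mem_nhds hs.isTransition.mem₀)
  have hev2 : ∀ᶠ τ in 𝓝 τ₁, f.symm (φ.symm (0, τ)) ∈ φ.source := by
    have hc : ContinuousAt (fun w => f.symm (φ.symm w)) (0, τ₁) :=
      hf'.continuousAt.comp (φ.continuousAt_symm hs.isTransition.mem₀)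
    refine ht.eventually (hc.eventually (φ.open_source.mem_nhds ?_))
    simp only [hp1]
    rw [Function.iterate_succ_apply', f.symm_apply_apply]
    exact h.1.1
  filter_upwards [hev1, hev2] with τ h1 h2
  have h3 := hφ.apply_of_mem h2 (by rw [f.apply_symm_apply]; exact φ.map_target h1)
  rw [f.apply_symm_apply, φ.right_inv h1, diagMap, Prod.mk.injEq] at h3
  have h4 : φ (f.symm (φ.symm (0, τ))) = (0, lam⁻¹ * τ) := by
    refine Prod.ext ?_ ?_
    · exact (mul_eq_zero.1 h3.1.symm).resolve_left hφ.mult_ne_zero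
    · change _ = lam⁻¹ * τ
      rw [eq_inv_mul_iff_mul_eq₀ hφ.lam_pos.ne']
      exact h3.2.symm
  rw [contactFunction, contactFunction, stableArc, stableArc, ← h4, φ.left_inv h2,
    Function.iterate_succ_apply]

end IsHomoclinicAt

/-- The contact function vanishes to order exactly two, with a positively associated sign. -/
def IsPositiveQuadratic (f : M ≃ M) (φ : OpenPartialHomeomorph M (ℂ × ℝ)) (q : M) (N K : ℕ) :
    Prop :=
  deriv (contactFunction f φ N K) (φ (f^[N] q)).2 = 0 ∧
    0 < (φ (f^[N] q)).2 * deriv (deriv (contactFunction f φ N K)) (φ (f^[N] q)).2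

end ContactShift

/-! ### Conjugacies respect rotated half-planes -/

section HalfPlane

theorem multiplier_pow_mul_inv_pow {r θ : ℝ} (n : ℕ) (z : ℂ) :
    (multiplier r θ)⁻¹ ^ n * z = ((r ^ n)⁻¹ : ℝ) • ((((Circle.exp θ) ^ n)⁻¹ : Circle) * z) := by
  rw [multiplier, mul_inv, mul_pow, Complex.real_smul]
  simp only [Circle.coe_inv, Circle.coe_pow, Complex.ofReal_inv, Complex.ofReal_pow, inv_pow]
  rw [mul_assoc]

theorem tendsto_circle_inv_mul {a u : Circle} {l : Filter ℕ} {x : ℕ → ℂ} {X : ℂ}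
    (h : Tendsto (fun n : ℕ => a ^ n) l (𝓝 u)) (hx : Tendsto x l (𝓝 X)) :
    Tendsto (fun n : ℕ => (((a ^ n)⁻¹ : Circle) : ℂ) * x n) l (𝓝 (((u⁻¹ : Circle) : ℂ) * X)) :=
  ((continuous_subtype_val.tendsto _).comp h.inv).mul hx

variable {r r' θ θ' lam lam' a₀ a' τ₀ τ₀' : ℝ} {H : ℂ × ℝ → ℂ × ℝ} {E E' : ℂ × ℝ → ℝ}

/-- A local conjugacy respects the rotated half-planes into which the unstable surfaces are folded
by the iterates. -/
theorem IsFold.half_plane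
    (hH : IsLocalConj (multiplier r θ) (multiplier r' θ') lam lam' a₀ a' H)
    (hr : 1 < r) (hr' : 1 < r') (hl0 : 0 < lam) (hl1 : lam < 1)
    (hE : IsFold E τ₀) (hE' : IsFold E' τ₀') (hτ : |τ₀| < a₀) (hHτ : H (0, τ₀) = (0, τ₀'))
    (hEE' : ∀ᶠ w in 𝓝 ((0 : ℂ), τ₀), E w = 0 → E' (H w) = 0) {u u' : Circle}
    (huu' : (u, u') ∈ rotationClosure (Circle.exp θ) (Circle.exp θ')) {z : ℂ} (hz : ‖z‖ < a₀)
    (hneg : horizontalDeriv E (0, τ₀) ((u⁻¹ : Circle) * z) < 0) :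
    horizontalDeriv E' (0, τ₀') ((u'⁻¹ : Circle) * (H (z, 0)).1) ≤ 0 := by
  obtain ⟨l, hl, hle, hu, hu'⟩ := mem_rotationClosure_iff.1 huu'
  set η := horizontalDeriv E (0, τ₀) with hη
  set η' := horizontalDeriv E' (0, τ₀') with hη'
  have hr0 : 0 < r := by linarith
  have hr0' : 0 < r' := by linarith
  have hμ : 1 < ‖multiplier r θ‖ := by rw [norm_multiplier hr0]; exact hr
  have ha0 : 0 < a₀ := (abs_nonneg _).trans_lt hτ
  have hz0 : z ≠ 0 := by rintro rfl; simp at hneg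
  have hznorm : 0 < ‖z‖ := norm_pos_iff.2 hz0
  have hHcont : ContinuousAt H (0, τ₀) :=
    hH.continuousOn.continuousAt (cylinder_mem_nhds (by simpa using ha0) hτ)
  have hHcontz : ContinuousAt H (z, 0) :=
    hH.continuousOn.continuousAt (cylinder_mem_nhds hz (by simpa using ha0))
  set κ := -η ((u⁻¹ : Circle) * z) / (2 * ‖z‖) with hκ
  have hκ0 : 0 < κ := div_pos (by linarith) (by positivity)
  -- the points of the disk of radius `r⁻ⁿ ‖z‖` over which we look for points of the surface
  set zn : ℕ → ℂ := fun n => (multiplier r θ)⁻¹ ^ n * z with hzn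
  have hznn : ∀ n, ‖zn n‖ = (r ^ n)⁻¹ * ‖z‖ := by
    intro n
    simp only [hzn]
    rw [norm_mul, norm_pow, norm_inv, norm_multiplier hr0, inv_pow]
  have hzn0 : Tendsto zn l (𝓝 0) := by
    rw [tendsto_zero_iff_norm_tendsto_zero]
    simp only [hznn]
    have := (tendsto_pow_zero_of_le_atTop (ρ := r⁻¹) (by positivity)
      (inv_lt_one_of_one_lt₀ hr) hle).mul_const ‖z‖
    simpa [inv_pow] using this
  have hznneg : ∀ᶠ n in l, η (zn n) ≤ -κ * ‖zn n‖ := by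
    have h1 : Tendsto (fun n : ℕ => η ((((Circle.exp θ) ^ n)⁻¹ : Circle) * z)) l
        (𝓝 (η ((u⁻¹ : Circle) * z))) :=
      (η.continuous.tendsto _).comp (tendsto_circle_inv_mul hu tendsto_const_nhds)
    filter_upwards [h1.eventually_lt_const (show η ((u⁻¹ : Circle) * z) < -κ * ‖z‖ by
      rw [hκ]; field_simp; linarith)] with n hn
    rw [hznn]
    simp only [hzn]
    rw [multiplier_pow_mul_inv_pow, map_smul, smul_eq_mul, mul_left_comm]
    exact mul_le_mul_of_nonneg_left hn.le (by positivity)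
  -- Over `zn n = μ⁻ⁿ z` there are points of the first surface, and their `n`-th iterates tend to
  -- `(z, 0)`. Their images under `H` lie on the second surface, so the horizontal parts satisfy `η'
  -- ≤ ε * ‖·‖`. Multiplied by `r'ⁿ`, these horizontal parts converge along `l` to `u'⁻¹ * (H (z,
  -- 0)).1`, and the homogeneous inequality passes to the limit.
  have key : ∀ ε > 0, η' ((u'⁻¹ : Circle) * (H (z, 0)).1) ≤ ε * ‖(H (z, 0)).1‖ := by
    intro ε hε
    have hev1 := hHcont.eventually (by
      simpa only [hHτ] using hE'.eventually_le_of_eq_zero hε)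
    have hcyl := cylinder_mem_nhds (w := ((0 : ℂ), τ₀)) (by simpa using ha0) hτ
    obtain ⟨δ, hδ, hball⟩ := Metric.eventually_nhds_iff_ball.1
      (hev1.and (hEE'.and (show ∀ᶠ w in 𝓝 ((0 : ℂ), τ₀), w ∈ cylinder a₀ from hcyl)))
    have hsol : ∀ᶠ n in l, ∃ t, |t - τ₀| < δ ∧ E (zn n, t) = 0 := by
      filter_upwards [hzn0.eventually (hE.eventually_exists_eq_zero hκ0 hδ), hznneg] with n h1 h2
      exact h1 h2
    obtain ⟨t, ht⟩ := hsol.choice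
    have htb : ∀ᶠ n in l, (zn n, t n) ∈ Metric.ball ((0 : ℂ), τ₀) δ := by
      filter_upwards [hzn0.norm.eventually_lt_const (by simpa using hδ), ht] with n h1 h2
      rw [← ball_prod_same]
      exact ⟨by simpa using h1, by rw [Metric.mem_ball, Real.dist_eq]; exact h2.1⟩
    have htend : Tendsto (fun n => ((z, lam ^ n * t n) : ℂ × ℝ)) l (𝓝 (z, 0)) := by
      refine tendsto_const_nhds.prodMk_nhds ?_
      refine squeeze_zero_norm' (a := fun n => lam ^ n * a₀) ?_ ?_
      · filter_upwards [htb] with n hn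
        have := (mem_cylinder.1 (hball _ hn).2.2).2
        rw [norm_mul, norm_pow, Real.norm_eq_abs, Real.norm_eq_abs, abs_of_pos hl0]
        gcongr
      · have := (tendsto_pow_zero_of_le_atTop hl0.le hl1 hle).mul_const a₀
        simpa using this
    have hdiag : ∀ n, diagMap (multiplier r θ ^ n) (lam ^ n) (zn n, t n) = (z, lam ^ n * t n) := by
      intro n
      have hne : multiplier r θ ≠ 0 := by rw [← norm_pos_iff, norm_multiplier hr0]; exact hr0
      simp only [diagMap, hzn]
      rw [← mul_assoc, ← mul_pow, mul_inv_cancel₀ hne, one_pow, one_mul]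
    have hlim := hHcontz.tendsto.comp htend
    have hconj : ∀ᶠ n in l, H (z, lam ^ n * t n) =
        diagMap (multiplier r' θ' ^ n) (lam' ^ n) (H (zn n, t n)) := by
      have hmem : ∀ᶠ n in l, ((z, lam ^ n * t n) : ℂ × ℝ) ∈ cylinder a₀ :=
        htend.eventually (cylinder_mem_nhds hz (by simpa using ha0))
      filter_upwards [hmem, htb] with n h1 h2
      rw [← hdiag] at h1 ⊢
      exact hH.conj_pow hμ hl0 hl1 (hball _ h2).2.2 h1
    have hlim1 : Tendsto (fun n => multiplier r' θ' ^ n * (H (zn n, t n)).1) l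
        (𝓝 (H (z, 0)).1) := by
      have := (continuous_fst.tendsto _).comp hlim
      refine this.congr' ?_
      filter_upwards [hconj] with n hn
      simp only [Function.comp_apply, hn, diagMap]
    have hlim2 : Tendsto (fun n => ((r' ^ n : ℝ) : ℂ) * (H (zn n, t n)).1) l
        (𝓝 ((u'⁻¹ : Circle) * (H (z, 0)).1)) := by
      refine (tendsto_circle_inv_mul hu' hlim1).congr fun n => ?_
      have : ((Circle.exp θ' : Circle) : ℂ) ^ n ≠ 0 := pow_ne_zero _ (Circle.coe_ne_zero _)
      rw [multiplier, mul_pow, Circle.coe_inv, Circle.coe_pow]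
      push_cast
      field_simp
    have hnorm : Tendsto (fun n => ε * ‖((r' ^ n : ℝ) : ℂ) * (H (zn n, t n)).1‖) l
        (𝓝 (ε * ‖((u'⁻¹ : Circle) : ℂ) * (H (z, 0)).1‖)) := hlim2.norm.const_mul ε
    have hle' := le_of_tendsto_of_tendsto ((η'.continuous.tendsto _).comp hlim2) hnorm (by
      filter_upwards [htb, ht] with n h1 h2
      obtain ⟨b1, b2, -⟩ := hball _ h1
      have := b1 (b2 h2.2)
      simp only [Function.comp_apply]
      rw [← Complex.real_smul, map_smul, norm_smul, smul_eq_mul, Real.norm_eq_abs,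
        abs_of_pos (pow_pos hr0' n), mul_left_comm]
      exact mul_le_mul_of_nonneg_left this (by positivity))
    rwa [norm_mul, Circle.norm_coe, one_mul] at hle'
  have hlim : Tendsto (fun ε : ℝ => ε * ‖(H (z, 0)).1‖) (𝓝[>] 0) (𝓝 0) := by
    have : ContinuousAt (fun ε : ℝ => ε * ‖(H (z, 0)).1‖) 0 := by fun_prop
    simpa using this.tendsto.mono_left nhdsWithin_le_nhds
  exact ge_of_tendsto hlim (by filter_upwards [self_mem_nhdsWithin] with ε hε using key ε hε)

end HalfPlane

/-! ### The sign carried by positive association -/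

section PositiveQuadratic

theorem two_le_smoothness {k : ℕ∞} (hk : 3 ≤ k) : (2 : WithTop ℕ∞) ≤ k := by
  have h : ((2 : ℕ∞) : WithTop ℕ∞) ≤ k :=
    WithTop.coe_le_coe.2 ((show (2 : ℕ∞) ≤ 3 by norm_num).trans hk)
  exact h

variable {M : Type*} [TopologicalSpace M] [T2Space M] [ChartedSpace E3 M] {k : ℕ∞} {f : M ≃ M}
  {p q : M} {r θ lam a : ℝ} {φ : OpenPartialHomeomorph M (ℂ × ℝ)}

/-- The order of contact and the sign of the contact function near `q` are both carried to all large
`N`, `K` by the shift formulas. A function vanishing to order exactly two has near its zero the sign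
of its second derivative, so the side condition becomes a condition on that derivative. -/
theorem exists_isHomoclinicAt_isPositiveQuadratic (hk : 3 ≤ k)
    (hφ : IsLinearizingChart k f p r θ lam a φ) (hf : Continuous f)
    (hf' : ContMDiff 𝓘(ℝ, E3) 𝓘(ℝ, E3) k f.symm)
    (hq : IsQuadraticTangency f p φ a q) (hpos : IsPositivelyAssociated f φ a q) :
    ∃ N₀, ∀ N ≥ N₀, ∀ K ≥ N₀, IsHomoclinicAt f φ a q N K ∧ IsPositiveQuadratic f φ q N K := by
  have hl0 := hφ.lam_pos
  have hli : lam⁻¹ ≠ 0 := inv_ne_zero hl0.ne'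
  have hfc' : Continuous f.symm := hf'.continuous
  obtain ⟨-, N₁, K₁, hs, hu, hd1, hd2⟩ := hq
  obtain ⟨N₂, hs₂, hev⟩ := hpos
  obtain ⟨n₀, hn₀⟩ := eventually_atTop.1 hev
  -- order two contact
  have hord : ∀ N ≥ N₁, ∀ K ≥ K₁, IsHomoclinicAt f φ a q N K ∧
      deriv (contactFunction f φ N K) (φ (f^[N] q)).2 = 0 ∧
      deriv (deriv (contactFunction f φ N K)) (φ (f^[N] q)).2 ≠ 0 := by
    intro N hN
    induction N, hN using Nat.le_induction with
    | base =>
      intro K hK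
      induction K, hK using Nat.le_induction with
      | base => exact ⟨⟨hs, hu⟩, hd1, hd2⟩
      | succ K hK ih =>
        obtain ⟨h, h1, h2⟩ := ih
        have e := h.contact_succ_right hφ hf hfc'
        refine ⟨h.succ_right hφ hf, ?_, ?_⟩
        · rw [e.deriv_eq, deriv_const_mul_field, h1, mul_zero]
        · rw [e.deriv.deriv_eq]
          simp only [deriv_const_mul_field']
          exact mul_ne_zero hli h2
    | succ N hN ih =>
      intro K hK
      obtain ⟨h, h1, h2⟩ := ih K hK
      have e := h.contact_succ_left hφ hf hfc'
      obtain ⟨h', hτ⟩ := h.succ_left hφ hf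
      have hτ' : lam⁻¹ * (φ (f^[N + 1] q)).2 = (φ (f^[N] q)).2 := by
        rw [hτ, inv_mul_cancel_left₀ hl0.ne']
      refine ⟨h', ?_, ?_⟩
      · rw [e.deriv_eq, deriv_comp_mul_left, hτ', h1, smul_zero]
      · rw [e.deriv.deriv_eq]
        rw [show (deriv fun τ => contactFunction f φ N K (lam⁻¹ * τ)) =
            fun τ => lam⁻¹ * deriv (contactFunction f φ N K) (lam⁻¹ * τ) from
              funext fun τ => by rw [deriv_comp_mul_left, smul_eq_mul], deriv_const_mul_field,
              deriv_comp_mul_left, hτ', smul_eq_mul]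
        exact mul_ne_zero hli (mul_ne_zero hli h2)
  -- the sign
  have hsign : ∀ N ≥ max N₁ N₂, ∀ K ≥ max K₁ (max n₀ N₂), ∀ᶠ τ in 𝓝[≠] (φ (f^[N] q)).2,
      0 < (φ (f^[N] q)).2 * contactFunction f φ N K τ := by
    intro N hN K hK
    have hK₁ : K₁ ≤ K := (le_max_left _ _).trans hK
    have hKn : n₀ ≤ K := ((le_max_left _ _).trans (le_max_right _ _)).trans hK
    have hKN : N₂ ≤ K := ((le_max_right _ _).trans (le_max_right _ _)).trans hK
    obtain ⟨-, hu'⟩ := (hord N₁ le_rfl K hK₁).1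
    have hbase : ∀ᶠ τ in 𝓝[≠] (φ (f^[N₂] q)).2,
        0 < (φ (f^[N₂] q)).2 * contactFunction f φ N₂ K τ := by
      filter_upwards [hn₀ K hKn] with τ hτ
      have h1 := hτ.2.2
      have h2 : (φ (f^[K] q)).2 = lam ^ (K - N₂) * (φ (f^[N₂] q)).2 := by
        have := (hφ.map_segment hf hs₂ (K - N₂)).2
        rw [← Function.iterate_add_apply, Nat.sub_add_cancel hKN] at this
        rw [this]
      rw [h2, mul_assoc] at h1
      exact pos_of_mul_pos_right h1 (by positivity)
    have hall : ∀ N ≥ N₂, IsHomoclinicAt f φ a q N K ∧ ∀ᶠ τ in 𝓝[≠] (φ (f^[N] q)).2,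
        0 < (φ (f^[N] q)).2 * contactFunction f φ N K τ := by
      intro N hN
      induction N, hN using Nat.le_induction with
      | base => exact ⟨⟨hs₂, hu'⟩, hbase⟩
      | succ N hN ih =>
        obtain ⟨h, hev⟩ := ih
        obtain ⟨h', hτ⟩ := h.succ_left hφ hf
        refine ⟨h', ?_⟩
        have e := h.contact_succ_left hφ hf hfc'
        have ht : Tendsto (fun τ => lam⁻¹ * τ) (𝓝[≠] (φ (f^[N + 1] q)).2)
            (𝓝[≠] (φ (f^[N] q)).2) := by
          refine tendsto_nhdsWithin_iff.2 ⟨?_, ?_⟩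
          · have hc : ContinuousAt (fun τ => lam⁻¹ * τ) (φ (f^[N + 1] q)).2 := by fun_prop
            have := hc.tendsto.mono_left (nhdsWithin_le_nhds (s := {(φ (f^[N + 1] q)).2}ᶜ))
            rw [hτ, inv_mul_cancel_left₀ hl0.ne'] at this
            rwa [hτ]
          · filter_upwards [self_mem_nhdsWithin] with τ hne heq
            apply hne
            rw [Set.mem_singleton_iff] at heq ⊢
            rw [hτ, ← heq, mul_inv_cancel_left₀ hl0.ne']
        filter_upwards [ht.eventually hev, e.filter_mono nhdsWithin_le_nhds] with τ h1 h2
        rw [h2, hτ, mul_assoc]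
        exact mul_pos hl0 h1
    exact (hall N ((le_max_right _ _).trans hN)).2
  refine ⟨max (max N₁ N₂) (max K₁ (max n₀ N₂)), fun N hN K hK => ?_⟩
  have hN' := (le_max_left _ _).trans hN
  have hK' := (le_max_right _ _).trans hK
  obtain ⟨h, h1, h2⟩ := hord N ((le_max_left _ _).trans hN') K ((le_max_left _ _).trans hK')
  have h3 := hsign N hN' K hK'
  refine ⟨h, h1, ?_⟩
  set τ₀ := (φ (f^[N] q)).2 with hτ₀
  set X := contactFunction f φ N K with hX
  by_contra! hneg
  have hne : τ₀ * deriv (deriv X) τ₀ ≠ 0 := by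
    refine mul_ne_zero ?_ h2
    intro h0
    rw [h0] at h3
    obtain ⟨τ, hτ⟩ := h3.exists
    simp at hτ
  have hXd : ContDiffAt ℝ 2 X τ₀ := by
    have hb : ContDiffAt ℝ 2 (chartIterate φ f.symm (K + N)) (0, τ₀) :=
      (h.isTransition.contDiffAt_backward hφ hf').of_le
        (two_le_smoothness hk)
    have : X = fun τ => (chartIterate φ f.symm (K + N) (0, τ)).2 := funext fun τ =>
      contactFunction_eq f φ N K τ
    rw [this]
    exact (ContDiffAt.comp τ₀ (f := fun τ : ℝ => ((0 : ℂ), τ)) hb (by fun_prop)).snd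
  have hX0 : X τ₀ = 0 := by
    rw [hX, contactFunction_eq, h.isTransition.backward_eq]
  have hd : deriv (fun t => -τ₀ * X t) = fun t => -τ₀ * deriv X t :=
    funext fun t => deriv_const_mul_field _
  -- With the wrong sign of the second derivative, `-τ₀ * X` would be nonnegative near `τ₀`,
  -- contradicting the side condition `h3`.
  have hq := eventually_quadratic_bounds (C := fun t => -τ₀ * X t) (τ₀ := τ₀)
    (contDiffAt_const.mul hXd) (by simp [hX0]) (by rw [hd]; simp [h1]) (by
      rw [hd, deriv_const_mul_field]
      have := lt_of_le_of_ne hneg hne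
      linarith)
  obtain ⟨τ, hτ1, hτ2⟩ := (h3.and (hq.filter_mono nhdsWithin_le_nhds)).exists
  have h5 : 0 < deriv (deriv fun t => -τ₀ * X t) τ₀ := by
    rw [hd, deriv_const_mul_field]
    have := lt_of_le_of_ne hneg hne
    linarith
  have h4 : 0 ≤ -τ₀ * X τ := le_trans (by positivity) hτ2.1
  linarith

end PositiveQuadratic

/-! ### Local inverses at transverse points and composite returns -/

section OneSide

variable {M : Type*} [TopologicalSpace M] [ChartedSpace E3 M] {k : ℕ∞} {f : M ≃ M}
  {p q : M} {r θ lam a : ℝ} {φ : OpenPartialHomeomorph M (ℂ × ℝ)}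

namespace IsTransition

variable {m : ℕ} {w₀ w₁ : ℂ × ℝ}

theorem fderiv_backward_forward (h : IsTransition f φ m w₀ w₁) (hk : 3 ≤ k)
    (hφ : IsLinearizingChart k f p r θ lam a φ)
    (hf : ContMDiff 𝓘(ℝ, E3) 𝓘(ℝ, E3) k f) (hf' : ContMDiff 𝓘(ℝ, E3) 𝓘(ℝ, E3) k f.symm)
    (v : ℂ × ℝ) : fderiv ℝ (chartIterate φ f.symm m) w₀ (fderiv ℝ (chartIterate φ f m) w₁ v) = v := by
  have hk2 := two_le_smoothness hk
  have hb : HasFDerivAt (chartIterate φ f.symm m) (fderiv ℝ (chartIterate φ f.symm m) w₀)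
      (chartIterate φ f m w₁) := by
    rw [h.forward_eq]
    exact (((h.contDiffAt_backward hφ hf').of_le hk2).differentiableAt (by norm_num)).hasFDerivAt
  have hg := (((h.contDiffAt_forward hφ hf).of_le hk2).differentiableAt (by norm_num)).hasFDerivAt
  have hc := hb.comp w₁ hg
  have hid : HasFDerivAt (chartIterate φ f.symm m ∘ chartIterate φ f m)
      (ContinuousLinearMap.id ℝ (ℂ × ℝ)) w₁ :=
    (hasFDerivAt_id w₁).congr_of_eventuallyEq (h.eventually_backward_forward hf.continuous)
  have := hc.unique hid
  exact DFunLike.congr_fun this v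

/-- At a transverse intersection, the horizontal coordinate near the stable segment is a local
coordinate on the unstable disk. -/
theorem exists_local_inverse {τ₁ : ℝ} {ζ : ℂ} (h : IsTransition f φ m (0, τ₁) (ζ, 0)) (hk : 3 ≤ k)
    (hφ : IsLinearizingChart k f p r θ lam a φ)
    (hf : ContMDiff 𝓘(ℝ, E3) 𝓘(ℝ, E3) k f) (hf' : ContMDiff 𝓘(ℝ, E3) 𝓘(ℝ, E3) k f.symm)
    (htr : deriv (fun τ => (chartIterate φ f.symm m (0, τ)).2) τ₁ ≠ 0) :
    ∃ (F : ℂ → ℂ) (Λ : ℂ →L[ℝ] ℂ), HasFDerivAt F Λ 0 ∧ F 0 = ζ ∧ Function.Surjective Λ ∧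
      (∀ᶠ x in 𝓝 0, (chartIterate φ f m (F x, 0)).1 = x) ∧
      (∀ᶠ y in 𝓝 ζ, F (chartIterate φ f m (y, 0)).1 = y) := by
  have hk2 := two_le_smoothness hk
  set P : ℂ → ℂ := fun y => (chartIterate φ f m (y, 0)).1 with hP
  set D := fderiv ℝ (chartIterate φ f m) (ζ, 0) with hD
  set B := fderiv ℝ (chartIterate φ f.symm m) (0, τ₁) with hB
  have hfw := ((h.contDiffAt_forward hφ hf).of_le hk2).hasStrictFDerivAt (by norm_num)
  have hbw := (((h.contDiffAt_backward hφ hf').of_le hk2).differentiableAt (by norm_num)).hasFDerivAt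
  set P' : ℂ →L[ℝ] ℂ := (ContinuousLinearMap.fst ℝ ℂ ℝ).comp (D.comp (ContinuousLinearMap.inl ℝ ℂ ℝ))
    with hP'
  have hPs : HasStrictFDerivAt P P' ζ := by
    have h1 : HasStrictFDerivAt (fun y : ℂ => (y, (0 : ℝ))) (ContinuousLinearMap.inl ℝ ℂ ℝ) ζ :=
      (ContinuousLinearMap.inl ℝ ℂ ℝ).hasStrictFDerivAt
    have h2 := HasStrictFDerivAt.comp (g := chartIterate φ f m) ζ hfw h1
    exact (ContinuousLinearMap.fst ℝ ℂ ℝ).hasStrictFDerivAt.comp ζ h2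
  have hBt : (B (0, 1)).2 ≠ 0 := by
    have h1 := hbw.comp_hasDerivAt τ₁ (f := fun t : ℝ => ((0 : ℂ), t))
      ((hasDerivAt_const τ₁ (0 : ℂ)).prodMk (hasDerivAt_id τ₁))
    have h2 : HasDerivAt (fun τ => (chartIterate φ f.symm m (0, τ)).2) (B (0, 1)).2 τ₁ :=
      (ContinuousLinearMap.snd ℝ ℂ ℝ).hasFDerivAt.comp_hasDerivAt τ₁ h1
    rwa [h2.deriv] at htr
  -- A vector `v` killed by `P'` makes `D (v, 0)` a multiple of `(0, 1)`. Applying `B`, which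
  -- inverts `D`, gives `(v, 0)` as the same multiple of `B (0, 1)`, whose height is nonzero by
  -- transversality. So the multiple is 0.
  have hinj : Function.Injective P' := by
    rw [injective_iff_map_eq_zero]
    intro v hv
    have h1 : D (v, 0) = (D (v, 0)).2 • ((0 : ℂ), (1 : ℝ)) := by
      refine Prod.ext ?_ ?_
      · have hv' : (D (v, 0)).1 = 0 := hv
        simp [hv']
      · simp
    have h2 := h.fderiv_backward_forward hk hφ hf hf' (v, 0)
    rw [← hD, ← hB, h1, map_smul] at h2
    have h3 := congrArg Prod.snd h2
    simp only [Prod.smul_snd, smul_eq_mul, mul_eq_zero, hBt, or_false] at h3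
    rw [h3, zero_smul] at h2
    exact (congrArg Prod.fst h2).symm
  let e : ℂ ≃L[ℝ] ℂ := (LinearEquiv.ofInjectiveEndo (P' : ℂ →ₗ[ℝ] ℂ) hinj).toContinuousLinearEquiv
  have he : (e : ℂ →L[ℝ] ℂ) = P' := by
    ext v; rfl
  rw [← he] at hPs
  have hP0 : P ζ = 0 := by rw [hP]; simp only; rw [h.forward_eq]
  refine ⟨hPs.localInverse P e ζ, (e.symm : ℂ →L[ℝ] ℂ), ?_, ?_, e.symm.surjective, ?_, ?_⟩
  · have := hPs.to_localInverse.hasFDerivAt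
    rwa [hP0] at this
  · have := hPs.localInverse_apply_image
    rwa [hP0] at this
  · have := hPs.eventually_right_inverse
    rwa [hP0] at this
  · exact hPs.eventually_left_inverse

/-- A transition followed by a passage near the fixed point and by another transition. -/
theorem chartIterate_return [T2Space M] (hφ : IsLinearizingChart k f p r θ lam a φ)
    (hf : Continuous f) (hf' : Continuous f.symm) {w : ℂ × ℝ} {n : ℕ} (hw : w ∈ φ.target)
    (hw' : f.symm^[m] (φ.symm w) ∈ φ.source)
    (h1 : ‖(chartIterate φ f.symm m w).1‖ < a) (h2 : |(chartIterate φ f.symm m w).2| < a)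
    (h3 : ‖(diagMap ((multiplier r θ)⁻¹ ^ n) (lam⁻¹ ^ n) (chartIterate φ f.symm m w)).1‖ < a)
    (h4 : |(diagMap ((multiplier r θ)⁻¹ ^ n) (lam⁻¹ ^ n) (chartIterate φ f.symm m w)).2| < a) :
    ∀ᶠ v in 𝓝 w, f.symm^[m + n + m] (φ.symm v) = f.symm^[m] (φ.symm
      (diagMap ((multiplier r θ)⁻¹ ^ n) (lam⁻¹ ^ n) (chartIterate φ f.symm m v))) := by
  have hc0 : ContinuousAt (fun w => f.symm^[m] (φ.symm w)) w :=
    (hf'.iterate m).continuousAt.comp (φ.continuousAt_symm hw)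
  have hc1 : ContinuousAt (chartIterate φ f.symm m) w :=
    ContinuousAt.comp (g := φ) (f := fun w => f.symm^[m] (φ.symm w)) (φ.continuousAt hw') hc0
  have hc2 : ContinuousAt (fun v => diagMap ((multiplier r θ)⁻¹ ^ n) (lam⁻¹ ^ n)
      (chartIterate φ f.symm m v)) w :=
    ContinuousAt.comp (g := diagMap ((multiplier r θ)⁻¹ ^ n) (lam⁻¹ ^ n))
      (continuous_diagMap _ _).continuousAt hc1
  filter_upwards [hc0.eventually (φ.open_source.mem_nhds hw'),
    hc1.eventually (cylinder_mem_nhds h1 h2), hc2.eventually (cylinder_mem_nhds h3 h4)]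
    with v hv1 hv2 hv3
  rw [Function.iterate_add_apply, Function.iterate_add_apply]
  have := hφ.iterate_symm_map_symm hf hv2 hv3
  rw [← this, chartIterate, φ.left_inv hv1]

end IsTransition

end OneSide

/-! ### The unstable surface at the tangency is a fold -/

section FoldPackage

variable {M : Type*} [TopologicalSpace M] [ChartedSpace E3 M] {k : ℕ∞} {f : M ≃ M}
  {p q : M} {r θ lam a : ℝ} {φ : OpenPartialHomeomorph M (ℂ × ℝ)} {N K : ℕ}

/-- Taking for `c₀` the second derivative of the contact function makes the second derivative of `E`
along the axis equal to `c₀² > 0`, and makes `c₀ * τ₀ > 0` the positivity condition. The horizontal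
derivative cannot vanish: the vertical one does, by tangency, and the height component of a local
diffeomorphism has nonzero differential. -/
theorem exists_isFold_of_isPositiveQuadratic (hk : 3 ≤ k)
    (hφ : IsLinearizingChart k f p r θ lam a φ)
    (hf : ContMDiff 𝓘(ℝ, E3) 𝓘(ℝ, E3) k f) (hf' : ContMDiff 𝓘(ℝ, E3) 𝓘(ℝ, E3) k f.symm)
    (h : IsHomoclinicAt f φ a q N K) (hq : IsPositiveQuadratic f φ q N K) :
    ∃ (c₀ : ℝ) (α : ℂ), 0 < c₀ * (φ (f^[N] q)).2 ∧ α ≠ 0 ∧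
      IsFold (fun w => c₀ * (chartIterate φ f.symm (K + N) w).2) (φ (f^[N] q)).2 ∧
      ∀ x : ℂ, horizontalDeriv (fun w => c₀ * (chartIterate φ f.symm (K + N) w).2)
        (0, (φ (f^[N] q)).2) x = -(α * x).re := by
  have hk2 := two_le_smoothness hk
  obtain ⟨hq1, hq2⟩ := hq
  set τ₀ := (φ (f^[N] q)).2 with hτ₀
  set X := contactFunction f φ N K with hX
  set c₀ := deriv (deriv X) τ₀ with hc₀
  have hc0 : c₀ ≠ 0 := by rintro h0; rw [h0] at hq2; simp at hq2
  set E : ℂ × ℝ → ℝ := fun w => c₀ * (chartIterate φ f.symm (K + N) w).2 with hE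
  have hbd : ContDiffAt ℝ 2 (chartIterate φ f.symm (K + N)) (0, τ₀) :=
    (h.isTransition.contDiffAt_backward hφ hf').of_le hk2
  have hEX : (fun t => E (0, t)) = fun t => c₀ * X t :=
    funext fun t => by rw [hE, hX, contactFunction_eq]
  have hEd : ContDiffAt ℝ 2 E (0, τ₀) := contDiffAt_const.mul hbd.snd
  have hdX : deriv (fun t => c₀ * X t) = fun t => c₀ * deriv X t :=
    funext fun t => deriv_const_mul_field _
  have hd0 : deriv (fun t => E (0, t)) τ₀ = 0 := by
    rw [hEX, hdX]; simp [hq1]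
  have hfold : IsFold E τ₀ := by
    refine ⟨hEd, ?_, hd0, ?_⟩
    · simp only [hE]
      rw [h.isTransition.backward_eq, mul_zero]
    · rw [hEX, hdX, deriv_const_mul_field]
      exact mul_self_pos.2 hc0
  set η := horizontalDeriv E (0, τ₀) with hη
  have hfE : ∀ v, fderiv ℝ E (0, τ₀) v =
      c₀ * (fderiv ℝ (chartIterate φ f.symm (K + N)) (0, τ₀) v).2 := by
    intro v
    have h1 := (hbd.differentiableAt (by norm_num)).hasFDerivAt
    have h2 := ((ContinuousLinearMap.snd ℝ ℂ ℝ).hasFDerivAt.comp (0, τ₀) h1).const_mul c₀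
    have h3 : fderiv ℝ E (0, τ₀) = _ := h2.fderiv
    rw [h3]
    simp
  have hη0 : η ≠ 0 := by
    intro h0
    have hvert : fderiv ℝ E (0, τ₀) (0, 1) = 0 := by
      have h1 := (hEd.differentiableAt (by norm_num)).hasFDerivAt.comp_hasDerivAt τ₀
        (f := fun t : ℝ => ((0 : ℂ), t)) ((hasDerivAt_const τ₀ (0 : ℂ)).prodMk (hasDerivAt_id τ₀))
      rw [← hd0]
      exact h1.deriv.symm
    have hall : ∀ v, fderiv ℝ E (0, τ₀) v = 0 := by
      intro v
      have e : v = (v.1, 0) + v.2 • ((0 : ℂ), (1 : ℝ)) := by ext <;> simp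
      have h1 : fderiv ℝ E (0, τ₀) (v.1, 0) = 0 := DFunLike.congr_fun h0 v.1
      rw [e, map_add, map_smul, hvert, h1, smul_zero, add_zero]
    have h1 := hfE (fderiv ℝ (chartIterate φ f (K + N)) ((φ (f.symm^[K] q)).1, 0) (0, 1))
    rw [hall, h.isTransition.fderiv_backward_forward hk hφ hf hf'] at h1
    simp at h1
    exact hc0 h1.symm
  -- The unique `α` representing the real-linear form `η` as `x ↦ -Re (α x)`.
  refine ⟨c₀, ⟨-η 1, η Complex.I⟩, by rw [mul_comm]; exact hq2, ?_, hfold, ?_⟩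
  · intro h0
    apply hη0
    have e1 := congrArg Complex.re h0
    have e2 := congrArg Complex.im h0
    simp only [Complex.zero_re, Complex.zero_im, neg_eq_zero] at e1 e2
    ext x
    have : x = x.re • (1 : ℂ) + x.im • Complex.I := by
      rw [Complex.real_smul, Complex.real_smul, mul_one, Complex.re_add_im]
    rw [this, map_add, map_smul, map_smul, e1, e2]
    simp
  · intro x
    have : x = x.re • (1 : ℂ) + x.im • Complex.I := by
      rw [Complex.real_smul, Complex.real_smul, mul_one, Complex.re_add_im]
    conv_lhs => rw [this]
    rw [map_add, map_smul, map_smul, Complex.mul_re]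
    simp only [smul_eq_mul]
    ring

end FoldPackage

/-! ### Radiality of the conjugacy and simultaneous transverse returns -/

section TwoSided

theorem denseRange_circle_exp_zpow {θ : ℝ} (hθ : Irrational (θ / (2 * Real.pi))) :
    DenseRange fun n : ℤ => Circle.exp θ ^ n := by
  have h := AddCircle.denseRange_zsmul_coe_iff.2 hθ
  have : Fact (0 < 2 * Real.pi) := ⟨Real.two_pi_pos⟩
  have hs : Function.Surjective (AddCircle.toCircle : AddCircle (2 * Real.pi) → Circle) := by
    intro u
    obtain ⟨x, hx⟩ := (AddCircle.homeomorphCircle (T := 2 * Real.pi) Real.two_pi_pos.ne').surjective u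
    exact ⟨x, by rwa [AddCircle.homeomorphCircle_apply] at hx⟩
  have h2 := hs.denseRange.comp h AddCircle.continuous_toCircle
  refine h2.mono ?_
  rintro _ ⟨n, rfl⟩
  refine ⟨n, ?_⟩
  simp only [Function.comp_apply]
  rw [AddCircle.toCircle_zsmul, AddCircle.toCircle_apply_mk]
  congr 2
  have := Real.pi_ne_zero
  field_simp

variable {r r' θ θ' lam lam' a a' a₀ a₀' τ₀ τ₀' : ℝ} {H H' : ℂ × ℝ → ℂ × ℝ} {E E' : ℂ × ℝ → ℝ}
  {α α' : ℂ}

theorem IsLocalConj.continuousOn_disk {μ μ' : ℂ}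
    (hH : IsLocalConj μ μ' lam lam' a₀ a' H) :
    ContinuousOn (fun z : ℂ => (H (z, 0)).1) (Metric.ball 0 a₀) := by
  refine continuous_fst.comp_continuousOn (hH.continuousOn.comp (by fun_prop) ?_)
  intro z hz
  rw [mem_ball_zero_iff] at hz
  exact mem_cylinder.2 ⟨hz.le, by simpa using (norm_nonneg z).trans hz.le⟩

/-- A local conjugacy between two fixed points having folded unstable surfaces is radial on the
unstable disk. -/
theorem radial_of_isFold (hθ : Irrational (θ / (2 * Real.pi)))
    (hH : IsLocalConj (multiplier r θ) (multiplier r' θ') lam lam' a₀ a' H)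
    (hH' : IsLocalConj (multiplier r' θ') (multiplier r θ) lam' lam a₀' a H')
    (hr : 1 < r) (hr' : 1 < r') (hl0 : 0 < lam) (hl1 : lam < 1) (hl0' : 0 < lam') (hl1' : lam' < 1)
    (hE : IsFold E τ₀) (hE' : IsFold E' τ₀') (hα : α ≠ 0) (hα' : α' ≠ 0)
    (hEα : ∀ x, horizontalDeriv E (0, τ₀) x = -(α * x).re)
    (hEα' : ∀ x, horizontalDeriv E' (0, τ₀') x = -(α' * x).re)
    (hτ : |τ₀| < a₀) (hτ' : |τ₀'| < a₀') (hHτ : H (0, τ₀) = (0, τ₀')) (hHτ' : H' (0, τ₀') = (0, τ₀))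
    (hEE' : ∀ᶠ w in 𝓝 ((0 : ℂ), τ₀), E w = 0 → E' (H w) = 0)
    (hE'E : ∀ᶠ w in 𝓝 ((0 : ℂ), τ₀'), E' w = 0 → E (H' w) = 0)
    (hHH' : ∀ w ∈ cylinder a₀', H (H' w) = w) (hH'H : ∀ w ∈ cylinder a₀, H' (H w) = w) :
    (∀ u u', (u, u') ∈ rotationClosure (Circle.exp θ) (Circle.exp θ') → u' = u) ∧
        (∀ z, ‖z‖ < a₀ → ∃ s : ℝ, 0 ≤ s ∧ α' * (H (z, 0)).1 = s * (α * z)) ∨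
      (∀ u u', (u, u') ∈ rotationClosure (Circle.exp θ) (Circle.exp θ') → u' = u⁻¹) ∧
        (∀ z, ‖z‖ < a₀ → ∃ s : ℝ, 0 ≤ s ∧ starRingEnd ℂ (α' * (H (z, 0)).1) = s * (α * z)) := by
  have ha : 0 < a₀ := (abs_nonneg _).trans_lt hτ
  have ha' : 0 < a₀' := (abs_nonneg _).trans_lt hτ'
  have hμ : 1 < ‖multiplier r θ‖ := by rw [norm_multiplier (by linarith)]; exact hr
  have hμ' : 1 < ‖multiplier r' θ'‖ := by rw [norm_multiplier (by linarith)]; exact hr'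
  have hinv : ∀ᶠ x : ℂ in 𝓝 0, (H ((H' (x, 0)).1, 0)).1 = x := by
    filter_upwards [Metric.ball_mem_nhds (0 : ℂ) ha'] with x hx
    rw [mem_ball_zero_iff] at hx
    have e : ((H' (x, 0)).1, (0 : ℝ)) = H' (x, 0) :=
      Prod.ext rfl (hH'.map_disk hμ' hl0' hl1' hl0 hl1 hx.le).symm
    rw [e, hHH' _ (mem_cylinder.2 ⟨hx.le, by simpa using ha'.le⟩)]
  have hinv' : ∀ᶠ x : ℂ in 𝓝 0, (H' ((H (x, 0)).1, 0)).1 = x := by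
    filter_upwards [Metric.ball_mem_nhds (0 : ℂ) ha] with x hx
    rw [mem_ball_zero_iff] at hx
    have e : ((H (x, 0)).1, (0 : ℝ)) = H (x, 0) :=
      Prod.ext rfl (hH.map_disk hμ hl0 hl1 hl0' hl1' hx.le).symm
    rw [e, hH'H _ (mem_cylinder.2 ⟨hx.le, by simpa using ha.le⟩)]
  refine radial_of_half_planes (denseRange_circle_exp_zpow hθ) hα hα' (g' := fun z => (H' (z, 0)).1)
    ha ha' ?_ ?_ hH.continuousOn_disk hH'.continuousOn_disk ?_ ?_ hinv hinv'
  · intro u u' huu' z hz hpos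
    have := hE.half_plane hH hr hr' hl0 hl1 hE' hτ hHτ hEE' huu' hz (by
      rw [hEα, ← mul_assoc]; linarith)
    rw [hEα', ← mul_assoc] at this
    linarith
  · intro u u' huu' z hz hpos
    have := hE'.half_plane hH' hr' hr hl0' hl1' hE hτ' hHτ' hE'E huu' hz (by
      rw [hEα', ← mul_assoc]; linarith)
    rw [hEα, ← mul_assoc] at this
    linarith
  · change (H 0).1 = 0
    rw [hH.map_zero]; rfl
  · change (H' 0).1 = 0
    rw [hH'.map_zero]; rfl

theorem exists_circle_inv_mul_re_pos {w : ℂ} (hw : w ≠ 0) :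
    ∃ u : Circle, 0 < (((u⁻¹ : Circle) : ℂ) * w).re := by
  have hn : 0 < ‖w‖ := norm_pos_iff.2 hw
  refine ⟨Circle.exp (Complex.arg w), ?_⟩
  have h1 : w = ‖w‖ * (Circle.exp (Complex.arg w) : ℂ) := by
    rw [Circle.coe_exp]; exact (Complex.norm_mul_exp_arg_mul_I w).symm
  generalize Circle.exp (Complex.arg w) = u at h1
  generalize ‖w‖ = n at h1 hn
  rw [h1, mul_left_comm, ← Circle.coe_mul, inv_mul_cancel]
  simpa using hn

theorem eventually_horizontalDeriv_le (hr : 0 < r)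
    (hEα : ∀ x, horizontalDeriv E (0, τ₀) x = -(α * x).re) {l : Filter ℕ} {u : Circle} {z : ℂ}
    (hu : Tendsto (fun n : ℕ => (Circle.exp θ) ^ n) l (𝓝 u))
    (hpos : 0 < (α * (u⁻¹ : Circle) * z).re) :
    ∃ κ > 0, ∀ᶠ n in l, horizontalDeriv E (0, τ₀) ((multiplier r θ)⁻¹ ^ n * z) ≤
      -κ * ‖(multiplier r θ)⁻¹ ^ n‖ := by
  set η := horizontalDeriv E (0, τ₀) with hη
  have h1 : Tendsto (fun n : ℕ => η ((((Circle.exp θ) ^ n)⁻¹ : Circle) * z)) l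
      (𝓝 (η ((u⁻¹ : Circle) * z))) :=
    (η.continuous.tendsto _).comp (tendsto_circle_inv_mul hu tendsto_const_nhds)
  refine ⟨(α * (u⁻¹ : Circle) * z).re / 2, by positivity, ?_⟩
  filter_upwards [h1.eventually_lt_const (show _ < -((α * (u⁻¹ : Circle) * z).re / 2) by
    rw [hEα, ← mul_assoc]; linarith)] with n hn
  rw [multiplier_pow_mul_inv_pow, map_smul, smul_eq_mul, norm_pow, norm_inv, norm_multiplier hr,
    inv_pow, mul_comm (-_)]
  exact mul_le_mul_of_nonneg_left hn.le (by positivity)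

variable {back back' : ℂ × ℝ → ℂ × ℝ} {c₀ c₀' : ℝ}

/-- Existence, arbitrarily close to the folds, of a return of the unstable surface to the stable
curve which is transverse for both maps. -/
theorem exists_transverse_return
    (hH : IsLocalConj (multiplier r θ) (multiplier r' θ') lam lam' a₀ a' H)
    (hr : 1 < r) (hr' : 1 < r') (hl0 : 0 < lam) (hl1 : lam < 1) (hl0' : 0 < lam') (hl1' : lam' < 1)
    (hE : IsFold E τ₀) (hE' : IsFold E' τ₀')
    (hb : ContDiffAt ℝ 2 back (0, τ₀)) (hb' : ContDiffAt ℝ 2 back' (0, τ₀'))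
    (hEb : ∀ w, E w = c₀ * (back w).2) (hEb' : ∀ w, E' w = c₀' * (back' w).2)
    (hc₀ : 0 < c₀ * τ₀) (hc₀' : 0 < c₀' * τ₀')
    (hEα : ∀ x, horizontalDeriv E (0, τ₀) x = -(α * x).re)
    (hEα' : ∀ x, horizontalDeriv E' (0, τ₀') x = -(α' * x).re)
    (hτ : |τ₀| < a₀) (hHτ : H (0, τ₀) = (0, τ₀'))
    (hHb : ∀ᶠ w in 𝓝 ((0 : ℂ), τ₀), H (back w) = back' (H w))
    {z₀ : ℂ} (hbz : back (0, τ₀) = (z₀, 0)) (hz : ‖z₀‖ < a₀) {u u' : Circle}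
    (huu' : (u, u') ∈ rotationClosure (Circle.exp θ) (Circle.exp θ'))
    (hpos : 0 < (α * (u⁻¹ : Circle) * z₀).re)
    (hpos' : 0 < (α' * (u'⁻¹ : Circle) * (H (z₀, 0)).1).re) {U : Set (ℂ × ℝ)}
    (hU : U ∈ 𝓝 ((0 : ℂ), τ₀)) :
    ∃ (n : ℕ) (τ τ' : ℝ) (w : ℂ × ℝ), (0, τ) ∈ U ∧ w ∈ U ∧
      diagMap ((multiplier r θ)⁻¹ ^ n) (lam⁻¹ ^ n) (back (0, τ)) = w ∧
      (back w).2 = 0 ∧ H (0, τ) = (0, τ') ∧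
      diagMap ((multiplier r' θ')⁻¹ ^ n) (lam'⁻¹ ^ n) (back' (0, τ')) = H w ∧ (back' (H w)).2 = 0 ∧
      deriv (fun τ => (back (diagMap ((multiplier r θ)⁻¹ ^ n) (lam⁻¹ ^ n) (back (0, τ)))).2) τ ≠ 0 ∧
      deriv (fun τ => (back' (diagMap ((multiplier r' θ')⁻¹ ^ n) (lam'⁻¹ ^ n)
        (back' (0, τ)))).2) τ' ≠ 0 := by
  have hr0 : 0 < r := by linarith
  have hr0' : 0 < r' := by linarith
  have ha : 0 < a₀ := (abs_nonneg _).trans_lt hτ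
  have hμ : 1 < ‖multiplier r θ‖ := by rw [norm_multiplier hr0]; exact hr
  have hμ' : 1 < ‖multiplier r' θ'‖ := by rw [norm_multiplier hr0']; exact hr'
  have hμ0 : multiplier r θ ≠ 0 := by rw [← norm_pos_iff]; linarith
  have hμ0' : multiplier r' θ' ≠ 0 := by rw [← norm_pos_iff]; linarith
  have hc0 : c₀ ≠ 0 := by rintro rfl; simp at hc₀
  have hc0' : c₀' ≠ 0 := by rintro rfl; simp at hc₀'
  have hτ0 : τ₀ ≠ 0 := by rintro rfl; simp at hc₀
  have hτ0' : τ₀' ≠ 0 := by rintro rfl; simp at hc₀'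
  obtain ⟨l, hl, hle, hu, hu'⟩ := mem_rotationClosure_iff.1 huu'
  have hbz' : back' (0, τ₀') = H (z₀, 0) := by
    have := hHb.self_of_nhds
    rw [hHτ, hbz] at this
    exact this.symm
  obtain ⟨κ, hκ, hev⟩ := eventually_horizontalDeriv_le hr0 hEα hu hpos
  obtain ⟨κ', hκ', hev'⟩ := eventually_horizontalDeriv_le hr0' hEα' hu' hpos'
  obtain ⟨δ, hδ, hT⟩ := hE.eventually_deriv_return_ne_zero hb hEb hc0 hτ0 hμ hl0 hl1 hκ
  obtain ⟨δ', hδ', hT'⟩ := hE'.eventually_deriv_return_ne_zero hb' hEb' hc0' hτ0' hμ' hl0' hl1' hκ'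
  have hHc : ContinuousAt H (0, τ₀) :=
    hH.continuousOn.continuousAt (cylinder_mem_nhds (by simpa using ha) hτ)
  have hclose : ∀ᶠ w in 𝓝 ((0 : ℂ), τ₀), |(H w).2 - τ₀'| < δ' := by
    have : ContinuousAt (fun w => |(H w).2 - τ₀'|) (0, τ₀) := by fun_prop
    refine this.tendsto.eventually_lt_const ?_
    rw [hHτ]; simpa using hδ'
  have hbcyl : ∀ᶠ w in 𝓝 ((0 : ℂ), τ₀), back w ∈ cylinder a₀ :=
    hb.continuousAt.eventually (by
      rw [hbz]; exact cylinder_mem_nhds hz (by simpa using ha))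
  have hcyl : ∀ᶠ w in 𝓝 ((0 : ℂ), τ₀), w ∈ cylinder a₀ :=
    cylinder_mem_nhds (by simpa using ha) hτ
  obtain ⟨ε, hε, hball⟩ := Metric.eventually_nhds_iff_ball.1
    (hclose.and (hbcyl.and (hcyl.and (hHb.and (show ∀ᶠ w in 𝓝 ((0 : ℂ), τ₀), w ∈ U from hU)))))
  set δ₀ := min δ ε with hδ₀
  have hδ₀0 : 0 < δ₀ := lt_min hδ hε
  have hR := hE.eventually_exists_return hb hEb hc₀ hμ hl0 hl1 hκ hδ₀0
  -- the returning points are close to the axis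
  have hsmall : ∀ᶠ n : ℕ in atTop, ‖(multiplier r θ)⁻¹ ^ n‖ * a₀ < ε := by
    have := (tendsto_pow_zero_of_le_atTop (ρ := r⁻¹) (by positivity)
      (inv_lt_one_of_one_lt₀ hr) (le_refl atTop)).mul_const a₀
    rw [zero_mul] at this
    refine (this.congr fun n => ?_).eventually_lt_const hε
    rw [norm_pow, norm_inv, norm_multiplier hr0]
  -- The two direction conditions hold along `l`, the remaining ones for all large `n`. Since `l ≤
  -- atTop`, a single `n` serves both maps.
  obtain ⟨n, ⟨hn1, hn1'⟩, hn2, hn3, hn4, hn5⟩ := ((hev.and hev').and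
    ((hT.filter_mono hle).and ((hT'.filter_mono hle).and
      ((hR.filter_mono hle).and (hsmall.filter_mono hle))))).exists
  rw [hbz] at hn2 hn4
  rw [hbz'] at hn3
  obtain ⟨τ, hτ1, hτ2, hτ3⟩ := hn4 hn1
  have hb1 : ((0 : ℂ), τ) ∈ Metric.ball ((0 : ℂ), τ₀) ε := by
    rw [← ball_prod_same]
    exact ⟨by simpa using hε, by
      rw [Metric.mem_ball, Real.dist_eq]; exact hτ1.trans_le (min_le_right _ _)⟩
  obtain ⟨b1, b2, b3, b4, b5⟩ := hball _ hb1
  set w := diagMap ((multiplier r θ)⁻¹ ^ n) (lam⁻¹ ^ n) (back (0, τ)) with hw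
  have hb2 : w ∈ Metric.ball ((0 : ℂ), τ₀) ε := by
    rw [← Prod.mk.eta (p := w), ← ball_prod_same]
    refine ⟨?_, ?_⟩
    · rw [mem_ball_zero_iff, hw, diagMap, norm_mul]
      refine lt_of_le_of_lt ?_ hn5
      gcongr
      exact (mem_cylinder.1 b2).1
    · rw [Metric.mem_ball, Real.dist_eq]; exact hτ2.trans_le (min_le_right _ _)
  obtain ⟨d1, d2, d3, d4, d5⟩ := hball _ hb2
  have hw0 : (back w).2 = 0 := by
    rw [hEb] at hτ3
    exact (mul_eq_zero.1 hτ3).resolve_left hc0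
  have hHτ1 : H (0, τ) = (0, (H (0, τ)).2) :=
    Prod.ext (hH.map_axis hμ hμ' hl0 hl1 (mem_cylinder.1 b3).2) rfl
  have hbw : back (0, τ) = diagMap (multiplier r θ ^ n) (lam ^ n) w := by
    rw [hw, diagMap_inv_pow_cancel hμ0 hl0.ne']
  have hret : diagMap ((multiplier r' θ')⁻¹ ^ n) (lam'⁻¹ ^ n) (back' (0, (H (0, τ)).2)) = H w := by
    rw [← hHτ1, ← b4, hbw, hH.conj_pow hμ hl0 hl1 d3 (by rw [← hbw]; exact b2)]
    have := diagMap_inv_pow_cancel (inv_ne_zero hμ0') (inv_ne_zero hl0'.ne') n (H w)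
    rwa [inv_inv, inv_inv] at this
  have hHw0 : (back' (H w)).2 = 0 := by
    rw [← d4]
    have e : back w = ((back w).1, 0) := Prod.ext rfl hw0
    rw [e]
    apply hH.map_disk hμ hl0 hl1 hl0' hl1'
    exact (mem_cylinder.1 d2).1
  have hder : ∀ {c : ℝ} {E : ℂ × ℝ → ℝ} {b : ℂ × ℝ → ℂ × ℝ} {ν : ℂ} {m τ : ℝ},
      (∀ w, E w = c * (b w).2) → deriv (fun τ => E (diagMap ν m (b (0, τ)))) τ ≠ 0 →
      deriv (fun τ => (b (diagMap ν m (b (0, τ)))).2) τ ≠ 0 := by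
    intro c E b ν m τ hEb hne h0
    apply hne
    simp only [hEb]
    rw [deriv_const_mul_field, h0, mul_zero]
  refine ⟨n, τ, (H (0, τ)).2, w, b5, d5, rfl, hw0, hHτ1, hret, hHw0, ?_, ?_⟩
  · exact hder hEb (hn2 hn1 τ (hτ1.trans_le (min_le_left _ _)) (hτ2.trans_le (min_le_left _ _)) hτ3)
  -- `H` is only continuous and need not preserve transversality. The derivative estimate is
  -- therefore applied afresh to the second map, at the image of the return point.
  · refine hder hEb' (hn3 hn1' _ b1 ?_ ?_)
    · have e : lam'⁻¹ ^ n * (back' (0, (H (0, τ)).2)).2 = (H w).2 := by rw [← hret]; rfl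
      rw [e]
      exact d1
    · rw [hret, hEb', hHw0, mul_zero]

end TwoSided

/-! ### Comparison along a transverse intersection -/

section Comparison

variable {r r' θ θ' lam lam' a' a₀ : ℝ} {H : ℂ × ℝ → ℂ × ℝ}

/-- The unstable coordinate of a local conjugacy is compared, along the backward orbit of a
transverse intersection, with its coordinate along a second transverse intersection. -/
theorem IsLocalConj.exists_comparison {μ μ' : ℂ} (hH : IsLocalConj μ μ' lam lam' a₀ a' H)
    (hμ : 1 < ‖μ‖) (hl0 : 0 < lam) (hl1 : lam < 1) (hl0' : 0 < lam') (hl1' : lam' < 1)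
    {G G' : ℂ × ℝ → ℂ × ℝ} {ζ ζ' : ℂ} {τ : ℝ} (hζ : ‖ζ‖ < a₀) (hτ : |τ| < a₀)
    (hG : ContinuousAt G (ζ, 0)) (hGζ : G (ζ, 0) = (0, τ)) (hHζ : H (ζ, 0) = (ζ', 0))
    (hHG : ∀ᶠ w in 𝓝 (ζ, (0 : ℝ)), H (G w) = G' (H w)) {F F' : ℂ → ℂ}
    (hF : ContinuousAt F 0) (hF0 : F 0 = ζ) (hGF : ∀ᶠ x in 𝓝 0, (G (F x, 0)).1 = x)
    (hFG' : ∀ᶠ y in 𝓝 ζ', F' (G' (y, 0)).1 = y) {z : ℂ} (hz : ‖z‖ < a₀) :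
    ∃ w : ℕ → ℂ, (∀ᶠ n in atTop, (H (F (μ⁻¹ ^ n * z), 0)).1 = F' (w n)) ∧
      Tendsto (fun n => μ' ^ n * w n) atTop (𝓝 (H (z, 0)).1) := by
  have hμ0 : μ ≠ 0 := by rw [← norm_pos_iff]; linarith
  have ha : 0 < a₀ := (abs_nonneg _).trans_lt hτ
  have hx : Tendsto (fun n : ℕ => μ⁻¹ ^ n * z) atTop (𝓝 0) := by
    have := (tendsto_pow_atTop_nhds_zero_of_norm_lt_one (x := μ⁻¹)
      (by rw [norm_inv]; exact inv_lt_one_of_one_lt₀ hμ)).mul_const z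
    rwa [zero_mul] at this
  have hy : Tendsto (fun n : ℕ => F (μ⁻¹ ^ n * z)) atTop (𝓝 ζ) := by
    rw [← hF0]; exact hF.tendsto.comp hx
  have hy0 : Tendsto (fun n : ℕ => (F (μ⁻¹ ^ n * z), (0 : ℝ))) atTop (𝓝 (ζ, 0)) :=
    hy.prodMk_nhds tendsto_const_nhds
  have hGy : Tendsto (fun n : ℕ => G (F (μ⁻¹ ^ n * z), 0)) atTop (𝓝 (0, τ)) := by
    rw [← hGζ]; exact hG.tendsto.comp hy0
  have hgc : ContinuousAt (fun y : ℂ => (H (y, 0)).1) ζ :=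
    hH.continuousOn_disk.continuousAt (Metric.isOpen_ball.mem_nhds (by simpa using hζ))
  have hgy : Tendsto (fun n : ℕ => (H (F (μ⁻¹ ^ n * z), 0)).1) atTop (𝓝 ζ') := by
    have := hgc.tendsto.comp hy
    rwa [hHζ] at this
  -- The point `G (F (μ⁻ⁿ z), 0)` lies over `μ⁻ⁿ z`, at bounded height, so `n` iterates carry it
  -- near `(z, 0)`. The conjugacy relation then gives the limit of `μ'ⁿ * w n`, while `F'` recovers
  -- the disk point from its horizontal coordinate.
  refine ⟨fun n => (H (G (F (μ⁻¹ ^ n * z), 0))).1, ?_, ?_⟩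
  · filter_upwards [hy0.eventually hHG, hgy.eventually hFG',
      hy.eventually (Metric.isOpen_ball.mem_nhds (show ζ ∈ Metric.ball 0 a₀ by simpa using hζ))]
      with n h1 h2 h3
    have h3' : ‖F (μ⁻¹ ^ n * z)‖ < a₀ := by simpa using h3
    have e : H (F (μ⁻¹ ^ n * z), 0) = ((H (F (μ⁻¹ ^ n * z), 0)).1, 0) :=
      Prod.ext rfl (hH.map_disk hμ hl0 hl1 hl0' hl1' h3'.le)
    rw [h1]
    rw [e]
    exact h2.symm
  · have ht : Tendsto (fun n : ℕ => (z, lam ^ n * (G (F (μ⁻¹ ^ n * z), 0)).2)) atTop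
        (𝓝 (z, 0)) := by
      refine tendsto_const_nhds.prodMk_nhds ?_
      have h1 := (tendsto_pow_atTop_nhds_zero_of_lt_one hl0.le hl1).mul
        ((continuous_snd.tendsto _).comp hGy)
      simpa using h1
    have hcyl : cylinder a₀ ∈ 𝓝 (z, (0 : ℝ)) := cylinder_mem_nhds hz (by simpa using ha)
    have hlim := (continuous_fst.tendsto _).comp ((hH.continuousOn.continuousAt hcyl).tendsto.comp ht)
    refine hlim.congr' ?_
    filter_upwards [ht.eventually hcyl, hx.eventually hGF,
      hGy.eventually (cylinder_mem_nhds (by simpa using ha) hτ)] with n h1 h2 h3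
    have e : diagMap (μ ^ n) (lam ^ n) (G (F (μ⁻¹ ^ n * z), 0)) =
        (z, lam ^ n * (G (F (μ⁻¹ ^ n * z), 0)).2) := by
      rw [diagMap, h2, ← mul_assoc, ← mul_pow, mul_inv_cancel₀ hμ0, one_pow, one_mul]
    have h4 := hH.conj_pow hμ hl0 hl1 h3 (by rw [e]; exact h1)
    rw [e] at h4
    simp only [Function.comp_apply]
    rw [h4, diagMap]

end Comparison

/-! ### Linearity or antilinearity on the unstable disk -/

section Linear

variable {M : Type*} [TopologicalSpace M]

theorem localExpr_chartIterate {φ φ' : OpenPartialHomeomorph M (ℂ × ℝ)} {h g g' : M → M}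
    (hgg : ∀ x, h (g x) = g' (h x)) {m : ℕ} {w : ℂ × ℝ} (h1 : g^[m] (φ.symm w) ∈ φ.source)
    (h2 : h (φ.symm w) ∈ φ'.source) :
    localExpr φ φ' h (chartIterate φ g m w) = chartIterate φ' g' m (localExpr φ φ' h w) := by
  have hs : Function.Semiconj h g g' := hgg
  rw [localExpr, chartIterate, chartIterate, localExpr, φ.left_inv h1, φ'.left_inv h2,
    (hs.iterate_right m).eq]

variable [ChartedSpace E3 M] {k : ℕ∞} {f f' : M ≃ M} {p p' : M}
  {r r' θ θ' lam lam' a a' a₀ : ℝ} {φ φ' : OpenPartialHomeomorph M (ℂ × ℝ)} {h : M → M}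

/-- At a homoclinic point which is transverse for both maps, a radial conjugacy is linear or
antilinear on the unstable disk. -/
theorem linear_of_radial_of_isTransition (hk : 3 ≤ k)
    (hφ : IsLinearizingChart k f p r θ lam a φ) (hφ' : IsLinearizingChart k f' p' r' θ' lam' a' φ')
    (hf : ContMDiff 𝓘(ℝ, E3) 𝓘(ℝ, E3) k f) (hfi : ContMDiff 𝓘(ℝ, E3) 𝓘(ℝ, E3) k f.symm)
    (hf' : ContMDiff 𝓘(ℝ, E3) 𝓘(ℝ, E3) k f') (hfi' : ContMDiff 𝓘(ℝ, E3) 𝓘(ℝ, E3) k f'.symm)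
    (hθ : Irrational (θ / (2 * Real.pi)))
    (hH : IsLocalConj (multiplier r θ) (multiplier r' θ') lam lam' a₀ a' (localExpr φ φ' h))
    (hsrc : ∀ w ∈ cylinder a₀, h (φ.symm w) ∈ φ'.source) (hconj : ∀ x, h (f x) = f' (h x))
    {α α' : ℂ} (hα : α ≠ 0) (hα' : α' ≠ 0)
    (hrad : (∀ u u', (u, u') ∈ rotationClosure (Circle.exp θ) (Circle.exp θ') → u' = u) ∧
        (∀ z, ‖z‖ < a₀ → ∃ s : ℝ, 0 ≤ s ∧ α' * (localExpr φ φ' h (z, 0)).1 = s * (α * z)) ∨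
      (∀ u u', (u, u') ∈ rotationClosure (Circle.exp θ) (Circle.exp θ') → u' = u⁻¹) ∧
        (∀ z, ‖z‖ < a₀ → ∃ s : ℝ, 0 ≤ s ∧
          starRingEnd ℂ (α' * (localExpr φ φ' h (z, 0)).1) = s * (α * z)))
    {m : ℕ} {τ τ' : ℝ} {ζ ζ' : ℂ} (hζ : ‖ζ‖ < a₀) (hζ0 : ζ ≠ 0) (hτ : |τ| < a₀)
    (htr : IsTransition f φ m (0, τ) (ζ, 0)) (htr' : IsTransition f' φ' m (0, τ') (ζ', 0))
    (hHζ : localExpr φ φ' h (ζ, 0) = (ζ', 0))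
    (hd : deriv (fun τ => (chartIterate φ f.symm m (0, τ)).2) τ ≠ 0)
    (hd' : deriv (fun τ => (chartIterate φ' f'.symm m (0, τ)).2) τ' ≠ 0) :
    ∃ C : ℂ, C ≠ 0 ∧ ((∀ z, ‖z‖ < a₀ → (localExpr φ φ' h (z, 0)).1 = C * z) ∨
      (∀ z, ‖z‖ < a₀ → (localExpr φ φ' h (z, 0)).1 = C * starRingEnd ℂ z)) := by
  have ha : 0 < a₀ := (abs_nonneg _).trans_lt hτ
  obtain ⟨F, Λ, hF, hF0, hΛ, hGF, -⟩ := htr.exists_local_inverse hk hφ hf hfi hd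
  obtain ⟨F', Λ', hF', hF0', hΛ', -, hFG'⟩ := htr'.exists_local_inverse hk hφ' hf' hfi' hd'
  set H := localExpr φ φ' h with hHdef
  have hHG : ∀ᶠ w in 𝓝 (ζ, (0 : ℝ)), H (chartIterate φ f m w) = chartIterate φ' f' m (H w) := by
    filter_upwards [htr.eventually_forward_mem hf.continuous,
      cylinder_mem_nhds (w := (ζ, (0 : ℝ))) hζ (by simpa using ha)] with w h1 h2
    exact localExpr_chartIterate hconj h1.2 (hsrc w h2)
  have hcomp := fun (z : ℂ) (hz : ‖z‖ < a₀) => hH.exists_comparison hφ.one_lt_norm_mult hφ.lam_pos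
    hφ.lam_lt_one hφ'.lam_pos hφ'.lam_lt_one hζ hτ
    (htr.contDiffAt_forward hφ hf).continuousAt htr.forward_eq hHζ hHG hF.continuousAt hF0 hGF hFG' hz
  have hg0 : ∀ z, z ≠ 0 → ‖z‖ < a₀ → (H (z, 0)).1 ≠ 0 := by
    intro z hz0 hz h0
    have e : H (z, 0) = H 0 := by
      rw [hH.map_zero]
      exact Prod.ext h0 (hH.map_disk hφ.one_lt_norm_mult hφ.lam_pos hφ.lam_lt_one hφ'.lam_pos
        hφ'.lam_lt_one hz.le)
    have := hH.injOn (mem_cylinder.2 ⟨hz.le, by simpa using ha.le⟩)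
      (mem_cylinder.2 (by simpa using ha.le)) e
    exact hz0 (congrArg Prod.fst this)
  have hdense := denseRange_circle_exp_zpow hθ
  have hr := hφ.one_lt_r
  have hr' := hφ'.one_lt_r
  have hmul : multiplier r θ = (r : ℂ) * (Circle.exp θ : ℂ) := rfl
  rcases hrad with ⟨hu, hrad⟩ | ⟨hu, hrad⟩
  · have he := hu _ _ (mk_mem_rotationClosure _ _)
    obtain ⟨-, m₀, hm₀, hlin⟩ := linear_of_radial_of_comparison hdense hr hr'
      (c := α / α') (div_ne_zero hα hα') (g := fun z => (H (z, 0)).1) (R := a₀) (fun z hz => by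
        obtain ⟨s, hs, hsz⟩ := hrad z hz
        refine ⟨s, hs, ?_⟩
        field_simp
        linear_combination hsz) hg0 hζ hζ0 hF hF' hF0 (by rw [hF0', hHζ]) hΛ hΛ' (fun z hz => by
        have := hcomp z hz
        rwa [multiplier, multiplier, he] at this)
    refine ⟨m₀ * (α / α'), by
      have := hm₀.ne'
      have : (m₀ : ℂ) ≠ 0 := by exact_mod_cast this
      exact mul_ne_zero this (div_ne_zero hα hα'), Or.inl fun z hz => ?_⟩
    rw [hlin z hz, mul_assoc]
  -- In the reversing case the comparison theorem is applied to `conj ∘ g`, with `F'` conjugated on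
  -- both sides. Since the second rotation is the inverse of the first, complex conjugation turns
  -- its multiplier into one with rotation part `Circle.exp θ`.
  · have he := hu _ _ (mk_mem_rotationClosure _ _)
    have hconj' : ∀ n : ℕ, starRingEnd ℂ (multiplier r' θ' ^ n) =
        ((r' : ℂ) * (Circle.exp θ : ℂ)) ^ n := by
      intro n
      rw [map_pow, multiplier, he, map_mul, Complex.conj_ofReal, Circle.coe_inv_eq_conj,
        Complex.conj_conj]
    have hcα : starRingEnd ℂ α' ≠ 0 := by simpa using hα'
    obtain ⟨-, m₀, hm₀, hlin⟩ := linear_of_radial_of_comparison hdense hr hr'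
      (c := α / starRingEnd ℂ α') (div_ne_zero hα hcα)
      (g := fun z => starRingEnd ℂ (H (z, 0)).1) (R := a₀)
      (F' := fun z => starRingEnd ℂ (F' (starRingEnd ℂ z)))
      (Λ' := (Complex.conjCLE : ℂ →L[ℝ] ℂ).comp (Λ'.comp (Complex.conjCLE : ℂ →L[ℝ] ℂ)))
      (fun z hz => by
        obtain ⟨s, hs, hsz⟩ := hrad z hz
        refine ⟨s, hs, ?_⟩
        rw [map_mul] at hsz
        field_simp
        linear_combination hsz) (fun z hz0 hz => by simpa using hg0 z hz0 hz) hζ hζ0 hF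
      (by
        have h1 : HasFDerivAt (fun z : ℂ => starRingEnd ℂ z) (Complex.conjCLE : ℂ →L[ℝ] ℂ) 0 :=
          Complex.conjCLE.hasFDerivAt
        have h2 : HasFDerivAt F' Λ' (starRingEnd ℂ 0) := by rwa [map_zero]
        have h3 := h2.comp (0 : ℂ) h1
        exact (Complex.conjCLE : ℂ →L[ℝ] ℂ).hasFDerivAt.comp (0 : ℂ) h3)
      hF0 (by rw [map_zero, hF0', hHζ]) hΛ
      (by
        have hc : Function.Surjective fun z : ℂ => starRingEnd ℂ z :=
          fun z => ⟨starRingEnd ℂ z, Complex.conj_conj z⟩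
        exact hc.comp (hΛ'.comp hc))
      (fun z hz => by
        obtain ⟨w, hw1, hw2⟩ := hcomp z hz
        refine ⟨fun n => starRingEnd ℂ (w n), ?_, ?_⟩
        · filter_upwards [hw1] with n hn
          rw [Complex.conj_conj, ← hn, multiplier]
        · have := (Complex.continuous_conj.tendsto _).comp hw2
          refine this.congr fun n => ?_
          rw [Function.comp_apply, map_mul, hconj'])
    refine ⟨starRingEnd ℂ (m₀ * (α / starRingEnd ℂ α')), ?_, Or.inr fun z hz => ?_⟩
    · have : (m₀ : ℂ) ≠ 0 := by exact_mod_cast hm₀.ne'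
      simpa using ⟨hm₀.ne', hα, hα'⟩
    · have := congrArg (starRingEnd ℂ) (hlin z hz)
      rw [Complex.conj_conj] at this
      rw [this, ← map_mul, mul_assoc]

end Linear

/-! ### Producing transverse homoclinic points -/

section TransverseHomoclinic

variable {M : Type*} [TopologicalSpace M] [ChartedSpace E3 M] {k : ℕ∞} {f : M ≃ M}
  {p q : M} {r θ lam a : ℝ} {φ : OpenPartialHomeomorph M (ℂ × ℝ)} {m : ℕ}

theorem IsLinearizingChart.tendsto_iterate_of_mem_stableSegment [T2Space M]
    (hφ : IsLinearizingChart k f p r θ lam a φ) (hf : Continuous f) {x : M}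
    (hx : x ∈ stableSegment φ a) : Tendsto (fun n : ℕ => f^[n] x) atTop (𝓝 p) := by
  have h0 : (0 : ℂ × ℝ) ∈ φ.target :=
    hφ.cylinder_subset_target (mem_cylinder.2 (by simpa using hφ.a_pos.le))
  have ht : Tendsto (fun n : ℕ => ((0 : ℂ), lam ^ n * (φ x).2)) atTop (𝓝 0) := by
    refine tendsto_const_nhds.prodMk_nhds ?_
    simpa using (tendsto_pow_atTop_nhds_zero_of_lt_one hφ.lam_pos.le hφ.lam_lt_one).mul_const (φ x).2
  have h1 := (φ.continuousAt_symm h0).tendsto.comp ht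
  rw [hφ.symm_zero] at h1
  refine h1.congr fun n => ?_
  obtain ⟨hs, he⟩ := hφ.map_segment hf hx n
  rw [Function.comp_apply, ← he, φ.left_inv hs.1]

theorem IsLinearizingChart.tendsto_iterate_symm_of_mem_unstableDisk [T2Space M]
    (hφ : IsLinearizingChart k f p r θ lam a φ) (hf : Continuous f) {x : M}
    (hx : x ∈ unstableDisk φ a) : Tendsto (fun n : ℕ => f.symm^[n] x) atTop (𝓝 p) := by
  have h0 : (0 : ℂ × ℝ) ∈ φ.target :=
    hφ.cylinder_subset_target (mem_cylinder.2 (by simpa using hφ.a_pos.le))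
  have ht : Tendsto (fun n : ℕ => ((multiplier r θ)⁻¹ ^ n * (φ x).1, (0 : ℝ))) atTop (𝓝 0) := by
    refine Tendsto.prodMk_nhds ?_ tendsto_const_nhds
    simpa using (tendsto_pow_atTop_nhds_zero_of_norm_lt_one (x := (multiplier r θ)⁻¹)
      (by rw [norm_inv]; exact inv_lt_one_of_one_lt₀ hφ.one_lt_norm_mult)).mul_const (φ x).1
  have h1 := (φ.continuousAt_symm h0).tendsto.comp ht
  rw [hφ.symm_zero] at h1
  refine h1.congr fun n => ?_
  obtain ⟨hs, he⟩ := hφ.map_disk_inv hf hx n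
  rw [Function.comp_apply, ← he, φ.left_inv hs.1]

theorem IsLinearizingChart.fst_ne_zero_of_mem_unstableDisk
    (hφ : IsLinearizingChart k f p r θ lam a φ) {x : M} (hx : x ∈ unstableDisk φ a) (hxp : x ≠ p) :
    (φ x).1 ≠ 0 := by
  intro h0
  apply hxp
  rw [← hφ.symm_zero, ← φ.left_inv hx.1]
  congr 1
  exact Prod.ext h0 hx.2.2

theorem IsTransition.isTransverseHomoclinic [T2Space M] {τ : ℝ} {ζ : ℂ}
    (htr : IsTransition f φ m (0, τ) (ζ, 0)) (hφ : IsLinearizingChart k f p r θ lam a φ)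
    (hf : Continuous f) (hτ : |τ| ≤ a) (hζ : ‖ζ‖ ≤ a) (hζ0 : ζ ≠ 0)
    (hd : deriv (fun τ => (chartIterate φ f.symm m (0, τ)).2) τ ≠ 0) :
    IsTransverseHomoclinic f p φ a (φ.symm (ζ, 0)) ∧ φ.symm (ζ, 0) ∈ unstableDisk φ a := by
  have hφs : φ (φ.symm (ζ, 0)) = (ζ, 0) := φ.right_inv htr.mem₁
  have hφm : φ (φ.symm (0, τ)) = (0, τ) := φ.right_inv htr.mem₀
  have hD : φ.symm (ζ, 0) ∈ unstableDisk φ a :=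
    ⟨φ.map_target htr.mem₁, by rw [hφs]; exact hζ, by rw [hφs]⟩
  have hS : f^[m] (φ.symm (ζ, 0)) ∈ stableSegment φ a := by
    rw [htr.map']
    exact ⟨φ.map_target htr.mem₀, by rw [hφm], by rw [hφm]; exact hτ⟩
  refine ⟨⟨⟨?_, ?_, hφ.tendsto_iterate_symm_of_mem_unstableDisk hf hD⟩, m, 0, hS, hD, ?_⟩, hD⟩
  · intro h
    rw [h, hφ.map_base] at hφs
    exact hζ0 (congrArg Prod.fst hφs).symm
  · rw [← tendsto_add_atTop_iff_nat m]
    simp only [Function.iterate_add_apply]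
    exact hφ.tendsto_iterate_of_mem_stableSegment hf hS
  · have e : contactFunction f φ m 0 = fun τ => (chartIterate φ f.symm m (0, τ)).2 := by
      funext τ
      rw [contactFunction_eq, zero_add]
    rw [e, htr.map', hφm]
    exact hd

theorem IsTransition.eventually_backward_bounds {w₀ w₁ : ℂ × ℝ} {b : ℝ}
    (h : IsTransition f φ m w₀ w₁) (hφ : IsLinearizingChart k f p r θ lam a φ)
    (hf : ContMDiff 𝓘(ℝ, E3) 𝓘(ℝ, E3) k f.symm) (h1 : ‖w₀.1‖ < b) (h2 : |w₀.2| < b)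
    (h3 : ‖w₁.1‖ < b) (h4 : |w₁.2| < b) :
    ∀ᶠ w in 𝓝 w₀, (w ∈ φ.target ∧ f.symm^[m] (φ.symm w) ∈ φ.source) ∧ (‖w.1‖ < b ∧ |w.2| < b) ∧
      ‖(chartIterate φ f.symm m w).1‖ < b ∧ |(chartIterate φ f.symm m w).2| < b := by
  have hc : ContinuousAt (chartIterate φ f.symm m) w₀ := (h.contDiffAt_backward hφ hf).continuousAt
  have open_cyl : ∀ {v : ℂ × ℝ}, ‖v.1‖ < b → |v.2| < b → ∀ᶠ w in 𝓝 v, ‖w.1‖ < b ∧ |w.2| < b := by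
    intro v h1 h2
    have c1 : Continuous fun w : ℂ × ℝ => ‖w.1‖ := by fun_prop
    have c2 : Continuous fun w : ℂ × ℝ => |w.2| := by fun_prop
    exact ((c1.tendsto v).eventually_lt_const h1).and ((c2.tendsto v).eventually_lt_const h2)
  exact (h.eventually_backward_mem hf.continuous).and ((open_cyl h1 h2).and
    (hc.eventually (by rw [h.backward_eq]; exact open_cyl h3 h4)))

/-- A return through the linearized region gives a transition of larger order. -/
theorem IsLinearizingChart.isTransition_return [T2Space M] (hφ : IsLinearizingChart k f p r θ lam a φ)
    (hf : Continuous f) (hf' : Continuous f.symm) {n : ℕ} {τ : ℝ} {w : ℂ × ℝ} {ζ : ℂ}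
    (hτ : ((0 : ℂ), τ) ∈ φ.target) (hτ' : f.symm^[m] (φ.symm (0, τ)) ∈ φ.source)
    (h1 : ‖(chartIterate φ f.symm m (0, τ)).1‖ < a) (h2 : |(chartIterate φ f.symm m (0, τ)).2| < a)
    (hw : diagMap ((multiplier r θ)⁻¹ ^ n) (lam⁻¹ ^ n) (chartIterate φ f.symm m (0, τ)) = w)
    (h3 : ‖w.1‖ < a) (h4 : |w.2| < a) (hw' : f.symm^[m] (φ.symm w) ∈ φ.source)
    (hwζ : chartIterate φ f.symm m w = (ζ, 0))
    (hd : deriv (fun τ => (chartIterate φ f.symm m (diagMap ((multiplier r θ)⁻¹ ^ n) (lam⁻¹ ^ n)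
      (chartIterate φ f.symm m (0, τ)))).2) τ ≠ 0) :
    IsTransition f φ (m + n + m) (0, τ) (ζ, 0) ∧
      deriv (fun τ => (chartIterate φ f.symm (m + n + m) (0, τ)).2) τ ≠ 0 := by
  have hret := IsTransition.chartIterate_return hφ hf hf' (n := n) hτ hτ' h1 h2 (by rw [hw]; exact h3)
    (by rw [hw]; exact h4)
  have hζ : φ.symm (ζ, 0) = f.symm^[m] (φ.symm w) := by
    rw [← hwζ, chartIterate, φ.left_inv hw']
  refine ⟨⟨hτ, ?_, ?_⟩, ?_⟩
  · rw [← hwζ]; exact φ.map_source hw'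
  · rw [hret.self_of_nhds, hw, hζ]
  · have ht : Tendsto (fun τ : ℝ => ((0 : ℂ), τ)) (𝓝 τ) (𝓝 (0, τ)) := by
      have : Continuous fun τ : ℝ => ((0 : ℂ), τ) := by fun_prop
      exact this.tendsto _
    rw [Filter.EventuallyEq.deriv_eq (f := fun τ => (chartIterate φ f.symm m
      (diagMap ((multiplier r θ)⁻¹ ^ n) (lam⁻¹ ^ n) (chartIterate φ f.symm m (0, τ)))).2)]
    · exact hd
    · filter_upwards [ht.eventually hret] with t h
      rw [chartIterate, h]
      rfl

theorem exists_isHomoclinicAt_lt [T2Space M] (hk : 3 ≤ k)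
    (hφ : IsLinearizingChart k f p r θ lam a φ) (hf : Continuous f)
    (hf' : ContMDiff 𝓘(ℝ, E3) 𝓘(ℝ, E3) k f.symm)
    (hq : IsQuadraticTangency f p φ a q) (hpos : IsPositivelyAssociated f φ a q) {ε : ℝ}
    (hε : 0 < ε) :
    ∃ N₀, ∀ N ≥ N₀, IsHomoclinicAt f φ a q N N ∧ IsPositiveQuadratic f φ q N N ∧
      |(φ (f^[N] q)).2| < ε ∧ ‖(φ (f.symm^[N] q)).1‖ < ε := by
  obtain ⟨N₀, hN₀⟩ := exists_isHomoclinicAt_isPositiveQuadratic hk hφ hf hf' hq hpos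
  have hc : ContinuousAt φ p := φ.continuousAt hφ.mem_source
  have h1 : Tendsto (fun n : ℕ => |(φ (f^[n] q)).2|) atTop (𝓝 0) := by
    have c : Continuous fun w : ℂ × ℝ => |w.2| := by fun_prop
    have := (c.tendsto _).comp (hc.tendsto.comp hq.1.2.1)
    rw [hφ.map_base] at this
    simpa [Function.comp_def] using this
  have h2 : Tendsto (fun n : ℕ => ‖(φ (f.symm^[n] q)).1‖) atTop (𝓝 0) := by
    have c : Continuous fun w : ℂ × ℝ => ‖w.1‖ := by fun_prop
    have := (c.tendsto _).comp (hc.tendsto.comp hq.1.2.2)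
    rw [hφ.map_base] at this
    simpa [Function.comp_def] using this
  obtain ⟨N₁, hN₁⟩ := eventually_atTop.1
    ((h1.eventually_lt_const hε).and (h2.eventually_lt_const hε))
  refine ⟨max N₀ N₁, fun N hN => ?_⟩
  obtain ⟨e1, e2⟩ := hN₀ N (le_of_max_le_left hN) N (le_of_max_le_left hN)
  exact ⟨e1, e2, hN₁ N (le_of_max_le_right hN)⟩

end TransverseHomoclinic

/-! ### Assembling the two maps -/

section Conjugacy

variable {M : Type*} [TopologicalSpace M] {k : ℕ∞} {f f' : M ≃ M}
  {p p' q q' : M} {r r' θ θ' lam lam' a a' a₀ a₀' : ℝ} {φ φ' : OpenPartialHomeomorph M (ℂ × ℝ)}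

theorem localExpr_localExpr {h : M ≃ M} {w : ℂ × ℝ} (hw : w ∈ φ'.target)
    (h1 : h.symm (φ'.symm w) ∈ φ.source) :
    localExpr φ φ' h (localExpr φ' φ h.symm w) = w := by
  rw [localExpr, localExpr, φ.left_inv h1, h.apply_symm_apply, φ'.right_inv hw]

/-- A local conjugacy intertwines the transition maps near a homoclinic point and, as a
consequence, takes the unstable surface to the unstable surface. -/
theorem IsLocalConj.eventually_conj_transition [ChartedSpace E3 M]
    (hφ : IsLinearizingChart k f p r θ lam a φ) (hφ' : IsLinearizingChart k f' p' r' θ' lam' a' φ')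
    (hfi : ContMDiff 𝓘(ℝ, E3) 𝓘(ℝ, E3) k f.symm) {h : M ≃ M} (hconj : ∀ x, h (f x) = f' (h x))
    (hH : IsLocalConj (multiplier r θ) (multiplier r' θ') lam lam' a₀ a' (localExpr φ φ' h))
    (hsrc : ∀ w ∈ cylinder a₀, h (φ.symm w) ∈ φ'.source) {m : ℕ} {τ : ℝ} {ζ : ℂ}
    (htr : IsTransition f φ m (0, τ) (ζ, 0)) (hτ : |τ| < a₀) (hζ : ‖ζ‖ < a₀) :
    ∀ᶠ w in 𝓝 ((0 : ℂ), τ), localExpr φ φ' h (chartIterate φ f.symm m w) =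
        chartIterate φ' f'.symm m (localExpr φ φ' h w) ∧
      ((chartIterate φ f.symm m w).2 = 0 →
        (chartIterate φ' f'.symm m (localExpr φ φ' h w)).2 = 0) := by
  have ha : 0 < a₀ := (abs_nonneg _).trans_lt hτ
  have hconj' : ∀ x, h (f.symm x) = f'.symm (h x) := fun x => by
    rw [Equiv.eq_symm_apply, ← hconj, f.apply_symm_apply]
  filter_upwards [htr.eventually_backward_bounds hφ hfi (b := a₀) (by simpa using ha) hτ hζ
    (by simpa using ha)] with w ⟨⟨h1, h2⟩, ⟨h3, h4⟩, h5, h6⟩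
  have e := localExpr_chartIterate hconj' h2 (hsrc w (mem_cylinder.2 ⟨h3.le, h4.le⟩))
  refine ⟨e, fun h0 => ?_⟩
  rw [← e, ← Prod.mk.eta (p := chartIterate φ f.symm m w), h0]
  exact hH.map_disk hφ.one_lt_norm_mult hφ.lam_pos hφ.lam_lt_one hφ'.lam_pos hφ'.lam_lt_one h5.le

/-- The conjugacy is linear or antilinear on the unstable disk, and there is a transverse
homoclinic point. -/
theorem exists_linear_and_isTransverseHomoclinic [T2Space M] [ChartedSpace E3 M]
    (hk : 3 ≤ k)
    (hφ : IsLinearizingChart k f p r θ lam a φ) (hφ' : IsLinearizingChart k f' p' r' θ' lam' a' φ')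
    (hf : ContMDiff 𝓘(ℝ, E3) 𝓘(ℝ, E3) k f) (hfi : ContMDiff 𝓘(ℝ, E3) 𝓘(ℝ, E3) k f.symm)
    (hf' : ContMDiff 𝓘(ℝ, E3) 𝓘(ℝ, E3) k f') (hfi' : ContMDiff 𝓘(ℝ, E3) 𝓘(ℝ, E3) k f'.symm)
    (hθ : Irrational (θ / (2 * Real.pi))) {h : M ≃ M} (hconj : ∀ x, h (f x) = f' (h x))
    (hhq : h q = q') (haa : a₀ ≤ a) (haa' : a₀' ≤ a')
    (hH : IsLocalConj (multiplier r θ) (multiplier r' θ') lam lam' a₀ a' (localExpr φ φ' h))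
    (hsrc : ∀ w ∈ cylinder a₀, h (φ.symm w) ∈ φ'.source)
    (hH' : IsLocalConj (multiplier r' θ') (multiplier r θ) lam' lam a₀' a
      (localExpr φ' φ h.symm))
    (hsrc' : ∀ w ∈ cylinder a₀', h.symm (φ'.symm w) ∈ φ.source) (hqp : q ≠ p) {N : ℕ}
    (hq : IsHomoclinicAt f φ a q N N) (hpos : IsPositiveQuadratic f φ q N N)
    (hq' : IsHomoclinicAt f' φ' a' q' N N) (hpos' : IsPositiveQuadratic f' φ' q' N N)
    (hτ : |(φ (f^[N] q)).2| < a₀) (hz : ‖(φ (f.symm^[N] q)).1‖ < a₀)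
    (hτ' : |(φ' (f'^[N] q')).2| < a₀') (hz' : ‖(φ' (f'.symm^[N] q')).1‖ < a₀') :
    (∃ C : ℂ, C ≠ 0 ∧ ((∀ z, ‖z‖ < a₀ → (localExpr φ φ' h (z, 0)).1 = C * z) ∨
      (∀ z, ‖z‖ < a₀ → (localExpr φ φ' h (z, 0)).1 = C * starRingEnd ℂ z))) ∧
    ∃ s, IsTransverseHomoclinic f p φ a s ∧ s ∈ unstableDisk φ a ∧ h s ∈ unstableDisk φ' a' := by
  have ha : 0 < a₀ := (abs_nonneg _).trans_lt hτ
  have hconj' : ∀ x, h.symm (f' x) = f (h.symm x) := fun x => by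
    rw [Equiv.symm_apply_eq, hconj, h.apply_symm_apply]
  have hconji : ∀ x, h (f.symm x) = f'.symm (h x) := fun x => by
    rw [Equiv.eq_symm_apply, ← hconj, f.apply_symm_apply]
  have hHτ : localExpr φ φ' h (0, (φ (f^[N] q)).2) = (0, (φ' (f'^[N] q')).2) := by
    have hs : Function.Semiconj h f f' := hconj
    rw [← hq.eta_stable, ← hq'.eta_stable, localExpr, φ.left_inv hq.1.1, (hs.iterate_right N).eq,
      hhq]
  have hHz : localExpr φ φ' h ((φ (f.symm^[N] q)).1, 0) = ((φ' (f'.symm^[N] q')).1, 0) := by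
    have hs : Function.Semiconj h f.symm f'.symm := hconji
    rw [← hq.eta_unstable, ← hq'.eta_unstable, localExpr, φ.left_inv hq.2.1,
      (hs.iterate_right N).eq, hhq]
  have hz0 : (φ (f.symm^[N] q)).1 ≠ 0 := by
    refine hφ.fst_ne_zero_of_mem_unstableDisk hq.2 fun h0 => hqp ?_
    have := (Function.LeftInverse.iterate f.apply_symm_apply N) q
    rw [h0, Function.iterate_fixed hφ.fixed] at this
    exact this.symm
  have hHH' : ∀ w ∈ cylinder a₀', localExpr φ φ' h (localExpr φ' φ h.symm w) = w := fun w hw =>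
    localExpr_localExpr (hφ'.cylinder_subset_target (mem_cylinder.2
      ⟨(mem_cylinder.1 hw).1.trans haa', (mem_cylinder.1 hw).2.trans haa'⟩)) (hsrc' w hw)
  have hH'H : ∀ w ∈ cylinder a₀, localExpr φ' φ h.symm (localExpr φ φ' h w) = w := fun w hw =>
    localExpr_localExpr (h := h.symm) (hφ.cylinder_subset_target (mem_cylinder.2
      ⟨(mem_cylinder.1 hw).1.trans haa, (mem_cylinder.1 hw).2.trans haa⟩)) (hsrc w hw)
  have hHτ' : localExpr φ' φ h.symm (0, (φ' (f'^[N] q')).2) = (0, (φ (f^[N] q)).2) := by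
    have e := hH'H (0, (φ (f^[N] q)).2) (mem_cylinder.2 ⟨by simpa using ha.le, hτ.le⟩)
    rwa [hHτ] at e
  have htr := hq.isTransition
  have htr' := hq'.isTransition
  obtain ⟨c₀, α, hc₀, hα, hE, hEα⟩ := exists_isFold_of_isPositiveQuadratic hk hφ hf hfi hq hpos
  obtain ⟨c₀', α', hc₀', hα', hE', hEα'⟩ :=
    exists_isFold_of_isPositiveQuadratic hk hφ' hf' hfi' hq' hpos'
  have hc0 : c₀ ≠ 0 := by rintro rfl; simp at hc₀
  have hc0' : c₀' ≠ 0 := by rintro rfl; simp at hc₀'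
  have hev := hH.eventually_conj_transition hφ hφ' hfi hconj hsrc htr hτ hz
  have hev' := hH'.eventually_conj_transition hφ' hφ hfi' hconj' hsrc' htr' hτ' hz'
  have hrad := radial_of_isFold hθ hH hH' hφ.one_lt_r hφ'.one_lt_r hφ.lam_pos hφ.lam_lt_one
    hφ'.lam_pos hφ'.lam_lt_one hE hE' hα hα' hEα hEα' hτ hτ' hHτ hHτ'
    (hev.mono fun w hw h0 => by
      rw [hw.2 ((mul_eq_zero.1 h0).resolve_left hc0), mul_zero])
    (hev'.mono fun w hw h0 => by
      rw [hw.2 ((mul_eq_zero.1 h0).resolve_left hc0'), mul_zero]) hHH' hH'H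
  -- a direction along which the returns of the unstable surface meet the stable curve
  obtain ⟨u, hu⟩ := exists_circle_inv_mul_re_pos (mul_ne_zero hα hz0)
  obtain ⟨u', huu'⟩ := exists_mem_rotationClosure (denseRange_circle_exp_zpow hθ) (Circle.exp θ') u
  have hgz0 : (localExpr φ φ' h ((φ (f.symm^[N] q)).1, 0)).1 ≠ 0 := by
    intro h0
    have e : localExpr φ φ' h ((φ (f.symm^[N] q)).1, 0) = localExpr φ φ' h 0 := by
      rw [hH.map_zero]
      exact Prod.ext h0 (by rw [hHz]; rfl)
    have m1 : ((φ (f.symm^[N] q)).1, (0 : ℝ)) ∈ cylinder a₀ :=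
      mem_cylinder.2 ⟨hz.le, by simpa using ha.le⟩
    have m2 : (0 : ℂ × ℝ) ∈ cylinder a₀ := mem_cylinder.2 (by simpa using ha.le)
    have := hH.injOn m1 m2 e
    exact hz0 (congrArg Prod.fst this)
  have hposu : 0 < (α * (u⁻¹ : Circle) * (φ (f.symm^[N] q)).1).re := by
    convert hu using 2; ring
  -- In either radial alternative, `g` carries the half-plane rotated by `u` to the one rotated by
  -- `u'`. The image of the base point thus lies strictly inside the corresponding half-plane of the
  -- second fold, the direction condition for `f'`.
  have hposu' : 0 < (α' * (u'⁻¹ : Circle) * (localExpr φ φ' h ((φ (f.symm^[N] q)).1, 0)).1).re := by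
    rcases hrad with ⟨hr1, hr2⟩ | ⟨hr1, hr2⟩
    · obtain ⟨s, hs, he⟩ := hr2 _ hz
      have hs0 : 0 < s := hs.lt_of_ne (by
        rintro rfl
        rw [Complex.ofReal_zero, zero_mul] at he
        exact mul_ne_zero hα' hgz0 he)
      have e : α' * (u⁻¹ : Circle) * (localExpr φ φ' h ((φ (f.symm^[N] q)).1, 0)).1 =
          s * (α * (u⁻¹ : Circle) * (φ (f.symm^[N] q)).1) := by
        linear_combination ((u⁻¹ : Circle) : ℂ) * he
      rw [hr1 _ _ huu', e, Complex.re_ofReal_mul]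
      exact mul_pos hs0 hposu
    · obtain ⟨s, hs, he⟩ := hr2 _ hz
      have hs0 : 0 < s := hs.lt_of_ne (by
        rintro rfl
        rw [Complex.ofReal_zero, zero_mul, map_eq_zero] at he
        exact mul_ne_zero hα' hgz0 he)
      have e : starRingEnd ℂ (α' * u * (localExpr φ φ' h ((φ (f.symm^[N] q)).1, 0)).1) =
          s * (α * (u⁻¹ : Circle) * (φ (f.symm^[N] q)).1) := by
        rw [map_mul] at he
        rw [map_mul, map_mul, ← Circle.coe_inv_eq_conj]
        linear_combination ((u⁻¹ : Circle) : ℂ) * he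
      rw [← Complex.conj_re, hr1 _ _ huu', inv_inv, e, Complex.re_ofReal_mul]
      exact mul_pos hs0 hposu
  have hb : ContDiffAt ℝ 2 (chartIterate φ f.symm (N + N)) (0, (φ (f^[N] q)).2) :=
    (htr.contDiffAt_backward hφ hfi).of_le (two_le_smoothness hk)
  have hb' : ContDiffAt ℝ 2 (chartIterate φ' f'.symm (N + N)) (0, (φ' (f'^[N] q')).2) :=
    (htr'.contDiffAt_backward hφ' hfi').of_le (two_le_smoothness hk)
  have hHc : ContinuousAt (localExpr φ φ' h) (0, (φ (f^[N] q)).2) :=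
    hH.continuousOn.continuousAt (cylinder_mem_nhds (by simpa using ha) hτ)
  have hU1 := htr.eventually_backward_bounds hφ hfi (b := a₀) (by simpa using ha) hτ hz
    (by simpa using ha)
  have hU2 : ∀ᶠ w in 𝓝 ((0 : ℂ), (φ' (f'^[N] q')).2), _ :=
    htr'.eventually_backward_bounds hφ' hfi' (b := a') (by simpa using hφ'.a_pos)
      (hτ'.trans_le haa') (hz'.trans_le haa') (by simpa using hφ'.a_pos)
  rw [← hHτ] at hU2
  have hU3 : ∀ᶠ w in 𝓝 ((0 : ℂ), (φ (f^[N] q)).2), (chartIterate φ f.symm (N + N) w).1 ≠ 0 := by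
    have c : ContinuousAt (fun w => (chartIterate φ f.symm (N + N) w).1) (0, (φ (f^[N] q)).2) :=
      continuousAt_fst.comp hb.continuousAt
    exact c.eventually_ne (by rw [htr.backward_eq]; exact hz0)
  -- The neighbourhood collects what is needed to read the return as a composite transition for both
  -- maps: chart domains, cylinder bounds, the conjugacy relation, and a nonzero disk coordinate,
  -- which keeps the homoclinic point different from `p`.
  obtain ⟨n, τ, τ', w, hτU, hwU, hw, hw0, hHτ1, hHw, hHw0, hd, hd'⟩ :=
    exists_transverse_return hH hφ.one_lt_r hφ'.one_lt_r hφ.lam_pos hφ.lam_lt_one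
      hφ'.lam_pos hφ'.lam_lt_one hE hE' hb hb' (fun w => rfl) (fun w => rfl) hc₀ hc₀' hEα hEα' hτ hHτ
      (hev.mono fun w hw => hw.1) htr.backward_eq hz huu' hposu hposu'
      (hU1.and ((hHc.eventually hU2).and (hU3.and hev)))
  obtain ⟨⟨⟨s1, s2⟩, ⟨s3, s4⟩, s5, s6⟩, ⟨⟨s1', s2'⟩, ⟨s3', s4'⟩, s5', s6'⟩, -, -⟩ := hτU
  obtain ⟨⟨⟨t1, t2⟩, ⟨t3, t4⟩, t5, t6⟩, ⟨⟨t1', t2'⟩, ⟨t3', t4'⟩, t5', t6'⟩, hζ0, hHb, -⟩ := hwU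
  rw [hHτ1] at s1' s2' s3' s4' s5' s6'
  obtain ⟨htr₂, hd₂⟩ := hφ.isTransition_return hf.continuous hfi.continuous s1 s2 (s5.trans_le haa)
    (s6.trans_le haa) hw (t3.trans_le haa) (t4.trans_le haa) t2 (Prod.ext rfl hw0) hd
  obtain ⟨htr₂', hd₂'⟩ := hφ'.isTransition_return hf'.continuous hfi'.continuous s1' s2' s5' s6'
    hHw t3' t4' t2' (Prod.ext rfl hHw0) hd'
  have hHζ : localExpr φ φ' h ((chartIterate φ f.symm (N + N) w).1, 0) =
      ((chartIterate φ' f'.symm (N + N) (localExpr φ φ' h w)).1, 0) := by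
    have e : ((chartIterate φ f.symm (N + N) w).1, (0 : ℝ)) = chartIterate φ f.symm (N + N) w :=
      Prod.ext rfl hw0.symm
    rw [e, hHb]
    exact Prod.ext rfl hHw0
  refine ⟨linear_of_radial_of_isTransition hk hφ hφ' hf hfi hf' hfi' hθ hH hsrc hconj hα hα' hrad
    t5 hζ0 s4 htr₂ htr₂' hHζ hd₂ hd₂', ?_⟩
  obtain ⟨hs, hsD⟩ := htr₂.isTransverseHomoclinic hφ hf.continuous (s4.le.trans haa)
    (t5.le.trans haa) hζ0 hd₂
  refine ⟨_, hs, hsD, hsrc _ (mem_cylinder.2 ⟨t5.le, by simpa using ha.le⟩), ?_, ?_⟩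
  · change ‖(localExpr φ φ' h _).1‖ ≤ a'
    rw [hHζ]
    exact t5'.le
  · change (localExpr φ φ' h _).2 = 0
    rw [hHζ]

end Conjugacy

/-! ### Orientation of linear and antilinear germs -/

section Orientation

theorem preservesOrientation_of_eq_mul {g : ℂ → ℂ} {C : ℂ} {R : ℝ} (hR : 0 < R) (hC : C ≠ 0)
    (hg : ∀ z, ‖z‖ < R → g z = C * z) : PreservesOrientation g := by
  refine ⟨R, hR, fun ρ hρ0 hρR => ⟨fun t => t + Complex.arg C / (2 * Real.pi), by fun_prop,
    fun t => by ring, fun t => ?_⟩⟩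
  have hn : ‖(ρ : ℂ) * Complex.exp (2 * Real.pi * t * Complex.I)‖ = ρ := by
    have : (2 * Real.pi * t * Complex.I : ℂ) = ((2 * Real.pi * t : ℝ) : ℂ) * Complex.I := by
      push_cast; ring
    rw [norm_mul, this, Complex.norm_exp_ofReal_mul_I, mul_one, Complex.norm_real,
      Real.norm_eq_abs, abs_of_pos hρ0]
  rw [hg _ (by rw [hn]; exact hρR), norm_mul, hn]
  refine ⟨mul_ne_zero hC (mul_ne_zero (by exact_mod_cast hρ0.ne') (Complex.exp_ne_zero _)), ?_⟩
  have e : (2 * Real.pi * ((t + Complex.arg C / (2 * Real.pi) : ℝ) : ℂ) * Complex.I : ℂ) =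
      2 * Real.pi * t * Complex.I + Complex.arg C * Complex.I := by
    have : (Real.pi : ℂ) ≠ 0 := by exact_mod_cast Real.pi_ne_zero
    push_cast
    field_simp
  rw [e, Complex.exp_add]
  conv_lhs => rw [← Complex.norm_mul_exp_arg_mul_I C]
  push_cast
  ring

/-- The argument of `C * conj z` decreases as that of `z` increases, so for a lift `A` the
continuous function `A t + t - A 0` takes only integer values. Winding number 1 would make it go
from 0 to 2 over one turn, hence through `1/2`. -/
theorem not_preservesOrientation_of_eq_mul_conj {g : ℂ → ℂ} {C : ℂ} {R : ℝ} (hR : 0 < R)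
    (hg : ∀ z, ‖z‖ < R → g z = C * starRingEnd ℂ z) : ¬ PreservesOrientation g := by
  rintro ⟨ε, hε, h⟩
  set ρ := min ε R / 2 with hρ
  have hm : 0 < min ε R := lt_min hε hR
  have hρ0 : 0 < ρ := by positivity
  have hρε : ρ < ε := by have := min_le_left ε R; linarith
  have hρR : ρ < R := by have := min_le_right ε R; linarith
  obtain ⟨A, hA, hA1, hgA⟩ := h ρ hρ0 hρε
  have hn : ∀ t : ℝ, ‖(ρ : ℂ) * Complex.exp (2 * Real.pi * t * Complex.I)‖ = ρ := by
    intro t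
    have : (2 * Real.pi * t * Complex.I : ℂ) = ((2 * Real.pi * t : ℝ) : ℂ) * Complex.I := by
      push_cast; ring
    rw [norm_mul, this, Complex.norm_exp_ofReal_mul_I, mul_one, Complex.norm_real,
      Real.norm_eq_abs, abs_of_pos hρ0]
  have hgt : ∀ t : ℝ, g (ρ * Complex.exp (2 * Real.pi * t * Complex.I)) =
      C * ρ * Complex.exp (-(2 * Real.pi * t * Complex.I)) := by
    intro t
    have e : starRingEnd ℂ (2 * Real.pi * t * Complex.I : ℂ) = -(2 * Real.pi * t * Complex.I) := by
      have : (2 * Real.pi * t * Complex.I : ℂ) = ((2 * Real.pi * t : ℝ) : ℂ) * Complex.I := by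
        push_cast; ring
      rw [this, map_mul, Complex.conj_ofReal, Complex.conj_I, mul_neg]
    rw [hg _ (by rw [hn]; exact hρR), map_mul, Complex.conj_ofReal, ← Complex.exp_conj, e, mul_assoc C]
  have hgn : ∀ t : ℝ, ‖g (ρ * Complex.exp (2 * Real.pi * t * Complex.I))‖ = ‖C‖ * ρ := by
    intro t
    rw [hg _ (by rw [hn]; exact hρR), norm_mul, Complex.norm_conj, hn]
  have hC : C ≠ 0 := by
    rintro rfl
    have := (hgA 0).1
    rw [hgt] at this
    simp at this
  -- the sum of the argument and the parameter is constant
  have key : ∀ t : ℝ, Complex.exp (2 * Real.pi * (A t + t) * Complex.I) = C / ‖C‖ := by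
    intro t
    have h1 := (hgA t).2
    rw [hgn, hgt] at h1
    have h2 : (2 * Real.pi * (A t + t) * Complex.I : ℂ) =
        2 * Real.pi * A t * Complex.I + 2 * Real.pi * t * Complex.I := by ring
    have hCn : (‖C‖ : ℂ) ≠ 0 := by exact_mod_cast (norm_pos_iff.2 hC).ne'
    have hρc : (ρ : ℂ) ≠ 0 := by exact_mod_cast hρ0.ne'
    rw [h2, Complex.exp_add, eq_div_iff hCn]
    have h3 : Complex.exp (-(2 * Real.pi * t * Complex.I)) *
        Complex.exp (2 * Real.pi * t * Complex.I) = 1 := by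
      rw [← Complex.exp_add, neg_add_cancel, Complex.exp_zero]
    apply mul_left_cancel₀ hρc
    push_cast at h1
    linear_combination C * ρ * h3 - Complex.exp (2 * Real.pi * t * Complex.I) * h1
  have hint : ∀ t : ℝ, ∃ n : ℤ, A t + t - A 0 = n := by
    intro t
    have h1 := (key t).trans (key 0).symm
    obtain ⟨n, hn⟩ := Complex.exp_eq_exp_iff_exists_int.1 h1
    refine ⟨n, ?_⟩
    have hpi : (2 * Real.pi * Complex.I : ℂ) ≠ 0 := Complex.two_pi_I_ne_zero
    have : ((A t + t - A 0 : ℝ) : ℂ) = n := by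
      apply mul_left_cancel₀ hpi
      push_cast at hn ⊢
      linear_combination hn
    exact_mod_cast this
  have hcont : Continuous fun t : ℝ => A t + t - A 0 := by fun_prop
  have hone : A 1 + 1 - A 0 = 2 := by
    have := hA1 0
    rw [zero_add] at this
    linarith
  obtain ⟨t, -, ht⟩ := intermediate_value_Icc (zero_le_one (α := ℝ)) hcont.continuousOn
    (show (1 / 2 : ℝ) ∈ Set.Icc _ _ by rw [hone]; constructor <;> norm_num)
  obtain ⟨n, hn⟩ := hint t
  simp only at ht
  rw [ht] at hn
  have h2 : (2 * n : ℝ) = 1 := by linarith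
  have h3 : 2 * n = 1 := by exact_mod_cast h2
  omega

end Orientation

/-! ### Ratios of unstable coordinates -/

section Ratio

variable {M : Type*} [TopologicalSpace M] [T2Space M] [ChartedSpace E3 M] {k : ℕ∞} {f f' : M ≃ M}
  {p p' q s : M} {r r' θ θ' lam lam' a a' a₀ : ℝ} {φ φ' : OpenPartialHomeomorph M (ℂ × ℝ)}

theorem IsLinearizingChart.zRatio_iterate (hφ : IsLinearizingChart k f p r θ lam a φ)
    (hf : Continuous f) (hq : q ∈ unstableDisk φ a) (hs : s ∈ unstableDisk φ a) (n : ℕ) :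
    zRatio φ (f.symm^[n] q) (f.symm^[n] s) = zRatio φ q s := by
  rw [zRatio, zRatio, (hφ.map_disk_inv hf hq n).2, (hφ.map_disk_inv hf hs n).2]
  exact mul_div_mul_left _ _ (pow_ne_zero _ (inv_ne_zero hφ.mult_ne_zero))

theorem IsLinearizingChart.eventually_lt (hφ : IsLinearizingChart k f p r θ lam a φ)
    (hf : Continuous f) (hs : s ∈ unstableDisk φ a) (ha : 0 < a₀) :
    ∀ᶠ n : ℕ in atTop, ‖(φ (f.symm^[n] s)).1‖ < a₀ := by
  have hc : ContinuousAt (fun x => ‖(φ x).1‖) p :=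
    (continuousAt_fst.comp (φ.continuousAt hφ.mem_source)).norm
  refine (hc.tendsto.comp (hφ.tendsto_iterate_symm_of_mem_unstableDisk hf hs)).eventually_lt_const ?_
  simpa [hφ.map_base] using ha

/-- Ratios of unstable coordinates may be computed arbitrarily close to the fixed point. -/
theorem exists_zRatio_eq (hφ : IsLinearizingChart k f p r θ lam a φ)
    (hφ' : IsLinearizingChart k f' p' r' θ' lam' a' φ') (hf : Continuous f) (hf' : Continuous f')
    {h : M → M} (hconj : ∀ x, h (f x) = f' (h x)) (hqp : q ≠ p) (ha : 0 < a₀)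
    (hq : q ∈ unstableDisk φ a) (hs : s ∈ unstableDisk φ a) (hq' : h q ∈ unstableDisk φ' a')
    (hs' : h s ∈ unstableDisk φ' a') :
    ∃ z w : ℂ, ‖z‖ < a₀ ∧ ‖w‖ < a₀ ∧ z ≠ 0 ∧ zRatio φ q s = w / z ∧
      zRatio φ' (h q) (h s) = unstableExpr φ φ' h w / unstableExpr φ φ' h z := by
  obtain ⟨n, hn1, hn2⟩ := ((hφ.eventually_lt hf hq ha).and (hφ.eventually_lt hf hs ha)).exists
  have hexpr : ∀ x ∈ unstableDisk φ a,
      unstableExpr φ φ' h (φ (f.symm^[n] x)).1 = (φ' (f'.symm^[n] (h x))).1 := by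
    intro x hx
    obtain ⟨hx1, hx2⟩ := hφ.map_disk_inv hf hx n
    have e : ((φ (f.symm^[n] x)).1, (0 : ℝ)) = φ (f.symm^[n] x) := Prod.ext rfl hx1.2.2.symm
    have hconji : Function.Semiconj h f.symm f'.symm := fun x => by
      rw [Equiv.eq_symm_apply, ← hconj, f.apply_symm_apply]
    rw [unstableExpr, e, φ.left_inv hx1.1, (hconji.iterate_right n).eq]
  refine ⟨(φ (f.symm^[n] q)).1, (φ (f.symm^[n] s)).1, hn1, hn2, ?_,
    (hφ.zRatio_iterate hf hq hs n).symm, ?_⟩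
  · rw [(hφ.map_disk_inv hf hq n).2]
    exact mul_ne_zero (pow_ne_zero _ (inv_ne_zero hφ.mult_ne_zero))
      (hφ.fst_ne_zero_of_mem_unstableDisk hq hqp)
  · rw [hexpr q hq, hexpr s hs]
    exact (hφ'.zRatio_iterate hf' hq' hs' n).symm

end Ratio

/-! ### The modulus -/

theorem corollaryC {M : Type*} [TopologicalSpace M] [T2Space M] [SecondCountableTopology M]
    [ChartedSpace E3 M] (k : ℕ∞) (hk : 3 ≤ k) [IsManifold 𝓘(ℝ, E3) k M]
    (f f' : M ≃ₘ^k⟮𝓘(ℝ, E3), 𝓘(ℝ, E3)⟯ M) (p p' q q' : M)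
    (r θ lam a r' θ' lam' a' : ℝ) (φ φ' : OpenPartialHomeomorph M (ℂ × ℝ))
    (hφ : IsLinearizingChart k f.toEquiv p r θ lam a φ)
    (hφ' : IsLinearizingChart k f'.toEquiv p' r' θ' lam' a' φ')
    (hq : IsQuadraticTangency f.toEquiv p φ a q)
    (hq' : IsQuadraticTangency f'.toEquiv p' φ' a' q')
    (hqpos : IsPositivelyAssociated f.toEquiv φ a q)
    (hqpos' : IsPositivelyAssociated f'.toEquiv φ' a' q')
    (hqD : q ∈ unstableDisk φ a) (hqD' : q' ∈ unstableDisk φ' a')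
    (hθ : Irrational (θ / (2 * Real.pi)))
    (h : M ≃ₜ M) (hconj : ∀ x, h (f x) = f' (h x)) (hp : h p = p') (hhq : h q = q') :
    (∃ s, IsTransverseHomoclinic f.toEquiv p φ a s ∧
      s ∈ unstableDisk φ a ∧ h s ∈ unstableDisk φ' a') ∧
    ∀ s, IsTransverseHomoclinic f.toEquiv p φ a s →
      s ∈ unstableDisk φ a → h s ∈ unstableDisk φ' a' →
      (PreservesOrientation (unstableExpr φ φ' h) → zRatio φ q s = zRatio φ' q' (h s)) ∧
      (¬ PreservesOrientation (unstableExpr φ φ' h) →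
        zRatio φ q s = starRingEnd ℂ (zRatio φ' q' (h s))) ∧
      s(zRatio φ q s, starRingEnd ℂ (zRatio φ q s)) =
        s(zRatio φ' q' (h s), starRingEnd ℂ (zRatio φ' q' (h s))) := by
  have hfc : ContMDiff 𝓘(ℝ, E3) 𝓘(ℝ, E3) k f.toEquiv := f.contMDiff
  have hfi : ContMDiff 𝓘(ℝ, E3) 𝓘(ℝ, E3) k f.toEquiv.symm := f.symm.contMDiff
  have hfc' : ContMDiff 𝓘(ℝ, E3) 𝓘(ℝ, E3) k f'.toEquiv := f'.contMDiff
  have hfi' : ContMDiff 𝓘(ℝ, E3) 𝓘(ℝ, E3) k f'.toEquiv.symm := f'.symm.contMDiff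
  have hc : ∀ x, h (f.toEquiv x) = f'.toEquiv (h x) := hconj
  have hc' : ∀ x, h.symm (f'.toEquiv x) = f.toEquiv (h.symm x) := fun x => by
    rw [Homeomorph.symm_apply_eq, hc, h.apply_symm_apply]
  obtain ⟨a₀, ha₀, hex⟩ := exists_isLocalConj hφ hφ' hfc.continuous h hc hp
  obtain ⟨a₀', ha₀', hex'⟩ := exists_isLocalConj hφ' hφ hfc'.continuous h.symm hc' (by
    rw [Homeomorph.symm_apply_eq, hp])
  obtain ⟨haa, hH, hsrc⟩ := hex a₀ ha₀ le_rfl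
  obtain ⟨haa', hH', hsrc'⟩ := hex' a₀' ha₀' le_rfl
  obtain ⟨N, hN⟩ := exists_isHomoclinicAt_lt hk hφ hfc.continuous hfi hq hqpos ha₀
  obtain ⟨N', hN'⟩ := exists_isHomoclinicAt_lt hk hφ' hfc'.continuous hfi' hq' hqpos' ha₀'
  -- The same number of iterates is used for `q` and `q'`, so that `h` matches the two base points
  -- on the stable segments and on the unstable disks.
  obtain ⟨h1, h2, h3, h4⟩ := hN (max N N') (le_max_left _ _)
  obtain ⟨h1', h2', h3', h4'⟩ := hN' (max N N') (le_max_right _ _)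
  obtain ⟨⟨C, hC, hlin⟩, hex⟩ := exists_linear_and_isTransverseHomoclinic (h := h.toEquiv) hk hφ hφ'
    hfc hfi hfc' hfi' hθ hc hhq haa haa' hH hsrc hH' hsrc' hq.1.1 h1 h2 h1' h2' h3 h4 h3' h4'
  refine ⟨hex, fun s _ hsD hsD' => ?_⟩
  obtain ⟨z, w, hz, hw, hz0, hr1, hr2⟩ := exists_zRatio_eq hφ hφ' hfc.continuous hfc'.continuous hc
    hq.1.1 ha₀ hqD hsD (by rwa [hhq]) hsD'
  rw [hhq] at hr2
  -- The form of the conjugacy on the disk decides whether orientation is preserved, so in each case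
  -- one of the two implications is vacuous. The constant `C` cancels in the ratio.
  rcases hlin with hlin | hlin
  · have hor : PreservesOrientation (unstableExpr φ φ' h) :=
      preservesOrientation_of_eq_mul ha₀ hC hlin
    have e : zRatio φ q s = zRatio φ' q' (h s) := by
      rw [hr1, hr2, show unstableExpr φ φ' h w = C * w from hlin w hw,
        show unstableExpr φ φ' h z = C * z from hlin z hz, mul_div_mul_left _ _ hC]
    exact ⟨fun _ => e, fun hn => absurd hor hn, by rw [e]⟩
  · have hor : ¬ PreservesOrientation (unstableExpr φ φ' h) :=
      not_preservesOrientation_of_eq_mul_conj ha₀ hlin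
    have e : zRatio φ q s = starRingEnd ℂ (zRatio φ' q' (h s)) := by
      rw [hr1, hr2, show unstableExpr φ φ' h w = C * starRingEnd ℂ w from hlin w hw,
        show unstableExpr φ φ' h z = C * starRingEnd ℂ z from hlin z hz, mul_div_mul_left _ _ hC,
        map_div₀, Complex.conj_conj, Complex.conj_conj]
    exact ⟨fun hn => absurd hn hor, fun _ => e, by rw [e, Complex.conj_conj, Sym2.eq_swap]⟩
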